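/- Let $G=(V,E)$ be a finite simple graph with $V=\{0,\dots,n-1\}$ and $|V|=n$. A set $S\subseteq V$ is an *induced subtree* if $G[S]$ is acyclic and any two of its vertices are connected by a path in $G[S]$ (so $\emptyset$ is an induced subtree). Let $N$ be the number of induced subtrees of $G$. The *degeneracy* $k$ of $G$ is the least $d$ such that every nonempty induced subgraph of $G$ has a vertex of degree at most $d$. A *Matula–Beck ordering* is a linear ordering $<$ of $V$ in which each vertex $u$ has minimum degree in $G[\{w: w\ge u\}]$. Write $N(u)$ for the set of neighbours of $u$, $N'(u)=\{v\in N(u): v>u\}$ and $\Gamma(u,X)=\{v\in N(u): v\notin X,\ v<u\}$. For an ordering $<$, the *improved binary partition algorithm* is the following recursive procedure $\mathrm{ISE}(S,\mathrm{CAND},X)$, called first as $\mathrm{ISE}(\emptyset,V,\emptyset)$. If $\mathrm{CAND}=\emptyset$, output $S$ and return. Otherwise let $u$ be the smallest element of $\mathrm{CAND}$; call $\mathrm{ISE}(S,\mathrm{CAND}\setminus\{u\},X\cup\{u\})$, and then call $\mathrm{ISE}(S\cup\{u\},\mathrm{CAND}',X')$, where $$\mathrm{CAND}'=\bigl((\mathrm{CAND}\setminus\{u\})\setminus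 N(u)\bigr)\cup\bigl(N'(u)\setminus(\mathrm{CAND}\cup X)\bigr)\cup\Gamma(u,X),\qquad X'=X\cup\{u\}\cup(\mathrm{CAND}\cap N(u))$$ if $S\ne\emptyset$, and $\mathrm{CAND}'=(N'(u)\setminus X)\cup\Gamma(u,X)$, $X'=X\cup\{u\}$ if $S=\emptyset$. The machine model is a random access machine with a fixed finite number of registers. Its instructions are constants, copying, addition, truncated subtraction, load, store and comparison, with structured control flow; each instruction and each test takes one step. It writes to a write-only output stream symbols "insert $v$", "delete $v$" and "report the current set" (the current set is empty at first), one step per symbol, so that solutions are output as differences. The input is $n$ together with the adjacency lists of $G$, each in arbitrary order, stored consecutively and accessed through an array of pointers. **Theorem.** There are a program consisting of a preprocessing part followed by an enumeration part, and a constant $C$, such that for every finite simple graph $G$ as above and every choice of its adjacency lists: 1. The preprocessing part terminates after at most $C(|V|+|E|+1)$ steps without output. It leaves in memory the vertex sequence of a Matula–Beck ordering of $G$ and the adjacency lists of $G$ sorted by this ordering. 2. The enumeration part then terminates, and the sequence of reported sets is exactly the output sequence of the improved binary partition algorithm for this ordering. It contains every induced subtree of $G$ exactly once and nothing else. 3.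 The enumeration part takes at most $C\cdot\max(1,k)\cdot N$ steps, that is, $O(\max(1,k))$ amortized time per solution. 4. Over the whole run, all memory cells accessed have addresses below $C(|V|+|E|+1)$, and all numbers written are at most $C(|V|+|E|+1)$; so the space is $O(|V|+|E|+1)$ words of $O(\log(|V|+|E|+2))$ bits. -/

import Mathlib

namespace InducedSubtrees

/-! ## Graphs: induced subtrees, degeneracy, smallest-last orderings -/

section Graphs

variable {V : Type*}

/-- `S` is an induced subtree of `G`: the induced subgraph `G[S]` is acyclic and any two of its
vertices are connected by a path. The empty set is an induced subtree. -/
def IsInducedSubtree (G : SimpleGraph V) (S : Finset V) : Prop :=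
  (G.induce (S : Set V)).Preconnected ∧ (G.induce (S : Set V)).IsAcyclic

open Classical in
/-- The number of vertices of `S` adjacent to `v`; for `v ∈ S` this is the degree of `v` in the
induced subgraph `G[S]`. -/
noncomputable def adjCount (G : SimpleGraph V) (S : Finset V) (v : V) : ℕ :=
  (S.filter (fun w => G.Adj v w)).card

/-- `G` is `d`-degenerate: every (nonempty) induced subgraph has a vertex of degree at most `d`. -/
def IsDegenerate (G : SimpleGraph V) (d : ℕ) : Prop :=
  ∀ S : Finset V, S.Nonempty → ∃ v ∈ S, adjCount G S v ≤ d

/-- The degeneracy of a finite graph: the least `d` for which it is `d`-degenerate. -/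
noncomputable def degeneracy (G : SimpleGraph V) : ℕ :=
  sInf {d : ℕ | IsDegenerate G d}

variable {n : ℕ}

/-- A Matula–Beck (smallest-last) ordering; `pos v` is the position of the vertex `v`. Every
vertex `u` has minimum degree in the subgraph induced by `u` and the vertices after it. -/
def IsMatulaBeckOrder [Fintype V] (G : SimpleGraph V) (pos : V ≃ Fin n) : Prop :=
  ∀ u v : V, pos u ≤ pos v →
    adjCount G (Finset.univ.filter (fun w => pos u ≤ pos w)) u ≤
      adjCount G (Finset.univ.filter (fun w => pos u ≤ pos w)) v

/-! ## The improved binary partition procedure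

`CAND` is the candidate set, `X` the forbidden set, and `u` the smallest candidate. -/

open Classical in
/-- The neighbourhood `N(u)`. -/
noncomputable def nbrs [Fintype V] (G : SimpleGraph V) (u : V) : Finset V :=
  Finset.univ.filter (fun v => G.Adj u v)

/-- The set `N'(u)` of neighbours of `u` after `u` in the ordering. -/
noncomputable def laterNbrs [Fintype V] (G : SimpleGraph V) (pos : V ≃ Fin n) (u : V) : Finset V :=
  (nbrs G u).filter (fun v => pos u < pos v)

open Classical in
/-- `Γ(u, X)`: the neighbours of `u` before `u` in the ordering that are not in `X`. -/
noncomputable def Gam [Fintype V] (G : SimpleGraph V) (pos : V ≃ Fin n) (u : V) (X : Finset V) :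
    Finset V :=
  (nbrs G u).filter (fun v => v ∉ X ∧ pos v < pos u)

open Classical in
/-- The candidate set after `u` has been moved from `CAND` to `S`. If `S` is empty, every vertex
outside `X` is a candidate without being adjacent to `S`, and then the candidates
for `{u}` are the neighbours of `u` outside `X`. -/
noncomputable def newCand [Fintype V] (G : SimpleGraph V) (pos : V ≃ Fin n)
    (S CAND X : Finset V) (u : V) : Finset V :=
  if S = ∅ then (laterNbrs G pos u \ X) ∪ Gam G pos u X
  else (CAND.erase u \ nbrs G u) ∪ ((laterNbrs G pos u \ (CAND ∪ X)) ∪ Gam G pos u X)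

open Classical in
/-- The forbidden set after `u` has been moved from `CAND` to `S`. If `S` is empty, the candidates
adjacent to `u` remain addible. -/
noncomputable def newForbidden [Fintype V] (G : SimpleGraph V)
    (S CAND X : Finset V) (u : V) : Finset V :=
  if S = ∅ then insert u X else insert u X ∪ (CAND ∩ nbrs G u)

open Classical in
/-- `ISE G pos S CAND X L`: the recursive procedure called with `S`, `CAND`, `X` terminates
and outputs the list `L`. If there is no candidate it outputs `S`. Otherwise it takes the smallest
candidate `u` and calls itself first without and then with `u`. -/
inductive ISE [Fintype V] (G : SimpleGraph V) (pos : V ≃ Fin n) :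
    Finset V → Finset V → Finset V → List (Finset V) → Prop
  | leaf (S X : Finset V) : ISE G pos S ∅ X [S]
  | branch (S CAND X : Finset V) (u : V) (L₁ L₂ : List (Finset V))
      (hu : u ∈ CAND) (hmin : ∀ v ∈ CAND, pos u ≤ pos v)
      (h₁ : ISE G pos S (CAND.erase u) (insert u X) L₁)
      (h₂ : ISE G pos (insert u S) (newCand G pos S CAND X u) (newForbidden G S CAND X u) L₂) :
      ISE G pos S CAND X (L₁ ++ L₂)

/-! ## Adjacency lists -/

/-- `adj v` lists the neighbours of `v`, each once, in an arbitrary order. -/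
def IsAdjacencyList (G : SimpleGraph V) (adj : V → List V) : Prop :=
  ∀ v, (adj v).Nodup ∧ ∀ w, w ∈ adj v ↔ G.Adj v w

/-- The adjacency lists of `0, 1, …, n - 1`, one after the other. -/
def flatAdj (adj : Fin n → List (Fin n)) : List ℕ :=
  (List.finRange n).flatMap (fun v => (adj v).map Fin.val)

/-- The input of a graph on `n` vertices: `n`, then `n + 1` pointers, then the adjacency lists one
after the other. For `v < n`, pointer number `v` is the address at which the list of `v` starts;
the last pointer is the first address after all lists. -/
def adjInput (adj : Fin n → List (Fin n)) : List ℕ :=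
  n :: ((List.range (n + 1)).map
    (fun i => n + 2 + (((List.finRange n).take i).map (fun v => (adj v).length)).sum)
      ++ flatAdj adj)

end Graphs

/-! ## Random access machine with unit cost

Structured programs over registers and a random access memory, both holding natural numbers.
A write-only output stream receives differences between successive solutions: "insert `v`",
"delete `v`" and "report the current set". -/

/-- Symbols of the output stream. -/
inductive Event where
  | ins (v : ℕ)
  | del (v : ℕ)
  | report

/-- The list of sets reported by an output stream, if `cur` is the current set at its start. -/
def reportedFrom (cur : Finset ℕ) : List Event → List (Finset ℕ)
  | [] => []
  | Event.ins v :: l => reportedFrom (insert v cur) l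
  | Event.del v :: l => reportedFrom (cur.erase v) l
  | Event.report :: l => cur :: reportedFrom cur l

/-- The list of sets reported by an output stream; the current set is empty at first. -/
def reported (l : List Event) : List (Finset ℕ) := reportedFrom ∅ l

/-- A state of the machine with its meters: `time` is the number of steps so far, `space` is
one more than the largest address accessed so far (`0` if there was none), and `width` is the
largest number written to a register so far. Numbers reach the memory and
the output stream only from registers, and every address is the content of a register. -/
structure State where
  reg : ℕ → ℕ
  mem : ℕ → ℕ
  out : List Event
  time : ℕ
  space : ℕ
  width : ℕ

/-- The initial state: the input occupies the first memory cells, everything else is zero. -/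
def State.init (input : List ℕ) : State where
  reg := fun _ => 0
  mem := fun i => input.getD i 0
  out := []
  time := 0
  space := 0
  width := 0

/-- One more time step. -/
def State.tick (s : State) : State := { s with time := s.time + 1 }

/-- Write `a` to register `x`. -/
def State.setReg (s : State) (x a : ℕ) : State :=
  { s with reg := Function.update s.reg x a, width := max s.width a }

/-- Write `a` to the memory cell with address `i`. -/
def State.setMem (s : State) (i a : ℕ) : State :=
  { s with mem := Function.update s.mem i a }

/-- Record an access to the memory cell with address `i`. -/
def State.touch (s : State) (i : ℕ) : State := { s with space := max s.space (i + 1) }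

/-- Append a symbol to the output stream. -/
def State.emit (s : State) (e : Event) : State := { s with out := s.out ++ [e] }

/-- Elementary instructions. The arguments are register numbers, except for `c` in `const x c`. -/
inductive Instr where
  | const (x c : ℕ)
  | copy (x y : ℕ)
  | add (x y z : ℕ)
  | sub (x y z : ℕ)
  | load (x y : ℕ)
  | store (x y : ℕ)
  | ins (x : ℕ)
  | del (x : ℕ)
  | report

/-- The effect of an elementary instruction; each takes one step. Subtraction is truncated. -/
def Instr.run : Instr → State → State
  | .const x c, s => (s.setReg x c).tick
  | .copy x y, s => (s.setReg x (s.reg y)).tick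
  | .add x y z, s => (s.setReg x (s.reg y + s.reg z)).tick
  | .sub x y z, s => (s.setReg x (s.reg y - s.reg z)).tick
  | .load x y, s => ((s.touch (s.reg y)).setReg x (s.mem (s.reg y))).tick
  | .store x y, s => ((s.touch (s.reg x)).setMem (s.reg x) (s.reg y)).tick
  | .ins x, s => (s.emit (Event.ins (s.reg x))).tick
  | .del x, s => (s.emit (Event.del (s.reg x))).tick
  | .report, s => (s.emit Event.report).tick

/-- Programs. `ite x y p q` and `loop x y p` test whether register `x` holds a smaller number than
register `y`. -/
inductive Prog where
  | instr (i : Instr)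
  | seq (p q : Prog)
  | ite (x y : ℕ) (p q : Prog)
  | loop (x y : ℕ) (p : Prog)

/-- `Exec p s t`: the program `p`, started in state `s`, terminates in state `t`. Each elementary
instruction and each evaluation of a test takes one step. -/
inductive Exec : Prog → State → State → Prop
  | instr (i : Instr) (s : State) : Exec (.instr i) s (i.run s)
  | seq {p q : Prog} {s t r : State} (hp : Exec p s t) (hq : Exec q t r) : Exec (.seq p q) s r
  | ite_true {x y : ℕ} {p q : Prog} {s t : State} (h : s.reg x < s.reg y)
      (hp : Exec p s.tick t) : Exec (.ite x y p q) s t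
  | ite_false {x y : ℕ} {p q : Prog} {s t : State} (h : ¬ s.reg x < s.reg y)
      (hq : Exec q s.tick t) : Exec (.ite x y p q) s t
  | loop_true {x y : ℕ} {p : Prog} {s t r : State} (h : s.reg x < s.reg y)
      (hp : Exec p s.tick t) (hl : Exec (.loop x y p) t r) : Exec (.loop x y p) s r
  | loop_false {x y : ℕ} {p : Prog} {s : State} (h : ¬ s.reg x < s.reg y) :
      Exec (.loop x y p) s s.tick

/-- The memory contains the list `l` in consecutive cells, starting at some address. -/
def State.Stores (s : State) (l : List ℕ) : Prop :=
  ∃ a : ℕ, ∀ (i : ℕ) (hi : i < l.length), s.mem (a + i) = l[i]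

end InducedSubtrees

namespace InducedSubtrees

/-! ## A small imperative language on top of the machine

The memory is divided into a raw region `[0, β)` and sixteen interleaved arrays: entry `i` of
array `k < 16` has the address `β + 16 * i + k`. -/

/-! Correctness of the procedure. In a call with `S`, `CAND`, `X` the sets still to be reported are
the induced subtrees `T ⊇ S` with `T \ S` disjoint from `X`. If `S` is nonempty, the candidates are
exactly the vertices outside `X` adjacent to `S`, and each has a unique neighbour in `S`; adding
such a vertex gives a tree again. A vertex with two neighbours in a connected set would close a
cycle, so a candidate adjacent to the included vertex can be forbidden for good. When no candidate
is left, connectedness forces `T = S`. The two branches are the trees without and with `u`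
(`ISE.correct`).

Time. Let `K = max 1 k`. In a Matula–Beck ordering every vertex has at most `k` later neighbours,
but the number of its earlier neighbours is not bounded in terms of `k`. Call a vertex fresh if it
is neither a candidate nor forbidden. For every `w` a doubly linked list of its fresh earlier
neighbours is maintained, and the candidates form a sorted linked list. Including `u` merges its
later neighbours with the old candidate list `C₀` and then moves its fresh earlier neighbours to the
front; a vertex that stops being fresh must be unlinked from the lists of its at most `K` later
neighbours. If `C` is the new candidate list, then every vertex that stops being fresh is in `C`,
and `|C₀| ≤ |C| + K`, so the inclusion costs `O(K + K |C|)` (`includeStep_exec`). All writes are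
logged on a trail, and undoing them has the same cost. Since a call with `C` reports at least `|C| +
1` sets, this is `O(K)` per solution; the precise form is an inequality in which each call leaves
`56 K |C| + 112 K` steps of its budget unspent (`call_correct`, `return_correct`).

For `S = ∅` the excluding calls come first, so the roots are in effect treated from the largest to
the smallest: when `r` is treated, the vertices after `r` are fresh and those before `r` are
forbidden (`rootStep_wp`).

Space. The trail length plus the potential `pot` of the fresh vertices plus the length of the
candidate list does not grow along a branch, which bounds the trail linearly.

Preprocessing. Vertices are kept in buckets by the number of neighbours left, and one with the least
number is placed next. On being placed it is appended to the lists of its neighbours, so all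
adjacency lists come out sorted by the ordering in linear time (`sortEdge_exec`, `select_exec`,
`preprocess_exec`).

The programs are written in a small language with expressions and arrays, which is compiled to the
machine with constant overhead (`HExec.code_exec`). Recursion becomes a single loop with an explicit
stack. -/

/-- Expressions over registers, constants, array entries and raw memory cells. -/
inductive Expr where
  | reg (r : ℕ)
  | const (c : ℕ)
  | add (a b : Expr)
  | sub (a b : Expr)
  | fld (k i : Expr)
  | raw (i : Expr)

/-- States of the language. -/
@[ext] structure HState where
  reg : ℕ → ℕ
  fld : ℕ → ℕ → ℕ
  raw : ℕ → ℕ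
  out : List Event
  time : ℕ

namespace HState

def tick (s : HState) : HState := { s with time := s.time + 1 }

def setReg (s : HState) (r v : ℕ) : HState :=
  { s with reg := Function.update s.reg r v, time := s.time + 1 }

def setFld (s : HState) (k i v : ℕ) : HState :=
  { s with fld := Function.update s.fld k (Function.update (s.fld k) i v), time := s.time + 1 }

def setRaw (s : HState) (i v : ℕ) : HState :=
  { s with raw := Function.update s.raw i v, time := s.time + 1 }

def emit (s : HState) (e : Event) : HState :=
  { s with out := s.out ++ [e], time := s.time + 1 }

variable (s : HState) (r r' k k' i v : ℕ) (e : Event)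

@[simp] theorem tick_reg : s.tick.reg = s.reg := rfl
@[simp] theorem tick_fld : s.tick.fld = s.fld := rfl
@[simp] theorem tick_raw : s.tick.raw = s.raw := rfl
@[simp] theorem tick_out : s.tick.out = s.out := rfl
@[simp] theorem tick_time : s.tick.time = s.time + 1 := rfl
@[simp] theorem setReg_reg : (s.setReg r v).reg r' = if r' = r then v else s.reg r' := by
  simp [setReg, Function.update_apply]
@[simp] theorem setReg_fld : (s.setReg r v).fld = s.fld := rfl
@[simp] theorem setReg_raw : (s.setReg r v).raw = s.raw := rfl
@[simp] theorem setReg_out : (s.setReg r v).out = s.out := rfl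
@[simp] theorem setReg_time : (s.setReg r v).time = s.time + 1 := rfl
@[simp] theorem setFld_reg : (s.setFld k i v).reg = s.reg := rfl
@[simp] theorem setFld_fld : (s.setFld k i v).fld k' =
    if k' = k then Function.update (s.fld k) i v else s.fld k' := by
  simp [setFld, Function.update_apply]
@[simp] theorem setFld_raw : (s.setFld k i v).raw = s.raw := rfl
@[simp] theorem setFld_out : (s.setFld k i v).out = s.out := rfl
@[simp] theorem setFld_time : (s.setFld k i v).time = s.time + 1 := rfl
@[simp] theorem setRaw_reg : (s.setRaw i v).reg = s.reg := rfl
@[simp] theorem setRaw_fld : (s.setRaw i v).fld = s.fld := rfl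
@[simp] theorem setRaw_raw : (s.setRaw i v).raw = Function.update s.raw i v := rfl
@[simp] theorem setRaw_out : (s.setRaw i v).out = s.out := rfl
@[simp] theorem setRaw_time : (s.setRaw i v).time = s.time + 1 := rfl
@[simp] theorem emit_reg : (s.emit e).reg = s.reg := rfl
@[simp] theorem emit_fld : (s.emit e).fld = s.fld := rfl
@[simp] theorem emit_raw : (s.emit e).raw = s.raw := rfl
@[simp] theorem emit_out : (s.emit e).out = s.out ++ [e] := rfl
@[simp] theorem emit_time : (s.emit e).time = s.time + 1 := rfl

/-- All numbers in the state are at most `B`. -/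
structure Bounded (B : ℕ) (s : HState) : Prop where
  reg : ∀ r, s.reg r ≤ B
  fld : ∀ k i, s.fld k i ≤ B
  raw : ∀ i, s.raw i ≤ B

end HState

namespace Expr

/-- The value of an expression. -/
@[simp] def eval (s : HState) : Expr → ℕ
  | reg r => s.reg r
  | const c => c
  | add a b => a.eval s + b.eval s
  | sub a b => a.eval s - b.eval s
  | fld k i => s.fld (k.eval s) (i.eval s)
  | raw i => s.raw (i.eval s)

/-- No value above `B` is computed, and all memory accesses stay within their regions. -/
@[simp] def Ok (B β : ℕ) (s : HState) : Expr → Prop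
  | reg _ => True
  | const c => c ≤ B
  | add a b => a.Ok B β s ∧ b.Ok B β s ∧ a.eval s + b.eval s ≤ B
  | sub a b => a.Ok B β s ∧ b.Ok B β s
  | fld k i => k.Ok B β s ∧ i.Ok B β s ∧ k.eval s < 16
  | raw i => i.Ok B β s ∧ i.eval s < β

theorem eval_le {B β : ℕ} {s : HState} (hs : s.Bounded B) : ∀ e : Expr, e.Ok B β s → e.eval s ≤ B
  | reg r, _ => hs.reg r
  | const _, h => h
  | add _ _, h => h.2.2
  | sub a _, h => (Nat.sub_le _ _).trans (eval_le hs a h.1)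
  | fld _ _, _ => hs.fld _ _
  | raw _, _ => hs.raw _

end Expr

/-- Structured programs over expressions. -/
inductive HProg where
  | skip
  | assign (r : ℕ) (e : Expr)
  | store (k i e : Expr)
  | storeRaw (i e : Expr)
  | ins (e : Expr)
  | del (e : Expr)
  | report
  | seq (p q : HProg)
  | ite (a b : Expr) (p q : HProg)
  | while (a b : Expr) (p : HProg)

/-- Big-step semantics, one time step for each statement and each test. -/
inductive HExec (B β : ℕ) : HProg → HState → HState → Prop
  | skip (s) : HExec B β .skip s s.tick
  | assign {r e s} (h : e.Ok B β s) : HExec B β (.assign r e) s (s.setReg r (e.eval s))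
  | store {k i e s} (hk : k.Ok B β s) (hi : i.Ok B β s) (he : e.Ok B β s) (h : k.eval s < 16) :
      HExec B β (.store k i e) s (s.setFld (k.eval s) (i.eval s) (e.eval s))
  | storeRaw {i e s} (hi : i.Ok B β s) (he : e.Ok B β s) (h : i.eval s < β) :
      HExec B β (.storeRaw i e) s (s.setRaw (i.eval s) (e.eval s))
  | ins {e s} (h : e.Ok B β s) : HExec B β (.ins e) s (s.emit (.ins (e.eval s)))
  | del {e s} (h : e.Ok B β s) : HExec B β (.del e) s (s.emit (.del (e.eval s)))
  | report (s) : HExec B β .report s (s.emit .report)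
  | seq {p q s t u} (hp : HExec B β p s t) (hq : HExec B β q t u) : HExec B β (.seq p q) s u
  | ite_true {a b p q s t} (ha : Expr.Ok B β s a) (hb : Expr.Ok B β s b)
      (h : a.eval s < b.eval s) (hp : HExec B β p s.tick t) : HExec B β (.ite a b p q) s t
  | ite_false {a b p q s t} (ha : Expr.Ok B β s a) (hb : Expr.Ok B β s b)
      (h : ¬ a.eval s < b.eval s) (hq : HExec B β q s.tick t) : HExec B β (.ite a b p q) s t
  | while_true {a b p s t u} (ha : Expr.Ok B β s a) (hb : Expr.Ok B β s b)
      (h : a.eval s < b.eval s) (hp : HExec B β p s.tick t)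
      (hl : HExec B β (.while a b p) t u) : HExec B β (.while a b p) s u
  | while_false {a b p s} (ha : Expr.Ok B β s a) (hb : Expr.Ok B β s b)
      (h : ¬ a.eval s < b.eval s) : HExec B β (.while a b p) s s.tick

/-- The conditions `Ok` are premises of the semantics: a program that would compute a number above
`B` or leave its memory region has no execution at all. Every execution therefore preserves the
bound, and the space bound needs no separate analysis. -/
theorem HExec.bounded {B β : ℕ} {p : HProg} {s t : HState} (h : HExec B β p s t)
    (hs : s.Bounded B) : t.Bounded B := by
  induction h with
  | skip => exact ⟨hs.1, hs.2, hs.3⟩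
  | assign h =>
    refine ⟨fun r => ?_, hs.2, hs.3⟩
    rw [HState.setReg_reg]; split
    · exact Expr.eval_le hs _ h
    · exact hs.1 _
  | store hk hi he h =>
    refine ⟨hs.1, fun k i => ?_, hs.3⟩
    rw [HState.setFld_fld]; split
    · rw [Function.update_apply]; split
      · exact Expr.eval_le hs _ he
      · exact hs.2 _ _
    · exact hs.2 _ _
  | storeRaw hi he h =>
    refine ⟨hs.1, hs.2, fun i => ?_⟩
    rw [HState.setRaw_raw, Function.update_apply]; split
    · exact Expr.eval_le hs _ he
    · exact hs.3 _
  | ins => exact ⟨hs.1, hs.2, hs.3⟩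
  | del => exact ⟨hs.1, hs.2, hs.3⟩
  | report => exact ⟨hs.1, hs.2, hs.3⟩
  | seq _ _ ih₁ ih₂ => exact ih₂ (ih₁ hs)
  | ite_true _ _ _ _ ih => exact ih ⟨hs.1, hs.2, hs.3⟩
  | ite_false _ _ _ _ ih => exact ih ⟨hs.1, hs.2, hs.3⟩
  | while_true _ _ _ _ _ ih₁ ih₂ => exact ih₂ (ih₁ ⟨hs.1, hs.2, hs.3⟩)
  | while_false => exact ⟨hs.1, hs.2, hs.3⟩

/-! ### Compilation -/

/-- The machine register of a register of the language. -/
def hreg (r : ℕ) : ℕ := 2 * r + 1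

/-- Machine registers for intermediate results. Register `0` holds `β`. -/
def tmp (t : ℕ) : ℕ := 2 * t + 2

/-- Compute `β + 16 * i + k` in `tmp t`, from `i` in `tmp t` and `k` in `tmp (t + 1)`. -/
def addrCode (t : ℕ) : Prog :=
  .seq (.instr (.add (tmp t) (tmp t) (tmp t))) <|
  .seq (.instr (.add (tmp t) (tmp t) (tmp t))) <|
  .seq (.instr (.add (tmp t) (tmp t) (tmp t))) <|
  .seq (.instr (.add (tmp t) (tmp t) (tmp t))) <|
  .seq (.instr (.add (tmp t) (tmp t) (tmp (t + 1)))) <|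
  .instr (.add (tmp t) (tmp t) 0)

/-- Code that puts the value of an expression into `tmp t`. -/
def Expr.code : Expr → ℕ → Prog
  | reg r, t => .instr (.copy (tmp t) (hreg r))
  | const c, t => .instr (.const (tmp t) c)
  | add a b, t => .seq (a.code t) <| .seq (b.code (t + 1)) <|
      .instr (.add (tmp t) (tmp t) (tmp (t + 1)))
  | sub a b, t => .seq (a.code t) <| .seq (b.code (t + 1)) <|
      .instr (.sub (tmp t) (tmp t) (tmp (t + 1)))
  | fld k i, t => .seq (i.code t) <| .seq (k.code (t + 1)) <| .seq (addrCode t) <|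
      .instr (.load (tmp t) (tmp t))
  | raw i, t => .seq (i.code t) <| .instr (.load (tmp t) (tmp t))

def Expr.cost : Expr → ℕ
  | reg _ => 1
  | const _ => 1
  | add a b => a.cost + b.cost + 1
  | sub a b => a.cost + b.cost + 1
  | fld k i => i.cost + k.cost + 7
  | raw i => i.cost + 1

/-- A machine loop compares two registers only. The test expressions of a `while` are therefore
evaluated once before the machine loop and again at the end of its body. -/
def HProg.code : HProg → Prog
  | skip => .instr (.const (tmp 0) 0)
  | assign r e => .seq (e.code 0) (.instr (.copy (hreg r) (tmp 0)))
  | store k i e => .seq (i.code 0) <| .seq (k.code 1) <| .seq (addrCode 0) <| .seq (e.code 1) <|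
      .instr (.store (tmp 0) (tmp 1))
  | storeRaw i e => .seq (i.code 0) <| .seq (e.code 1) <| .instr (.store (tmp 0) (tmp 1))
  | ins e => .seq (e.code 0) (.instr (.ins (tmp 0)))
  | del e => .seq (e.code 0) (.instr (.del (tmp 0)))
  | report => .instr .report
  | seq p q => .seq p.code q.code
  | ite a b p q => .seq (a.code 0) <| .seq (b.code 1) <| .ite (tmp 0) (tmp 1) p.code q.code
  | .while a b p => .seq (.seq (a.code 0) (b.code 1)) <|
      .loop (tmp 0) (tmp 1) (.seq p.code (.seq (a.code 0) (b.code 1)))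

/-- A bound for the number of machine steps for one step of a program. -/
def HProg.cost : HProg → ℕ
  | skip => 1
  | assign _ e => e.cost + 1
  | store k i e => k.cost + i.cost + e.cost + 7
  | storeRaw i e => i.cost + e.cost + 1
  | ins e => e.cost + 1
  | del e => e.cost + 1
  | report => 1
  | seq p q => p.cost + q.cost
  | ite a b p q => a.cost + b.cost + 1 + p.cost + q.cost
  | .while a b p => a.cost + b.cost + 1 + p.cost

/-- The machine state `s` represents the state `h`, with meters in the allowed range. -/
structure Rep (B β : ℕ) (h : HState) (s : State) : Prop where
  base : s.reg 0 = β
  reg : ∀ r, s.reg (hreg r) = h.reg r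
  fld : ∀ k < 16, ∀ i, s.mem (β + 16 * i + k) = h.fld k i
  raw : ∀ i < β, s.mem i = h.raw i
  out : s.out = h.out
  width : s.width ≤ 17 * B + β + 32
  space : s.space ≤ 17 * B + β + 32

section Refinement

variable {B β : ℕ}

/-- Register `0` holds the base address, registers of the language have odd numbers and temporaries
have positive even numbers, so writing a temporary does not affect the represented state. -/
theorem Rep.setTmp {h : HState} {s : State} (hr : Rep B β h s) (t a : ℕ)
    (ha : a ≤ 17 * B + β + 32) : Rep B β h (s.setReg (tmp t) a).tick := by
  refine ⟨?_, fun r => ?_, hr.fld, hr.raw, hr.out, ?_, hr.space⟩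
  · simp only [State.tick, State.setReg]
    rw [Function.update_of_ne (by simp [tmp])]; exact hr.base
  · simp only [State.tick, State.setReg]
    rw [Function.update_of_ne (by simp [tmp, hreg]; omega)]; exact hr.reg r
  · simp only [State.tick, State.setReg]
    exact max_le hr.width ha

theorem Rep.touch {h : HState} {s : State} (hr : Rep B β h s) (a : ℕ)
    (ha : a < 17 * B + β + 32) : Rep B β h (s.touch a) :=
  ⟨hr.base, hr.reg, hr.fld, hr.raw, hr.out, hr.width, max_le hr.space ha⟩

theorem setTmp_reg_same (s : State) (t a : ℕ) : ((s.setReg (tmp t) a).tick).reg (tmp t) = a := by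
  simp [State.tick, State.setReg]

theorem setTmp_reg_ne (s : State) (t a r : ℕ) (hr : r ≠ tmp t) :
    ((s.setReg (tmp t) a).tick).reg r = s.reg r := by
  simp [State.tick, State.setReg, Function.update_of_ne hr]

/-- Four doublings replace the multiplication by `16`. All intermediate values are at most `β + 16 *
B + 15`, which is why the meters in `Rep` are allowed to reach `17 * B + β + 32`. -/
theorem addrCode_exec {h : HState} {s : State} (hr : Rep B β h s) {t k i : ℕ} (hi : i ≤ B)
    (hk : k < 16) (h0 : s.reg (tmp t) = i) (h1 : s.reg (tmp (t + 1)) = k) :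
    ∃ s', Exec (addrCode t) s s' ∧ Rep B β h s' ∧ s'.reg (tmp t) = β + 16 * i + k ∧
      (∀ t' < t, s'.reg (tmp t') = s.reg (tmp t')) ∧ s'.time = s.time + 6 := by
  have n1 : tmp (t + 1) ≠ tmp t := by simp [tmp]
  have n2 : 0 ≠ tmp t := by simp [tmp]
  let s1 := (s.setReg (tmp t) (2 * i)).tick
  let s2 := (s1.setReg (tmp t) (4 * i)).tick
  let s3 := (s2.setReg (tmp t) (8 * i)).tick
  let s4 := (s3.setReg (tmp t) (16 * i)).tick
  let s5 := (s4.setReg (tmp t) (16 * i + k)).tick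
  let s6 := (s5.setReg (tmp t) (β + 16 * i + k)).tick
  have r1 : Rep B β h s1 := hr.setTmp _ _ (by omega)
  have r2 : Rep B β h s2 := r1.setTmp _ _ (by omega)
  have r3 : Rep B β h s3 := r2.setTmp _ _ (by omega)
  have r4 : Rep B β h s4 := r3.setTmp _ _ (by omega)
  have r5 : Rep B β h s5 := r4.setTmp _ _ (by omega)
  have r6 : Rep B β h s6 := r5.setTmp _ _ (by omega)
  have e1 : Exec (.instr (.add (tmp t) (tmp t) (tmp t))) s s1 := by
    convert Exec.instr (.add (tmp t) (tmp t) (tmp t)) s using 1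
    simp only [Instr.run, s1, h0, two_mul]
  have e2 : Exec (.instr (.add (tmp t) (tmp t) (tmp t))) s1 s2 := by
    convert Exec.instr (.add (tmp t) (tmp t) (tmp t)) s1 using 1
    simp only [Instr.run, s2, s1, setTmp_reg_same]; congr 2; omega
  have e3 : Exec (.instr (.add (tmp t) (tmp t) (tmp t))) s2 s3 := by
    convert Exec.instr (.add (tmp t) (tmp t) (tmp t)) s2 using 1
    simp only [Instr.run, s3, s2, setTmp_reg_same]; congr 2; omega
  have e4 : Exec (.instr (.add (tmp t) (tmp t) (tmp t))) s3 s4 := by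
    convert Exec.instr (.add (tmp t) (tmp t) (tmp t)) s3 using 1
    simp only [Instr.run, s4, s3, setTmp_reg_same]; congr 2; omega
  have e5 : Exec (.instr (.add (tmp t) (tmp t) (tmp (t + 1)))) s4 s5 := by
    convert Exec.instr (.add (tmp t) (tmp t) (tmp (t + 1))) s4 using 1
    simp only [Instr.run, s5, s4, setTmp_reg_same, s3, s2, s1, setTmp_reg_ne _ _ _ _ n1, h1]
  have e6 : Exec (.instr (.add (tmp t) (tmp t) 0)) s5 s6 := by
    convert Exec.instr (.add (tmp t) (tmp t) 0) s5 using 1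
    have := r5.base
    simp only [Instr.run, s6, this]
    simp only [s5, setTmp_reg_same]; congr 2; omega
  refine ⟨s6, .seq e1 (.seq e2 (.seq e3 (.seq e4 (.seq e5 e6)))), r6, setTmp_reg_same _ _ _,
    fun t' ht' => ?_, rfl⟩
  have n3 : tmp t' ≠ tmp t := by simp [tmp]; omega
  simp only [s6, s5, s4, s3, s2, s1, setTmp_reg_ne _ _ _ _ n3]

/-- Temporaries are used as a stack: evaluation at level `t` leaves the levels below `t` alone, so
the first operand survives the evaluation of the second one at level `t + 1`. -/
theorem Expr.code_exec {h : HState} (hb : h.Bounded B) : ∀ (e : Expr) (t : ℕ) (s : State),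
    e.Ok B β h → Rep B β h s → ∃ s', Exec (e.code t) s s' ∧ Rep B β h s' ∧
      s'.reg (tmp t) = e.eval h ∧ (∀ t' < t, s'.reg (tmp t') = s.reg (tmp t')) ∧
      s'.time = s.time + e.cost
  | reg r, t, s, _, hr => by
    have hle := hb.reg r
    refine ⟨_, .instr _ _, hr.setTmp t _ ?_, ?_, fun t' ht' => setTmp_reg_ne _ _ _ _ ?_, rfl⟩
    · rw [hr.reg]; omega
    · simp only [Instr.run]; rw [setTmp_reg_same, hr.reg]; rfl
    · simp [tmp]; omega
  | const c, t, s, ho, hr => by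
    have hle : c ≤ B := ho
    refine ⟨_, .instr _ _, hr.setTmp t _ (by omega), setTmp_reg_same _ _ _,
      fun t' ht' => setTmp_reg_ne _ _ _ _ ?_, rfl⟩
    simp [tmp]; omega
  | add a b, t, s, ho, hr => by
    obtain ⟨s1, x1, r1, v1, f1, t1⟩ := code_exec hb a t s ho.1 hr
    obtain ⟨s2, x2, r2, v2, f2, t2⟩ := code_exec hb b (t + 1) s1 ho.2.1 r1
    have hle : a.eval h + b.eval h ≤ B := ho.2.2
    have w1 : s2.reg (tmp t) = a.eval h := by rw [f2 t (by omega), v1]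
    refine ⟨_, .seq x1 (.seq x2 (.instr _ _)), r2.setTmp t _ ?_, ?_, fun t' ht' => ?_, ?_⟩
    · rw [w1, v2]; omega
    · simp only [Instr.run]; rw [setTmp_reg_same, w1, v2]; rfl
    · simp only [Instr.run]; rw [setTmp_reg_ne _ _ _ _ (by simp [tmp]; omega), f2 t' (by omega), f1 t' ht']
    · simp only [Instr.run, State.tick, State.setReg, t2, t1, cost]; omega
  | sub a b, t, s, ho, hr => by
    obtain ⟨s1, x1, r1, v1, f1, t1⟩ := code_exec hb a t s ho.1 hr
    obtain ⟨s2, x2, r2, v2, f2, t2⟩ := code_exec hb b (t + 1) s1 ho.2 r1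
    have hle : a.eval h ≤ B := eval_le hb a ho.1
    have w1 : s2.reg (tmp t) = a.eval h := by rw [f2 t (by omega), v1]
    refine ⟨_, .seq x1 (.seq x2 (.instr _ _)), r2.setTmp t _ ?_, ?_, fun t' ht' => ?_, ?_⟩
    · rw [w1, v2]; omega
    · simp only [Instr.run]; rw [setTmp_reg_same, w1, v2]; rfl
    · simp only [Instr.run]; rw [setTmp_reg_ne _ _ _ _ (by simp [tmp]; omega), f2 t' (by omega), f1 t' ht']
    · simp only [Instr.run, State.tick, State.setReg, t2, t1, cost]; omega
  | fld k i, t, s, ho, hr => by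
    obtain ⟨s1, x1, r1, v1, f1, t1⟩ := code_exec hb i t s ho.2.1 hr
    obtain ⟨s2, x2, r2, v2, f2, t2⟩ := code_exec hb k (t + 1) s1 ho.1 r1
    have hle : i.eval h ≤ B := eval_le hb i ho.2.1
    have hk : k.eval h < 16 := ho.2.2
    obtain ⟨s3, x3, r3, v3, f3, t3⟩ :=
      addrCode_exec r2 hle hk (by rw [f2 t (by omega), v1]) v2
    have hle2 := hb.fld (k.eval h) (i.eval h)
    have hm : s3.mem (s3.reg (tmp t)) = h.fld (k.eval h) (i.eval h) := by
      rw [v3, r3.fld _ hk]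
    refine ⟨_, .seq x1 (.seq x2 (.seq x3 (.instr _ _))), (r3.touch _ ?_).setTmp t _ ?_, ?_,
      fun t' ht' => ?_, ?_⟩
    · rw [v3]; omega
    · rw [hm]; omega
    · simp only [Instr.run]; rw [setTmp_reg_same, hm]; rfl
    · simp only [Instr.run]; rw [setTmp_reg_ne _ _ _ _ (by simp [tmp]; omega)]
      exact (f3 t' ht').trans ((f2 t' (by omega)).trans (f1 t' ht'))
    · simp only [Instr.run, State.tick, State.setReg, State.touch, t3, t2, t1, cost]; omega
  | raw i, t, s, ho, hr => by
    obtain ⟨s1, x1, r1, v1, f1, t1⟩ := code_exec hb i t s ho.1 hr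
    have hle : i.eval h ≤ B := eval_le hb i ho.1
    have hi : i.eval h < β := ho.2
    have hle2 := hb.raw (i.eval h)
    have hm : s1.mem (s1.reg (tmp t)) = h.raw (i.eval h) := by rw [v1, r1.raw _ hi]
    refine ⟨_, .seq x1 (.instr _ _), (r1.touch _ ?_).setTmp t _ ?_, ?_, fun t' ht' => ?_, ?_⟩
    · rw [v1]; omega
    · rw [hm]; omega
    · simp only [Instr.run]; rw [setTmp_reg_same, hm]; rfl
    · simp only [Instr.run]; rw [setTmp_reg_ne _ _ _ _ (by simp [tmp]; omega)]
      exact f1 t' ht'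
    · simp only [Instr.run, State.tick, State.setReg, State.touch, t1, cost]; omega

theorem test_exec {h : HState} (hb : h.Bounded B) {a b : Expr} {s : State} (ha : a.Ok B β h)
    (hb' : b.Ok B β h) (hr : Rep B β h s) : ∃ s', Exec (.seq (a.code 0) (b.code 1)) s s' ∧
      Rep B β h s' ∧ s'.reg (tmp 0) = a.eval h ∧ s'.reg (tmp 1) = b.eval h ∧
      s'.time = s.time + (a.cost + b.cost) := by
  obtain ⟨s1, x1, r1, v1, f1, t1⟩ := a.code_exec hb 0 s ha hr
  obtain ⟨s2, x2, r2, v2, f2, t2⟩ := b.code_exec hb 1 s1 hb' r1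
  exact ⟨s2, .seq x1 x2, r2, by rw [f2 0 (by omega), v1], v2, by omega⟩

theorem Rep.tick {h : HState} {s : State} (hr : Rep B β h s) : Rep B β h.tick s.tick :=
  ⟨hr.base, hr.reg, hr.fld, hr.raw, hr.out, hr.width, hr.space⟩

theorem HState.Bounded.tick {h : HState} (hb : h.Bounded B) : h.tick.Bounded B :=
  ⟨hb.1, hb.2, hb.3⟩

/-- Compiled programs simulate the language with constant overhead. -/
theorem HExec.code_exec {p : HProg} {h h' : HState} (hx : HExec B β p h h') (hb : h.Bounded B)
    {K : ℕ} (hK : p.cost ≤ K) {s : State} (hr : Rep B β h s) :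
    ∃ s', Exec p.code s s' ∧ Rep B β h' s' ∧ s'.time + K * h.time ≤ s.time + K * h'.time := by
  induction hx generalizing s with
  | skip h =>
    have r := hr.setTmp 0 0 (by omega)
    refine ⟨_, .instr _ _, ⟨r.base, r.reg, r.fld, r.raw, r.out, r.width, r.space⟩, ?_⟩
    simp only [HProg.cost] at hK
    simp only [HState.tick_time, Instr.run, State.tick, State.setReg, mul_add]; omega
  | @assign r e h ho =>
    obtain ⟨s1, x1, r1, v1, f1, t1⟩ := e.code_exec hb 0 s ho hr
    have hle := e.eval_le hb ho
    refine ⟨_, .seq x1 (.instr _ _), ⟨?_, fun r' => ?_, r1.fld, r1.raw, r1.out, ?_, r1.space⟩, ?_⟩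
    · simp only [Instr.run, State.tick, State.setReg]
      rw [Function.update_of_ne (by simp [hreg])]; exact r1.base
    · simp only [Instr.run, State.tick, State.setReg, HState.setReg_reg, Function.update_apply, v1,
        r1.reg]
      by_cases hrr : r' = r
      · simp [hrr]
      · rw [if_neg (by simp [hreg]; omega), if_neg hrr]
    · simp only [Instr.run, State.tick, State.setReg, v1]
      exact max_le r1.width (by omega)
    · simp only [HProg.cost] at hK
      simp only [HState.setReg_time, Instr.run, State.tick, State.setReg, mul_add]; omega
  | @store k i e h hk hi he hlt =>
    obtain ⟨s1, x1, r1, v1, f1, t1⟩ := i.code_exec hb 0 s hi hr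
    obtain ⟨s2, x2, r2, v2, f2, t2⟩ := k.code_exec hb 1 s1 hk r1
    have hle : i.eval h ≤ B := i.eval_le hb hi
    obtain ⟨s3, x3, r3, v3, f3, t3⟩ :=
      addrCode_exec r2 hle hlt (by rw [f2 0 (by omega), v1]) v2
    obtain ⟨s4, x4, r4, v4, f4, t4⟩ := e.code_exec hb 1 s3 he r3
    have v3' : s4.reg (tmp 0) = β + 16 * i.eval h + k.eval h := by rw [f4 0 (by omega), v3]
    refine ⟨_, .seq x1 (.seq x2 (.seq x3 (.seq x4 (.instr _ _)))),
      ⟨r4.base, r4.reg, fun k' hk' i' => ?_, fun i' hi' => ?_, r4.out, r4.width, ?_⟩, ?_⟩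
    · simp only [Instr.run, State.tick, State.setMem, State.touch, v3', v4, HState.setFld_fld]
      -- Since `k, k' < 16`, the address `β + 16 * i + k` determines both `i` and `k`; different
      -- array entries do not overlap, and none lies in the raw region.
      by_cases hkk : k' = k.eval h
      · by_cases hii : i' = i.eval h
        · subst hkk hii; simp
        · rw [Function.update_of_ne (by omega), if_pos hkk, Function.update_of_ne hii, r4.fld k' hk',
            hkk]
      · rw [Function.update_of_ne (by omega), if_neg hkk, r4.fld k' hk']
    · simp only [Instr.run, State.tick, State.setMem, State.touch, v3', HState.setFld_raw]
      rw [Function.update_of_ne (by omega), r4.raw i' hi']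
    · simp only [Instr.run, State.tick, State.setMem, State.touch, v3']
      exact max_le r4.space (by omega)
    · simp only [HProg.cost] at hK
      simp only [HState.setFld_time, Instr.run, State.tick, State.setMem, State.touch, mul_add]
      omega
  | @storeRaw i e h hi he hlt =>
    obtain ⟨s1, x1, r1, v1, f1, t1⟩ := i.code_exec hb 0 s hi hr
    obtain ⟨s2, x2, r2, v2, f2, t2⟩ := e.code_exec hb 1 s1 he r1
    have hle : i.eval h ≤ B := i.eval_le hb hi
    have v1' : s2.reg (tmp 0) = i.eval h := by rw [f2 0 (by omega), v1]
    refine ⟨_, .seq x1 (.seq x2 (.instr _ _)),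
      ⟨r2.base, r2.reg, fun k' hk' i' => ?_, fun i' hi' => ?_, r2.out, r2.width, ?_⟩, ?_⟩
    · simp only [Instr.run, State.tick, State.setMem, State.touch, v1', HState.setRaw_fld]
      rw [Function.update_of_ne (by omega), r2.fld k' hk']
    · simp only [Instr.run, State.tick, State.setMem, State.touch, v1', v2, HState.setRaw_raw,
        Function.update_apply, r2.raw i' hi']
    · simp only [Instr.run, State.tick, State.setMem, State.touch, v1']
      exact max_le r2.space (by omega)
    · simp only [HProg.cost] at hK
      simp only [HState.setRaw_time, Instr.run, State.tick, State.setMem, State.touch, mul_add]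
      omega
  | @ins e h ho =>
    obtain ⟨s1, x1, r1, v1, f1, t1⟩ := e.code_exec hb 0 s ho hr
    refine ⟨_, .seq x1 (.instr _ _), ⟨r1.base, r1.reg, r1.fld, r1.raw, ?_, r1.width, r1.space⟩, ?_⟩
    · simp only [Instr.run, State.tick, State.emit, HState.emit_out, v1, r1.out]
    · simp only [HProg.cost] at hK
      simp only [HState.emit_time, Instr.run, State.tick, State.emit, mul_add]; omega
  | @del e h ho =>
    obtain ⟨s1, x1, r1, v1, f1, t1⟩ := e.code_exec hb 0 s ho hr
    refine ⟨_, .seq x1 (.instr _ _), ⟨r1.base, r1.reg, r1.fld, r1.raw, ?_, r1.width, r1.space⟩, ?_⟩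
    · simp only [Instr.run, State.tick, State.emit, HState.emit_out, v1, r1.out]
    · simp only [HProg.cost] at hK
      simp only [HState.emit_time, Instr.run, State.tick, State.emit, mul_add]; omega
  | report h =>
    refine ⟨_, .instr _ _, ⟨hr.base, hr.reg, hr.fld, hr.raw, ?_, hr.width, hr.space⟩, ?_⟩
    · simp only [Instr.run, State.tick, State.emit, HState.emit_out, hr.out]
    · simp only [HProg.cost] at hK
      simp only [HState.emit_time, Instr.run, State.tick, State.emit, mul_add]; omega
  | seq hp hq ih₁ ih₂ =>
    simp only [HProg.cost] at hK
    obtain ⟨s1, x1, r1, t1⟩ := ih₁ hb (by omega) hr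
    obtain ⟨s2, x2, r2, t2⟩ := ih₂ (hp.bounded hb) (by omega) r1
    exact ⟨s2, .seq x1 x2, r2, by omega⟩
  | ite_true ha hb' hlt hp ih =>
    simp only [HProg.cost] at hK
    obtain ⟨s1, x1, r1, v1, f1, t1⟩ := Expr.code_exec hb _ 0 s ha hr
    obtain ⟨s2, x2, r2, v2, f2, t2⟩ := Expr.code_exec hb _ 1 s1 hb' r1
    obtain ⟨s3, x3, r3, t3⟩ := ih hb.tick (by omega) r2.tick
    refine ⟨s3, .seq x1 (.seq x2 (.ite_true ?_ x3)), r3, ?_⟩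
    · rw [v2, f2 0 (by omega), v1]; exact hlt
    · simp only [HState.tick_time, State.tick, mul_add] at t3; omega
  | ite_false ha hb' hlt hp ih =>
    simp only [HProg.cost] at hK
    obtain ⟨s1, x1, r1, v1, f1, t1⟩ := Expr.code_exec hb _ 0 s ha hr
    obtain ⟨s2, x2, r2, v2, f2, t2⟩ := Expr.code_exec hb _ 1 s1 hb' r1
    obtain ⟨s3, x3, r3, t3⟩ := ih hb.tick (by omega) r2.tick
    refine ⟨s3, .seq x1 (.seq x2 (.ite_false ?_ x3)), r3, ?_⟩
    · rw [v2, f2 0 (by omega), v1]; exact hlt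
    · simp only [HState.tick_time, State.tick, mul_add] at t3; omega
  | while_true ha hb' hlt hp hl ih₁ ih₂ =>
    have hK' := hK
    simp only [HProg.cost] at hK
    obtain ⟨s1, x1, r1, v1, v2, t1⟩ := test_exec hb ha hb' hr
    obtain ⟨s3, x3, r3, t3⟩ := ih₁ hb.tick (by omega) r1.tick
    obtain ⟨s4, x4, r4, t4⟩ := ih₂ (hp.bounded hb.tick) hK' r3
    -- The execution of the remaining loop starts with an evaluation of the test. In the compiled
    -- program this evaluation, `y1`, belongs to the end of the body just executed, and only `y2` to
    -- the machine loop.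
    rw [HProg.code] at x4
    cases x4 with
    | seq y1 y2 =>
      refine ⟨s4, .seq x1 (.loop_true ?_ (.seq x3 y1) y2), r4, ?_⟩
      · rw [v2, v1]; exact hlt
      · simp only [HState.tick_time, State.tick, mul_add] at t3; omega
  | while_false ha hb' hlt =>
    simp only [HProg.cost] at hK
    obtain ⟨s1, x1, r1, v1, v2, t1⟩ := test_exec hb ha hb' hr
    refine ⟨s1.tick, .seq x1 (.loop_false ?_), r1.tick, ?_⟩
    · rw [v2, v1]; exact hlt
    · simp only [HState.tick_time, State.tick, mul_add]; omega

end Refinement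

/-! ### Weakest preconditions -/

/-- The program terminates from `s` in a state that satisfies `Q`. -/
def Wp (B β : ℕ) (p : HProg) (Q : HState → Prop) (s : HState) : Prop :=
  ∃ t, HExec B β p s t ∧ Q t

section Wp

variable {B β : ℕ} {Q R : HState → Prop} {s : HState}

theorem Wp.mono {p : HProg} (h : Wp B β p Q s) (hQ : ∀ t, Q t → R t) : Wp B β p R s :=
  let ⟨t, ht, hq⟩ := h; ⟨t, ht, hQ t hq⟩

@[simp] theorem wp_skip : Wp B β .skip Q s ↔ Q s.tick :=
  ⟨fun ⟨_, h, hq⟩ => by cases h; exact hq, fun h => ⟨_, .skip s, h⟩⟩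

@[simp] theorem wp_assign {r e} :
    Wp B β (.assign r e) Q s ↔ e.Ok B β s ∧ Q (s.setReg r (e.eval s)) :=
  ⟨fun ⟨_, h, hq⟩ => by cases h; exact ⟨‹_›, hq⟩, fun h => ⟨_, .assign h.1, h.2⟩⟩

@[simp] theorem wp_store {k i e} : Wp B β (.store k i e) Q s ↔
    (k.Ok B β s ∧ i.Ok B β s ∧ e.Ok B β s ∧ k.eval s < 16) ∧
      Q (s.setFld (k.eval s) (i.eval s) (e.eval s)) :=
  ⟨fun ⟨_, h, hq⟩ => by cases h; exact ⟨⟨‹_›, ‹_›, ‹_›, ‹_›⟩, hq⟩,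
    fun h => ⟨_, .store h.1.1 h.1.2.1 h.1.2.2.1 h.1.2.2.2, h.2⟩⟩

@[simp] theorem wp_storeRaw {i e} : Wp B β (.storeRaw i e) Q s ↔
    (i.Ok B β s ∧ e.Ok B β s ∧ i.eval s < β) ∧ Q (s.setRaw (i.eval s) (e.eval s)) :=
  ⟨fun ⟨_, h, hq⟩ => by cases h; exact ⟨⟨‹_›, ‹_›, ‹_›⟩, hq⟩,
    fun h => ⟨_, .storeRaw h.1.1 h.1.2.1 h.1.2.2, h.2⟩⟩

@[simp] theorem wp_ins {e} :
    Wp B β (.ins e) Q s ↔ e.Ok B β s ∧ Q (s.emit (.ins (e.eval s))) :=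
  ⟨fun ⟨_, h, hq⟩ => by cases h; exact ⟨‹_›, hq⟩, fun h => ⟨_, .ins h.1, h.2⟩⟩

@[simp] theorem wp_del {e} :
    Wp B β (.del e) Q s ↔ e.Ok B β s ∧ Q (s.emit (.del (e.eval s))) :=
  ⟨fun ⟨_, h, hq⟩ => by cases h; exact ⟨‹_›, hq⟩, fun h => ⟨_, .del h.1, h.2⟩⟩

@[simp] theorem wp_report : Wp B β .report Q s ↔ Q (s.emit .report) :=
  ⟨fun ⟨_, h, hq⟩ => by cases h; exact hq, fun h => ⟨_, .report s, h⟩⟩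

@[simp] theorem wp_seq {p q} : Wp B β (.seq p q) Q s ↔ Wp B β p (Wp B β q Q) s :=
  ⟨fun ⟨_, h, hq⟩ => by cases h with | seq h₁ h₂ => exact ⟨_, h₁, _, h₂, hq⟩,
    fun ⟨_, h₁, _, h₂, hq⟩ => ⟨_, .seq h₁ h₂, hq⟩⟩

theorem wp_ite {a b p q} (ha : Expr.Ok B β s a) (hb : Expr.Ok B β s b)
    (h₁ : a.eval s < b.eval s → Wp B β p Q s.tick)
    (h₂ : ¬ a.eval s < b.eval s → Wp B β q Q s.tick) : Wp B β (.ite a b p q) Q s := by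
  by_cases h : a.eval s < b.eval s
  · obtain ⟨t, ht, hq⟩ := h₁ h
    exact ⟨t, .ite_true ha hb h ht, hq⟩
  · obtain ⟨t, ht, hq⟩ := h₂ h
    exact ⟨t, .ite_false ha hb h ht, hq⟩

/-- Loop rule: the invariant is indexed by a bound for the number of remaining iterations. -/
theorem wp_while {a b p} (I : ℕ → HState → Prop) (j : ℕ) (hI : I j s)
    (hok : ∀ j s, I j s → Expr.Ok B β s a ∧ Expr.Ok B β s b)
    (hbody : ∀ j s, I j s → a.eval s < b.eval s →
      Wp B β p (fun t => ∃ j' < j, I j' t) s.tick)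
    (hend : ∀ j s, I j s → ¬ a.eval s < b.eval s → Q s.tick) :
    Wp B β (.while a b p) Q s := by
  induction j using Nat.strong_induction_on generalizing s with
  | _ j ih =>
    obtain ⟨ha, hb⟩ := hok j s hI
    by_cases h : a.eval s < b.eval s
    · obtain ⟨t, ht, j', hj', hI'⟩ := hbody j s hI h
      obtain ⟨u, hu, hq⟩ := ih j' hj' hI'
      exact ⟨u, .while_true ha hb h ht hu, hq⟩
    · exact ⟨_, .while_false ha hb h, hend j s hI h⟩

end Wp

/-- Some iterations of a loop. -/
inductive Iter (B β : ℕ) (a b : Expr) (p : HProg) : HState → HState → Prop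
  | refl (s) : Iter B β a b p s s
  | step {s t u} (ha : a.Ok B β s) (hb : b.Ok B β s) (h : a.eval s < b.eval s)
      (hp : HExec B β p s.tick t) (hi : Iter B β a b p t u) : Iter B β a b p s u

section Iter

variable {B β : ℕ}

theorem Iter.trans {a b p} {s t u : HState} (h₁ : Iter B β a b p s t) (h₂ : Iter B β a b p t u) :
    Iter B β a b p s u := by
  induction h₁ with
  | refl => exact h₂
  | step ha hb h hp _ ih => exact .step ha hb h hp (ih h₂)

/-- The recursion is simulated by one loop, so a recursive call is a stretch of consecutive
iterations. The big-step rule for a whole loop cannot speak about such a stretch; `Iter` can, and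
here the stretches are turned into an execution once the test fails. -/
theorem Iter.exec {a b p} {s t : HState} (h : Iter B β a b p s t) (ha : a.Ok B β t)
    (hb : b.Ok B β t) (hn : ¬ a.eval t < b.eval t) : HExec B β (.while a b p) s t.tick := by
  induction h with
  | refl => exact .while_false ha hb hn
  | step ha' hb' h hp _ ih => exact .while_true ha' hb' h hp (ih ha hb hn)

end Iter

/-! ### Frame rules -/

/-- The program does not assign the register `r`. -/
def HProg.noReg (r : ℕ) : HProg → Bool
  | assign r' _ => r' != r
  | seq p q => p.noReg r && q.noReg r
  | ite _ _ p q => p.noReg r && q.noReg r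
  | .while _ _ p => p.noReg r
  | _ => true

/-- The program does not write to the array `k`. -/
def HProg.noFld (k : ℕ) : HProg → Bool
  | store (.const k') _ _ => k' != k
  | store _ _ _ => false
  | seq p q => p.noFld k && q.noFld k
  | ite _ _ p q => p.noFld k && q.noFld k
  | .while _ _ p => p.noFld k
  | _ => true

/-- The program does not write to the raw region. -/
def HProg.noRaw : HProg → Bool
  | storeRaw _ _ => false
  | seq p q => p.noRaw && q.noRaw
  | ite _ _ p q => p.noRaw && q.noRaw
  | .while _ _ p => p.noRaw
  | _ => true

/-- The program produces no output. -/
def HProg.noOut : HProg → Bool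
  | ins _ => false
  | del _ => false
  | report => false
  | seq p q => p.noOut && q.noOut
  | ite _ _ p q => p.noOut && q.noOut
  | .while _ _ p => p.noOut
  | _ => true

section Frame

variable {B β : ℕ} {p : HProg} {s t : HState}

/-- The footprint conditions are Boolean functions of the program text, so for concrete programs and
numbers they are discharged by `rfl`. -/
theorem HExec.reg_eq (h : HExec B β p s t) {r : ℕ} (hr : p.noReg r = true) :
    t.reg r = s.reg r := by
  induction h with
  | assign =>
    simp only [HProg.noReg, bne_iff_ne] at hr
    rw [HState.setReg_reg, if_neg hr.symm]
  | seq _ _ ih₁ ih₂ => simp only [HProg.noReg, Bool.and_eq_true] at hr; rw [ih₂ hr.2, ih₁ hr.1]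
  | ite_true _ _ _ _ ih => simp only [HProg.noReg, Bool.and_eq_true] at hr; exact ih hr.1
  | ite_false _ _ _ _ ih => simp only [HProg.noReg, Bool.and_eq_true] at hr; exact ih hr.2
  | while_true _ _ _ _ _ ih₁ ih₂ => rw [ih₂ hr, ih₁ hr]; rfl
  | _ => rfl

theorem HExec.fld_eq (h : HExec B β p s t) {k : ℕ} (hk : p.noFld k = true) :
    t.fld k = s.fld k := by
  induction h with
  | @store k' =>
    cases k' with
    | const c =>
      simp only [HProg.noFld, bne_iff_ne] at hk
      rw [HState.setFld_fld, if_neg (fun h => hk h.symm)]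
    | _ => simp [HProg.noFld] at hk
  | seq _ _ ih₁ ih₂ => simp only [HProg.noFld, Bool.and_eq_true] at hk; rw [ih₂ hk.2, ih₁ hk.1]
  | ite_true _ _ _ _ ih => simp only [HProg.noFld, Bool.and_eq_true] at hk; exact ih hk.1
  | ite_false _ _ _ _ ih => simp only [HProg.noFld, Bool.and_eq_true] at hk; exact ih hk.2
  | while_true _ _ _ _ _ ih₁ ih₂ => rw [ih₂ hk, ih₁ hk]; rfl
  | _ => rfl

theorem HExec.raw_eq (h : HExec B β p s t) (hp : p.noRaw = true) : t.raw = s.raw := by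
  induction h with
  | storeRaw => simp [HProg.noRaw] at hp
  | seq _ _ ih₁ ih₂ => simp only [HProg.noRaw, Bool.and_eq_true] at hp; rw [ih₂ hp.2, ih₁ hp.1]
  | ite_true _ _ _ _ ih => simp only [HProg.noRaw, Bool.and_eq_true] at hp; exact ih hp.1
  | ite_false _ _ _ _ ih => simp only [HProg.noRaw, Bool.and_eq_true] at hp; exact ih hp.2
  | while_true _ _ _ _ _ ih₁ ih₂ => rw [ih₂ hp, ih₁ hp]; rfl
  | _ => rfl

theorem HExec.out_eq (h : HExec B β p s t) (hp : p.noOut = true) : t.out = s.out := by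
  induction h with
  | ins => simp [HProg.noOut] at hp
  | del => simp [HProg.noOut] at hp
  | report => simp [HProg.noOut] at hp
  | seq _ _ ih₁ ih₂ => simp only [HProg.noOut, Bool.and_eq_true] at hp; rw [ih₂ hp.2, ih₁ hp.1]
  | ite_true _ _ _ _ ih => simp only [HProg.noOut, Bool.and_eq_true] at hp; exact ih hp.1
  | ite_false _ _ _ _ ih => simp only [HProg.noOut, Bool.and_eq_true] at hp; exact ih hp.2
  | while_true _ _ _ _ _ ih₁ ih₂ => rw [ih₂ hp, ih₁ hp]; rfl
  | _ => rfl

end Frame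

end InducedSubtrees

namespace InducedSubtrees

/-! ## Linked lists -/

/-- Following the pointers `nx` from `a`, one passes the cells `l` and arrives at `b`. -/
def Seg (nx : ℕ → ℕ) : ℕ → List ℕ → ℕ → Prop
  | a, [], b => nx a = b
  | a, x :: l, b => nx a = x ∧ Seg nx x l b

/-- The doubly linked analogue of `Seg`. -/
def DSeg (nx pv : ℕ → ℕ) : ℕ → List ℕ → ℕ → Prop
  | a, [], b => nx a = b ∧ pv b = a
  | a, x :: l, b => nx a = x ∧ pv x = a ∧ DSeg nx pv x l b

theorem Seg.congr {nx nx' : ℕ → ℕ} {a b : ℕ} {l : List ℕ} (h : Seg nx a l b)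
    (h' : ∀ i ∈ a :: l, nx' i = nx i) : Seg nx' a l b := by
  induction l generalizing a with
  | nil => exact (h' a (by simp)).trans h
  | cons x l ih =>
    exact ⟨(h' a (by simp)).trans h.1, ih h.2 fun i hi => h' i (List.mem_cons_of_mem _ hi)⟩

theorem seg_append {nx : ℕ → ℕ} {a b x : ℕ} {l l' : List ℕ} :
    Seg nx a (l ++ x :: l') b ↔ Seg nx a l x ∧ Seg nx x l' b := by
  induction l generalizing a with
  | nil => rfl
  | cons y l ih => simp only [List.cons_append, Seg, ih, and_assoc]

theorem Seg.update {nx : ℕ → ℕ} {a b i v : ℕ} {l : List ℕ} (h : Seg nx a l b)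
    (hi : i ∉ a :: l) : Seg (Function.update nx i v) a l b :=
  h.congr fun _ hj => Function.update_of_ne (by rintro rfl; exact hi hj) _ _

theorem Seg.head {nx : ℕ → ℕ} {a b : ℕ} {l : List ℕ} (h : Seg nx a l b) :
    nx a = l.headD b := by
  cases l with
  | nil => exact h
  | cons x l => exact h.1

theorem DSeg.congr {nx nx' pv pv' : ℕ → ℕ} {a b : ℕ} {l : List ℕ} (h : DSeg nx pv a l b)
    (h₁ : ∀ i ∈ a :: l, nx' i = nx i) (h₂ : ∀ i ∈ b :: l, pv' i = pv i) :
    DSeg nx' pv' a l b := by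
  induction l generalizing a with
  | nil => exact ⟨(h₁ a (by simp)).trans h.1, (h₂ b (by simp)).trans h.2⟩
  | cons x l ih =>
    refine ⟨(h₁ a (by simp)).trans h.1, (h₂ x (by simp)).trans h.2.1, ih h.2.2 ?_ ?_⟩
    · exact fun i hi => h₁ i (List.mem_cons_of_mem _ hi)
    · intro i hi
      refine h₂ i ?_
      simp only [List.mem_cons] at hi ⊢
      tauto

theorem dseg_append {nx pv : ℕ → ℕ} {a b x : ℕ} {l l' : List ℕ} :
    DSeg nx pv a (l ++ x :: l') b ↔ DSeg nx pv a l x ∧ DSeg nx pv x l' b := by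
  induction l generalizing a with
  | nil => simp only [List.nil_append, DSeg, and_assoc]
  | cons y l ih => simp only [List.cons_append, DSeg, ih, and_assoc]

theorem DSeg.pv_mem {nx pv : ℕ → ℕ} {a b : ℕ} {l : List ℕ} (h : DSeg nx pv a l b) :
    pv b ∈ a :: l := by
  induction l generalizing a with
  | nil => simp [h.2]
  | cons x l ih => exact List.mem_cons_of_mem _ (ih h.2.2)

theorem DSeg.nx_mem {nx pv : ℕ → ℕ} {a b : ℕ} {l : List ℕ} (h : DSeg nx pv a l b) :
    nx a ∈ b :: l := by
  cases l with
  | nil => simp [h.1]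
  | cons x l => simp [h.1]

/-- Only the pointers `nx (pv e)` and `pv (nx e)` change. The two hypotheses on distinctness allow
`a = b`; this is the case of a circular list through its header. -/
theorem DSeg.unlink {nx pv : ℕ → ℕ} {a b e : ℕ} {l l' : List ℕ}
    (h : DSeg nx pv a (l ++ e :: l') b) (ha : (a :: (l ++ e :: l')).Nodup)
    (hb : (b :: (l ++ e :: l')).Nodup) :
    DSeg (Function.update nx (pv e) (nx e)) (Function.update pv (nx e) (pv e)) a (l ++ l') b := by
  induction l generalizing a with
  | nil =>
    simp only [List.nil_append] at h ha hb ⊢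
    obtain ⟨h1, h2, h3⟩ := h
    rw [h2]
    cases l' with
    | nil =>
      exact ⟨by rw [Function.update_self]; exact h3.1, by rw [h3.1, Function.update_self]⟩
    | cons x l' =>
      obtain ⟨h4, h5, h6⟩ := h3
      refine ⟨by rw [Function.update_self]; exact h4, by rw [h4, Function.update_self],
        h6.congr ?_ ?_⟩
      · intro i hi
        refine Function.update_of_ne ?_ _ _
        rintro rfl
        simp only [List.nodup_cons, List.mem_cons] at ha hi
        tauto
      · intro i hi
        refine Function.update_of_ne ?_ _ _
        rintro rfl
        simp only [List.nodup_cons, List.mem_cons, h4] at hb hi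
        rcases hi with hi | hi
        · exact hb.1 (Or.inr (Or.inl hi.symm))
        · exact hb.2.2.1 hi
  | cons y l ih =>
    obtain ⟨h1, h2, h3⟩ := h
    obtain ⟨h4, h5⟩ := dseg_append.1 h3
    have hp : pv e ∈ y :: l := h4.pv_mem
    have hn : nx e ∈ b :: l' := h5.nx_mem
    have ih' := ih h3 (List.nodup_cons.1 ha).2
      (by simp only [List.cons_append, List.nodup_cons, List.mem_cons] at hb ⊢; tauto)
    refine ⟨?_, ?_, ih'⟩
    · rw [Function.update_of_ne, h1]
      rintro rfl
      simp only [List.cons_append, List.nodup_cons, List.mem_cons, List.mem_append] at ha hp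
      tauto
    · rw [Function.update_of_ne, h2]
      rintro rfl
      simp only [List.cons_append, List.nodup_cons, List.mem_cons, List.mem_append] at ha hb hn
      rcases hn with hn | hn
      · exact hb.1 (Or.inl hn.symm)
      · tauto

/-- Disjoint circular doubly linked lists with headers `0, …, n - 1` and cells at least `n`. -/
structure Fam (nx pv : ℕ → ℕ) (n : ℕ) (ls : ℕ → List ℕ) : Prop where
  seg : ∀ h < n, DSeg nx pv h (ls h) h
  nodup : ∀ h < n, (ls h).Nodup
  ge : ∀ h < n, ∀ c ∈ ls h, n ≤ c
  disj : ∀ h < n, ∀ h' < n, h ≠ h' → ∀ c ∈ ls h, c ∉ ls h'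

namespace Fam

variable {nx pv : ℕ → ℕ} {n : ℕ} {ls : ℕ → List ℕ}

theorem congr {ls' : ℕ → List ℕ} (hF : Fam nx pv n ls) (h : ∀ w < n, ls' w = ls w) :
    Fam nx pv n ls' := by
  refine ⟨fun w hw => ?_, fun w hw => ?_, fun w hw => ?_, fun w hw w' hw' => ?_⟩
  · rw [h w hw]; exact hF.seg w hw
  · rw [h w hw]; exact hF.nodup w hw
  · rw [h w hw]; exact hF.ge w hw
  · rw [h w hw, h w' hw']; exact hF.disj w hw w' hw'

theorem nodup_cons (hF : Fam nx pv n ls) {h : ℕ} (hh : h < n) : (h :: ls h).Nodup :=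
  List.nodup_cons.2 ⟨fun hc => absurd (hF.ge h hh h hc) (by omega), hF.nodup h hh⟩

/-- Headers are below `n` and cells are at least `n`, so one comparison with `n` decides whether a
circular list is empty. The programs test emptiness in this way. -/
theorem nx_lt_iff (hF : Fam nx pv n ls) {h : ℕ} (hh : h < n) : nx h < n ↔ ls h = [] := by
  have h1 := hF.seg h hh
  have h2 := hF.ge h hh
  cases hl : ls h with
  | nil => rw [hl] at h1; simp only [DSeg] at h1; simp only [iff_true]; omega
  | cons x l =>
    rw [hl] at h1 h2
    have := h2 x (by simp)
    simp only [DSeg] at h1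
    simp only [reduceCtorEq, iff_false]; omega

theorem nx_eq (hF : Fam nx pv n ls) {h : ℕ} (hh : h < n) {x : ℕ} {l : List ℕ}
    (hl : ls h = x :: l) : nx h = x := by
  have h1 := hF.seg h hh
  rw [hl] at h1; exact h1.1

theorem pv_eq (hF : Fam nx pv n ls) {h : ℕ} (hh : h < n) {x : ℕ} {l : List ℕ}
    (hl : ls h = l ++ [x]) : pv h = x := by
  have h1 := hF.seg h hh
  rw [hl, dseg_append] at h1; exact h1.2.2

theorem pv_lt_iff (hF : Fam nx pv n ls) {h : ℕ} (hh : h < n) : pv h < n ↔ ls h = [] := by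
  rcases List.eq_nil_or_concat (ls h) with hl | ⟨l, x, hl⟩
  · have h1 := hF.seg h hh
    rw [hl] at h1; simp only [DSeg] at h1; simp only [hl, iff_true]; omega
  · rw [List.concat_eq_append] at hl
    have h1 := hF.pv_eq hh hl
    have := hF.ge h hh x (by simp [hl])
    simp only [hl, List.append_eq_nil_iff, List.cons_ne_self, and_false, iff_false]; omega

/-- Unlinking overwrites `nx (pv e)` before it reads `nx e` for the second time; the value read is
still the old one because these are different entries. -/
theorem pv_ne (hF : Fam nx pv n ls) {h e : ℕ} (hh : h < n) (he : e ∈ ls h) : pv e ≠ e := by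
  obtain ⟨l, l', hl⟩ := List.append_of_mem he
  have h1 := hF.seg h hh
  have h2 := hF.nodup_cons hh
  rw [hl] at h1 h2
  have h3 := (dseg_append.1 h1).1.pv_mem
  intro h4
  rw [h4] at h3
  rw [← List.cons_append, List.nodup_append] at h2
  exact h2.2.2 e h3 e (by simp) rfl

theorem unlink (hF : Fam nx pv n ls) {h e : ℕ} (hh : h < n) (he : e ∈ ls h) :
    Fam (Function.update nx (pv e) (nx e)) (Function.update pv (nx e) (pv e)) n
      (Function.update ls h ((ls h).erase e)) := by
  have key : ∀ w c, c ∈ Function.update ls h ((ls h).erase e) w → c ∈ ls w := by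
    intro w c hc
    by_cases hw : w = h
    · subst hw; rw [Function.update_self] at hc; exact List.mem_of_mem_erase hc
    · rwa [Function.update_of_ne hw] at hc
  obtain ⟨l, l', hl⟩ := List.append_of_mem he
  have h1 := hF.seg h hh
  have h2 := hF.nodup_cons hh
  have h2' := hF.nodup h hh
  rw [hl] at h1 h2 h2'
  have hp : pv e ∈ h :: l := (dseg_append.1 h1).1.pv_mem
  have hn : nx e ∈ h :: l' := (dseg_append.1 h1).2.nx_mem
  have hp' : pv e = h ∨ pv e ∈ ls h := by
    rw [hl]; simp only [List.mem_cons, List.mem_append] at hp ⊢; tauto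
  have hn' : nx e = h ∨ nx e ∈ ls h := by
    rw [hl]; simp only [List.mem_cons, List.mem_append] at hn ⊢; tauto
  -- The changed pointers sit at the header `h` or at cells of the list of `h`, and no such place
  -- occurs in another circular list.
  have off : ∀ w < n, w ≠ h → ∀ i, (i = h ∨ i ∈ ls h) → i ∉ w :: ls w := by
    intro w hw hne i hi hc
    rcases List.mem_cons.1 hc with hc | hc
    · rcases hi with hi | hi
      · exact hne (hc.symm.trans hi)
      · have := hF.ge h hh i hi; omega
    · rcases hi with hi | hi
      · have := hF.ge w hw i hc; omega
      · exact hF.disj w hw h hh hne i hc hi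
  refine ⟨fun w hw => ?_, fun w hw => ?_, fun w hw c hc => hF.ge w hw c (key w c hc),
    fun w hw w' hw' hne c hc hc' => hF.disj w hw w' hw' hne c (key w c hc) (key w' c hc')⟩
  · by_cases hwh : w = h
    · subst hwh
      have : (ls w).erase e = l ++ l' := by
        rw [hl, List.erase_append_right, List.erase_cons_head]
        rw [List.nodup_append] at h2'
        exact fun hm => h2'.2.2 e hm e (by simp) rfl
      rw [Function.update_self, this]
      exact h1.unlink h2 h2
    · rw [Function.update_of_ne hwh]
      refine (hF.seg w hw).congr (fun i hi => Function.update_of_ne ?_ _ _)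
        (fun i hi => Function.update_of_ne ?_ _ _)
      · rintro rfl; exact off w hw hwh _ hp' hi
      · rintro rfl; exact off w hw hwh _ hn' hi
  · by_cases hwh : w = h
    · subst hwh; rw [Function.update_self]; exact (hF.nodup w hw).erase e
    · rw [Function.update_of_ne hwh]; exact hF.nodup w hw

theorem insert (hF : Fam nx pv n ls) {h c : ℕ} (hh : h < n) (hc : n ≤ c)
    (hnew : ∀ w < n, c ∉ ls w) :
    Fam (Function.update (Function.update nx c (nx h)) h c)
      (Function.update (Function.update pv c h) (nx h) c) n
      (Function.update ls h (c :: ls h)) := by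
  have key : ∀ w i, i ∈ Function.update ls h (c :: ls h) w → (w = h ∧ i = c) ∨ i ∈ ls w := by
    intro w i hi
    by_cases hw : w = h
    · subst hw; rw [Function.update_self] at hi
      rcases List.mem_cons.1 hi with hi | hi
      · exact Or.inl ⟨rfl, hi⟩
      · exact Or.inr hi
    · rw [Function.update_of_ne hw] at hi; exact Or.inr hi
  have h1 := hF.seg h hh
  have hn : nx h ∈ h :: ls h := h1.nx_mem
  have hnd := hF.nodup_cons hh
  refine ⟨fun w hw => ?_, fun w hw => ?_, fun w hw i hi => ?_, fun w hw w' hw' hne i hi hi' => ?_⟩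
  · by_cases hwh : w = h
    · subst hwh
      rw [Function.update_self]
      have hcw : c ≠ w := by omega
      have hcn : nx w ≠ c := by
        rintro h2
        rw [h2] at hn
        rcases List.mem_cons.1 hn with h3 | h3
        · exact hcw h3
        · exact hnew w hw h3
      refine ⟨by rw [Function.update_self], by
        rw [Function.update_of_ne hcn.symm, Function.update_self], ?_⟩
      cases hl : ls w with
      | nil =>
        rw [hl] at h1
        exact ⟨by rw [Function.update_of_ne hcw, Function.update_self, h1.1],
          by rw [h1.1, Function.update_self]⟩
      | cons x l =>
        rw [hl] at h1 hnd hn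
        obtain ⟨h2, h3, h4⟩ := h1
        have hcx : c ∉ x :: l := hl ▸ hnew w hw
        refine ⟨by rw [Function.update_of_ne hcw, Function.update_self, h2],
          by rw [h2, Function.update_self], h4.congr (fun i hi => ?_) (fun i hi => ?_)⟩
        · rw [Function.update_of_ne, Function.update_of_ne]
          · rintro rfl; exact hcx hi
          · rintro rfl; exact (List.nodup_cons.1 hnd).1 hi
        · rw [Function.update_of_ne, Function.update_of_ne]
          · rintro rfl
            rcases List.mem_cons.1 hi with hi | hi
            · exact hcw hi
            · exact hcx (List.mem_cons_of_mem _ hi)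
          · rw [h2]; rintro rfl
            simp only [List.nodup_cons, List.mem_cons] at hnd hi
            rcases hi with hi | hi
            · exact hnd.1 (Or.inl hi.symm)
            · exact hnd.2.1 hi
    · rw [Function.update_of_ne hwh]
      have hcw := hnew w hw
      refine (hF.seg w hw).congr (fun i hi => ?_) (fun i hi => ?_)
      · rw [Function.update_of_ne, Function.update_of_ne]
        · rintro rfl
          rcases List.mem_cons.1 hi with hi | hi
          · omega
          · exact hcw hi
        · rintro rfl
          rcases List.mem_cons.1 hi with hi | hi
          · exact hwh hi.symm
          · have := hF.ge w hw i hi; omega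
      · rw [Function.update_of_ne, Function.update_of_ne]
        · rintro rfl
          rcases List.mem_cons.1 hi with hi | hi
          · omega
          · exact hcw hi
        · rintro rfl
          rcases List.mem_cons.1 hi with hi | hi
          · rcases List.mem_cons.1 hn with h2 | h2
            · exact hwh (hi.symm.trans h2)
            · have := hF.ge h hh _ h2; omega
          · rcases List.mem_cons.1 hn with h2 | h2
            · have := hF.ge w hw _ hi; omega
            · exact hF.disj w hw h hh hwh _ hi h2
  · by_cases hwh : w = h
    · subst hwh; rw [Function.update_self]
      exact List.nodup_cons.2 ⟨hnew w hw, hF.nodup w hw⟩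
    · rw [Function.update_of_ne hwh]; exact hF.nodup w hw
  · rcases key w i hi with ⟨_, rfl⟩ | hi
    · exact hc
    · exact hF.ge w hw i hi
  · rcases key w i hi with ⟨rfl, rfl⟩ | h2
    · rcases key w' i hi' with ⟨rfl, _⟩ | h3
      · exact hne rfl
      · exact hnew w' hw' h3
    · rcases key w' i hi' with ⟨rfl, rfl⟩ | h3
      · exact hnew w hw h2
      · exact hF.disj w hw w' hw' hne i h2 h3

end Fam

end InducedSubtrees

namespace InducedSubtrees

/-! ## Induced subtrees -/

section Graph

variable {V : Type*} {G : SimpleGraph V}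

/-- Walks of `G` with support in `S` replace walks of `G.induce S`, so that sets can be enlarged
without changing the vertex type. `induce_isAcyclic_iff` does the same for cycles. -/
theorem induce_preconnected_iff {S : Finset V} : (G.induce (S : Set V)).Preconnected ↔
    ∀ a ∈ S, ∀ b ∈ S, ∃ p : G.Walk a b, ∀ w ∈ p.support, w ∈ S := by
  constructor
  · intro h a ha b hb
    obtain ⟨p⟩ := h ⟨a, ha⟩ ⟨b, hb⟩
    refine ⟨p.map (SimpleGraph.Embedding.induce (S : Set V)).toHom, fun w hw => ?_⟩
    have hw' : w ∈ p.support.map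
        (SimpleGraph.Embedding.induce (G := G) (S : Set V)).toHom := by
      rw [← SimpleGraph.Walk.support_map]; exact hw
    obtain ⟨x, -, rfl⟩ := List.mem_map.1 hw'
    exact x.2
  · intro h a b
    obtain ⟨p, hp⟩ := h a a.2 b b.2
    exact ⟨p.induce _ hp⟩

theorem induce_isAcyclic_iff {S : Finset V} : (G.induce (S : Set V)).IsAcyclic ↔
    ∀ (v : V) (c : G.Walk v v), (∀ w ∈ c.support, w ∈ S) → ¬ c.IsCycle := by
  have inj : Function.Injective (SimpleGraph.Embedding.induce (G := G) (S : Set V)).toHom :=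
    Subtype.val_injective
  constructor
  · intro h v c hc hcyc
    refine h (c.induce _ hc) ?_
    rw [← SimpleGraph.Walk.isCycle_map_iff_of_injective inj]
    have := SimpleGraph.Walk.map_induce (s := (S : Set V)) c hc
    rw [this]; exact hcyc
  · intro h v c hc
    refine h v (c.map (SimpleGraph.Embedding.induce (S : Set V)).toHom) (fun w hw => ?_) ?_
    · have hw' : w ∈ c.support.map
        (SimpleGraph.Embedding.induce (G := G) (S : Set V)).toHom := by
        rw [← SimpleGraph.Walk.support_map]; exact hw
      obtain ⟨x, -, rfl⟩ := List.mem_map.1 hw'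
      exact x.2
    · exact (SimpleGraph.Walk.isCycle_map_iff_of_injective inj).2 hc

theorem isInducedSubtree_empty : IsInducedSubtree G ∅ :=
  ⟨fun a => absurd a.2 (by simp), fun a => absurd a.2 (by simp)⟩

theorem isInducedSubtree_singleton (v : V) : IsInducedSubtree G {v} := by
  refine ⟨induce_preconnected_iff.2 fun a ha b hb => ?_, induce_isAcyclic_iff.2 fun a c hc hcyc => ?_⟩
  · obtain rfl := Finset.mem_singleton.1 ha
    obtain rfl := Finset.mem_singleton.1 hb
    exact ⟨.nil, by simp⟩
  · have h1 := Finset.mem_singleton.1 (hc _ c.start_mem_support)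
    have h2 := Finset.mem_singleton.1 (hc _ (c.getVert_mem_support 1))
    have := c.adj_snd hcyc.not_nil
    rw [SimpleGraph.Walk.snd, h2, h1] at this
    exact G.loopless.irrefl _ this

/-- The new vertex is a leaf. A cycle through it would pass from and to two different neighbours in
`S`, contradicting `huniq`; a cycle avoiding it lies in `S`. -/
theorem IsInducedSubtree.insert [DecidableEq V] {S : Finset V} (hS : IsInducedSubtree G S)
    {v p : V} (hp : p ∈ S) (hvp : G.Adj v p) (huniq : ∀ q ∈ S, G.Adj v q → q = p) :
    IsInducedSubtree G (insert v S) := by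
  have hcon := induce_preconnected_iff.1 hS.1
  have hac := induce_isAcyclic_iff.1 hS.2
  refine ⟨induce_preconnected_iff.2 fun a ha b hb => ?_, induce_isAcyclic_iff.2 fun a c hc hcyc => ?_⟩
  · have key : ∀ a ∈ Insert.insert v S, ∃ w : G.Walk a p, ∀ x ∈ w.support, x ∈ Insert.insert v S := by
      intro a ha
      rcases Finset.mem_insert.1 ha with rfl | ha
      · exact ⟨.cons hvp .nil, by simp [hp]⟩
      · obtain ⟨w, hw⟩ := hcon a ha p hp
        exact ⟨w, fun x hx => Finset.mem_insert_of_mem (hw x hx)⟩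
    obtain ⟨w1, h1⟩ := key a ha
    obtain ⟨w2, h2⟩ := key b hb
    refine ⟨w1.append w2.reverse, fun x hx => ?_⟩
    rw [SimpleGraph.Walk.mem_support_append_iff, SimpleGraph.Walk.support_reverse,
      List.mem_reverse] at hx
    exact hx.elim (h1 x) (h2 x)
  · by_cases hv : v ∈ c.support
    · have hcyc' := hcyc.rotate hv
      have hc' : ∀ w ∈ (c.rotate v hv).support, w ∈ Insert.insert v S := by
        intro w hw
        rw [SimpleGraph.Walk.mem_support_rotate_iff] at hw
        exact hc w hw
      set d := c.rotate v hv with hd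
      have a1 := d.adj_snd hcyc'.not_nil
      have a2 := (d.adj_penultimate hcyc'.not_nil).symm
      have m1 : d.snd ∈ S := by
        rcases Finset.mem_insert.1 (hc' _ (d.getVert_mem_support 1)) with h | h
        · exact absurd h a1.ne'
        · exact h
      have m2 : d.penultimate ∈ S := by
        rcases Finset.mem_insert.1 (hc' _ (d.getVert_mem_support _)) with h | h
        · exact absurd h a2.ne'
        · exact h
      exact hcyc'.snd_ne_penultimate ((huniq _ m1 a1).trans (huniq _ m2 a2).symm)
    · refine hac a c (fun w hw => ?_) hcyc
      rcases Finset.mem_insert.1 (hc w hw) with rfl | h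
      · exact absurd hw hv
      · exact h

/-- A path in `S` between two different neighbours of `v` closes up through `v` to a cycle inside
`T`. This justifies forbidding candidates that are adjacent to the included vertex. -/
theorem IsInducedSubtree.unique_adj [DecidableEq V] {S T : Finset V} (hT : IsInducedSubtree G T)
    (hS : IsInducedSubtree G S) (hST : S ⊆ T) {v a b : V} (hvT : v ∈ T) (hvS : v ∉ S)
    (ha : a ∈ S) (hb : b ∈ S) (hva : G.Adj v a) (hvb : G.Adj v b) : a = b := by
  by_contra hne
  obtain ⟨w, hw⟩ := induce_preconnected_iff.1 hS.1 a ha b hb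
  have hq : ∀ x ∈ w.bypass.support, x ∈ S :=
    fun x hx => hw x (w.support_bypass_subset_support hx)
  have hv : v ∉ w.bypass.support := fun h => hvS (hq v h)
  have hpath : (w.bypass.concat hvb.symm).IsPath := (w.bypass_isPath).concat hv hvb.symm
  refine induce_isAcyclic_iff.1 hT.2 v (.cons hva (w.bypass.concat hvb.symm)) ?_
    ((SimpleGraph.Walk.cons_isCycle_iff _ _).2 ⟨hpath, ?_⟩)
  · intro x hx
    rw [SimpleGraph.Walk.support_cons, List.mem_cons, SimpleGraph.Walk.support_concat,
      List.mem_append, List.mem_singleton] at hx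
    rcases hx with rfl | hx | rfl
    · exact hvT
    · exact hST (hq x hx)
    · exact hvT
  · rw [SimpleGraph.Walk.edges_concat, List.concat_eq_append, List.mem_append, List.mem_singleton]
    rintro (h | h)
    · exact hv (SimpleGraph.Walk.fst_mem_support_of_mem_edges _ h)
    · rw [Sym2.eq_iff] at h
      rcases h with ⟨h, -⟩ | ⟨-, h⟩
      · exact hvS (h ▸ hb)
      · exact hne h

/-- A walk inside `T` from a vertex of `S` to one outside `S` has a dart that leaves `S`. -/
theorem IsInducedSubtree.exists_adj {S T : Finset V} (hT : IsInducedSubtree G T) (hST : S ⊆ T)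
    (hS : S.Nonempty) (hne : ¬ T ⊆ S) : ∃ v ∈ T, v ∉ S ∧ ∃ p ∈ S, G.Adj v p := by
  obtain ⟨s, hs⟩ := hS
  obtain ⟨t, ht, hts⟩ := Finset.not_subset.1 hne
  obtain ⟨w, hw⟩ := induce_preconnected_iff.1 hT.1 s (hST hs) t ht
  obtain ⟨d, hd, h1, h2⟩ := w.exists_boundary_dart (S : Set V) hs hts
  exact ⟨d.snd, hw _ (w.dart_snd_mem_support_of_mem_darts hd), h2, d.fst, h1, d.adj.symm⟩

/-! ### Correctness of the binary partition procedure -/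

/-- The properties of the arguments of the procedure that are preserved by its recursive calls. -/
structure IsPartial (G : SimpleGraph V) (S CAND X : Finset V) : Prop where
  sub : S ⊆ X
  disj : ∀ v ∈ CAND, v ∉ X
  tree : IsInducedSubtree G S
  cand : S.Nonempty → ∀ v ∈ CAND, ∃ p ∈ S, G.Adj v p ∧ ∀ q ∈ S, G.Adj v q → q = p
  other : S.Nonempty → ∀ v, v ∉ X → v ∉ CAND → ∀ p ∈ S, ¬ G.Adj v p
  empty : S = ∅ → ∀ v, v ∉ X → v ∈ CAND

theorem IsPartial.exclude [DecidableEq V] {S CAND X : Finset V} (h : IsPartial G S CAND X) (u : V) :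
    IsPartial G S (CAND.erase u) (insert u X) := by
  refine ⟨h.sub.trans (Finset.subset_insert _ _), fun v hv hv' => ?_, h.tree,
    fun hS v hv => h.cand hS v (Finset.mem_of_mem_erase hv), fun hS v hv hv' => ?_,
    fun hS v hv => ?_⟩
  · rw [Finset.mem_erase] at hv
    rcases Finset.mem_insert.1 hv' with h1 | h1
    · exact hv.1 h1
    · exact h.disj v hv.2 h1
  · rw [Finset.mem_insert, not_or] at hv
    exact h.other hS v hv.2 fun hc => hv' (Finset.mem_erase.2 ⟨hv.1, hc⟩)
  · rw [Finset.mem_insert, not_or] at hv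
    exact Finset.mem_erase.2 ⟨hv.1, h.empty hS v hv.2⟩

variable {n : ℕ} [Fintype V]

open Classical in
theorem mem_newCand {pos : V ≃ Fin n} {S CAND X : Finset V} {u v : V} :
    v ∈ newCand G pos S CAND X u ↔
      if S = ∅ then (G.Adj u v ∧ v ∉ X)
      else (v ∈ CAND ∧ v ≠ u ∧ ¬ G.Adj u v) ∨
        (G.Adj u v ∧ v ∉ X ∧ (pos u < pos v → v ∉ CAND)) := by
  by_cases hS : S = ∅
  · simp only [newCand, hS, if_true, laterNbrs, Gam, nbrs, Finset.mem_union, Finset.mem_sdiff,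
      Finset.mem_filter, Finset.mem_univ, true_and]
    by_cases hA : G.Adj u v
    · have : pos u ≠ pos v := fun h => hA.ne (pos.injective h)
      rcases lt_or_gt_of_ne this with h | h
      · simp [h, hA, h.le]
      · simp [h, hA, h.le]
    · simp [hA]
  · simp only [newCand, hS, if_false, laterNbrs, Gam, nbrs, Finset.mem_union, Finset.mem_sdiff,
      Finset.mem_filter, Finset.mem_univ, true_and, Finset.mem_erase]
    by_cases hA : G.Adj u v
    · have : pos u ≠ pos v := fun h => hA.ne (pos.injective h)
      rcases lt_or_gt_of_ne this with h | h
      · simp [h, hA, h.le, and_comm]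
      · simp [h, hA, h.le]
    · simp [hA, and_comm]

theorem mem_newForbidden {S CAND X : Finset V} {u v : V} :
    v ∈ newForbidden G S CAND X u ↔
      v = u ∨ v ∈ X ∨ (S ≠ ∅ ∧ v ∈ CAND ∧ G.Adj u v) := by
  by_cases hS : S = ∅
  · simp [newForbidden, hS]
  · simp [newForbidden, hS, nbrs]

/-- An old candidate not adjacent to `u` keeps its unique neighbour; a vertex that becomes a
candidate was outside `X` and `CAND`, hence not adjacent to `S`, and its only neighbour is `u`. The
set `Gam` does not exclude candidates by itself: minimality of `u` does this, as a candidate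
adjacent to `u` comes after `u`. -/
theorem IsPartial.include [DecidableEq V] {pos : V ≃ Fin n} {S CAND X : Finset V}
    (h : IsPartial G S CAND X) (u : V) (hu : u ∈ CAND) (hmin : ∀ v ∈ CAND, pos u ≤ pos v) :
    IsPartial G (insert u S) (newCand G pos S CAND X u) (newForbidden G S CAND X u) := by
  have huX := h.disj u hu
  have huS : u ∉ S := fun hc => huX (h.sub hc)
  refine ⟨fun v hv => ?_, fun v hv hv' => ?_, ?_, fun _ v hv => ?_, fun _ v hv hv' p hp hA => ?_,
    fun hS => absurd hS (Finset.insert_nonempty _ _).ne_empty⟩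
  · rw [mem_newForbidden]
    rcases Finset.mem_insert.1 hv with h1 | h1
    · exact Or.inl h1
    · exact Or.inr (Or.inl (h.sub h1))
  · rw [mem_newCand] at hv
    rw [mem_newForbidden] at hv'
    by_cases hS : S = ∅
    · simp only [hS, if_true, ne_eq, not_true_eq_false, false_and, or_false] at hv hv'
      rcases hv' with rfl | hv'
      · exact G.loopless.irrefl _ hv.1
      · exact hv.2 hv'
    · simp only [hS, if_false, ne_eq, not_false_eq_true, true_and] at hv hv'
      rcases hv with ⟨h1, h2, h3⟩ | ⟨h1, h2, h3⟩
      · rcases hv' with h4 | h4 | h4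
        · exact h2 h4
        · exact h.disj v h1 h4
        · exact h3 h4.2
      · rcases hv' with rfl | h4 | h4
        · exact G.loopless.irrefl _ h1
        · exact h2 h4
        · exact h3 (lt_of_le_of_ne (hmin v h4.1) fun he => h1.ne (pos.injective he)) h4.1
  · rcases Finset.eq_empty_or_nonempty S with rfl | hS
    · simpa using isInducedSubtree_singleton u
    · obtain ⟨p, hp, hup, huq⟩ := h.cand hS u hu
      exact h.tree.insert hp hup huq
  · rw [mem_newCand] at hv
    rcases Finset.eq_empty_or_nonempty S with rfl | hS
    · simp only [if_true] at hv
      exact ⟨u, by simp, hv.1.symm, by simp⟩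
    · simp only [hS.ne_empty, if_false] at hv
      rcases hv with ⟨h1, h2, h3⟩ | ⟨h1, h2, h3⟩
      · obtain ⟨p, hp, hup, huq⟩ := h.cand hS v h1
        refine ⟨p, Finset.mem_insert_of_mem hp, hup, fun q hq hq' => ?_⟩
        rcases Finset.mem_insert.1 hq with rfl | hq
        · exact absurd hq'.symm h3
        · exact huq q hq hq'
      · refine ⟨u, by simp, h1.symm, fun q hq hq' => ?_⟩
        rcases Finset.mem_insert.1 hq with rfl | hq
        · rfl
        · refine absurd hq' (h.other hS v h2 (fun hc => ?_) q hq)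
          exact h3 (lt_of_le_of_ne (hmin v hc) fun he => h1.ne (pos.injective he)) hc
  · rw [mem_newForbidden] at hv
    rw [mem_newCand] at hv'
    rcases Finset.eq_empty_or_nonempty S with rfl | hS
    · simp only [if_true] at hv'
      obtain rfl : p = u := by simpa using hp
      exact hv' ⟨hA.symm, fun hc => hv (Or.inr (Or.inl hc))⟩
    · simp only [hS.ne_empty, if_false, ne_eq, not_false_eq_true, true_and, not_or] at hv hv'
      rcases Finset.mem_insert.1 hp with rfl | hp
      · exact hv'.2 ⟨hA.symm, hv.2.1, fun _ hc => hv.2.2 ⟨hc, hA.symm⟩⟩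
      · refine h.other hS v hv.2.1 (fun hc => ?_) p hp hA
        exact hv'.1 ⟨hc, hv.1, fun hA' => hv.2.2 ⟨hc, hA'⟩⟩

/-- At a leaf, a strictly larger tree `T` would contain a vertex adjacent to `S` that is neither
forbidden nor a candidate, or any vertex outside `X` if `S` is empty. At a branch the trees are
split by whether they contain `u`, and those with `u` lose nothing through the newly forbidden
vertices, which would close a cycle. -/
theorem ISE.correct {pos : V ≃ Fin n} {S CAND X : Finset V} {L : List (Finset V)}
    (h : ISE G pos S CAND X L) (hp : IsPartial G S CAND X) : L.Nodup ∧
      ∀ T, T ∈ L ↔ IsInducedSubtree G T ∧ S ⊆ T ∧ ∀ v ∈ T, v ∉ S → v ∉ X := by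
  classical
  induction h with
  | leaf S X =>
    refine ⟨List.nodup_singleton _, fun T => ?_⟩
    rw [List.mem_singleton]
    constructor
    · rintro rfl
      exact ⟨hp.tree, subset_rfl, fun v h1 h2 => absurd h1 h2⟩
    · rintro ⟨h1, h2, h3⟩
      refine (h2.antisymm ?_).symm
      by_contra hne
      rcases Finset.eq_empty_or_nonempty S with rfl | hS
      · obtain ⟨t, ht, hts⟩ := Finset.not_subset.1 hne
        exact absurd (hp.empty rfl t (h3 t ht hts)) (by simp)
      · obtain ⟨v, hv, hvS, p, hpS, hA⟩ := h1.exists_adj h2 hS hne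
        exact hp.other hS v (h3 v hv hvS) (by simp) p hpS hA
  | branch S CAND X u L₁ L₂ hu hmin h₁ h₂ ih₁ ih₂ =>
    have huX := hp.disj u hu
    have huS : u ∉ S := fun hc => huX (hp.sub hc)
    have e1 := hp.exclude u
    have e2 := hp.include u hu hmin
    obtain ⟨n1, m1⟩ := ih₁ (by convert e1)
    obtain ⟨n2, m2⟩ := ih₂ (by convert e2)
    have m1' : ∀ T, T ∈ L₁ ↔ (IsInducedSubtree G T ∧ S ⊆ T ∧ ∀ v ∈ T, v ∉ S → v ∉ X) ∧ u ∉ T := by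
      intro T
      rw [m1]
      constructor
      · rintro ⟨h1, h2, h3⟩
        refine ⟨⟨h1, h2, fun v hv hvS hvX => h3 v hv hvS (Finset.mem_insert_of_mem hvX)⟩, fun hT => ?_⟩
        exact h3 u hT huS (Finset.mem_insert_self _ _)
      · rintro ⟨⟨h1, h2, h3⟩, h4⟩
        refine ⟨h1, h2, fun v hv hvS hvX => ?_⟩
        rcases Finset.mem_insert.1 hvX with rfl | h5
        · exact h4 hv
        · exact h3 v hv hvS h5
    have m2' : ∀ T, T ∈ L₂ ↔ (IsInducedSubtree G T ∧ S ⊆ T ∧ ∀ v ∈ T, v ∉ S → v ∉ X) ∧ u ∈ T := by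
      intro T
      rw [m2]
      constructor
      · rintro ⟨h1, h2, h3⟩
        refine ⟨⟨h1, fun v hv => h2 (Finset.mem_insert_of_mem hv), fun v hv hvS hvX => ?_⟩,
          h2 (Finset.mem_insert_self _ _)⟩
        refine h3 v hv (fun h4 => ?_) (mem_newForbidden.2 (Or.inr (Or.inl hvX)))
        rcases Finset.mem_insert.1 h4 with rfl | h5
        · exact huX hvX
        · exact hvS h5
      · rintro ⟨⟨h1, h2, h3⟩, h4⟩
        refine ⟨h1, Finset.insert_subset h4 h2, fun v hv hvS hvX => ?_⟩
        rw [Finset.mem_insert, not_or] at hvS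
        rcases mem_newForbidden.1 hvX with h5 | h5 | ⟨h5, h6, h7⟩
        · exact hvS.1 h5
        · exact h3 v hv hvS.2 h5
        -- The vertex `v` was a candidate adjacent to `u` and also has a neighbour `p` in `S`. Both
        -- neighbours lie in the tree `insert u S`, so `u = p ∈ S`, which is impossible.
        · obtain ⟨p, hpS, hA, -⟩ := hp.cand (Finset.nonempty_iff_ne_empty.2 h5) v h6
          refine huS (h1.unique_adj e2.tree (Finset.insert_subset h4 h2) hv ?_
            (Finset.mem_insert_self _ _) (Finset.mem_insert_of_mem hpS) h7.symm hA ▸ hpS)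
          rw [Finset.mem_insert]; tauto
    refine ⟨List.nodup_append.2 ⟨n1, n2, fun a ha b hb hab => ?_⟩, fun T => ?_⟩
    · subst hab
      exact ((m1' a).1 ha).2 ((m2' a).1 hb).2
    · rw [List.mem_append, m1', m2']; tauto

theorem ISE.start_correct {pos : V ≃ Fin n} {L : List (Finset V)}
    (h : ISE G pos ∅ Finset.univ ∅ L) : L.Nodup ∧ ∀ T, T ∈ L ↔ IsInducedSubtree G T := by
  have := h.correct ⟨by simp, by simp, isInducedSubtree_empty, by simp, by simp, by simp⟩
  simpa using this

theorem isDegenerate_degeneracy (G : SimpleGraph V) : IsDegenerate G (degeneracy G) := by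
  have : {d : ℕ | IsDegenerate G d}.Nonempty := by
    refine ⟨Fintype.card V, fun S hS => ?_⟩
    obtain ⟨v, hv⟩ := hS
    refine ⟨v, hv, ?_⟩
    unfold adjCount
    exact Finset.card_le_univ _
  exact Nat.sInf_mem this

/-- In a Matula–Beck ordering every vertex has at most `degeneracy G` later neighbours. -/
theorem IsMatulaBeckOrder.adjCount_le {pos : V ≃ Fin n} (h : IsMatulaBeckOrder G pos) (u : V) :
    adjCount G (Finset.univ.filter (fun w => pos u ≤ pos w)) u ≤ degeneracy G := by
  obtain ⟨v, hv, hd⟩ := isDegenerate_degeneracy G (Finset.univ.filter (fun w => pos u ≤ pos w))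
    ⟨u, by simp⟩
  exact (h u v (by simpa using hv)).trans hd

end Graph

end InducedSubtrees

namespace InducedSubtrees

/-! ## Logged writes

The arrays `4`, `5`, `6` are a trail of the writes to the arrays `0`, …, `3`: array number, index
and old value. Register `5` is its length. -/

infixr:60 " ;; " => HProg.seq

/-- The entry `i` of the array `k`. -/
abbrev arr (k : ℕ) (i : Expr) : Expr := .fld (.const k) i

abbrev rg (r : ℕ) : Expr := .reg r

/-- Write `v` to the entry `i` of the array `k` and log this. -/
def logStore (k : ℕ) (i v : Expr) : HProg :=
  .store (.const 4) (rg 5) (.const k) ;; .store (.const 5) (rg 5) i ;;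
  .store (.const 6) (rg 5) (arr k i) ;; .store (.const k) i v ;;
  .assign 5 (.add (rg 5) (.const 1))

/-- The expression does not read the trail. -/
def Expr.noTrail : Expr → Bool
  | reg _ => true
  | const _ => true
  | add a b => a.noTrail && b.noTrail
  | sub a b => a.noTrail && b.noTrail
  | fld (.const k) i => k != 4 && (k != 5 && (k != 6 && i.noTrail))
  | fld _ _ => false
  | raw i => i.noTrail

/-- A logged write evaluates its index and value after parts of the trail have been written;
expressions that do not read the trail are not disturbed by this. -/
theorem Expr.noTrail_congr {B β : ℕ} {s t : HState} (hr : t.reg = s.reg) (hw : t.raw = s.raw)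
    (hf : ∀ k, k ≠ 4 → k ≠ 5 → k ≠ 6 → t.fld k = s.fld k) :
    ∀ e : Expr, e.noTrail = true → e.eval t = e.eval s ∧ (e.Ok B β t ↔ e.Ok B β s)
  | reg r, _ => by simp [hr]
  | const c, _ => by simp
  | add a b, h => by
    simp only [noTrail, Bool.and_eq_true] at h
    have ha := noTrail_congr (B := B) (β := β) hr hw hf a h.1
    have hb := noTrail_congr (B := B) (β := β) hr hw hf b h.2
    simp [ha.1, hb.1, ha.2, hb.2]
  | sub a b, h => by
    simp only [noTrail, Bool.and_eq_true] at h
    have ha := noTrail_congr (B := B) (β := β) hr hw hf a h.1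
    have hb := noTrail_congr (B := B) (β := β) hr hw hf b h.2
    simp [ha.1, hb.1, ha.2, hb.2]
  | fld (.const k) i, h => by
    simp only [noTrail, Bool.and_eq_true, bne_iff_ne] at h
    have hi := noTrail_congr (B := B) (β := β) hr hw hf i h.2.2.2
    simp [hi.1, hi.2, hf k h.1 h.2.1 h.2.2.1]
  | fld (.reg _) _, h => by simp [noTrail] at h
  | fld (.add _ _) _, h => by simp [noTrail] at h
  | fld (.sub _ _) _, h => by simp [noTrail] at h
  | fld (.fld _ _) _, h => by simp [noTrail] at h
  | fld (.raw _) _, h => by simp [noTrail] at h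
  | raw i, h => by
    have hi := noTrail_congr (B := B) (β := β) hr hw hf i h
    simp [hi.1, hi.2, hw]

/-- The effect of `logStore`. -/
def HState.log (s : HState) (k i v : ℕ) : HState where
  reg := Function.update s.reg 5 (s.reg 5 + 1)
  fld := fun k' => if k' = k then Function.update (s.fld k) i v
    else if k' = 4 then Function.update (s.fld 4) (s.reg 5) k
    else if k' = 5 then Function.update (s.fld 5) (s.reg 5) i
    else if k' = 6 then Function.update (s.fld 6) (s.reg 5) (s.fld k i)
    else s.fld k'
  raw := s.raw
  out := s.out
  time := s.time + 5

section Log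

variable (s : HState) (k i v : ℕ)

@[simp] theorem HState.log_reg (r : ℕ) : (s.log k i v).reg r = if r = 5 then s.reg 5 + 1 else s.reg r := by
  simp [HState.log, Function.update_apply]
@[simp] theorem HState.log_fld (k' : ℕ) : (s.log k i v).fld k' =
    if k' = k then Function.update (s.fld k) i v
    else if k' = 4 then Function.update (s.fld 4) (s.reg 5) k
    else if k' = 5 then Function.update (s.fld 5) (s.reg 5) i
    else if k' = 6 then Function.update (s.fld 6) (s.reg 5) (s.fld k i)
    else s.fld k' := rfl
@[simp] theorem HState.log_raw : (s.log k i v).raw = s.raw := rfl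
@[simp] theorem HState.log_out : (s.log k i v).out = s.out := rfl
@[simp] theorem HState.log_time : (s.log k i v).time = s.time + 5 := rfl

end Log

theorem wp_logStore {B β : ℕ} {Q : HState → Prop} {s : HState} {k : ℕ} {i v : Expr} (hk : k < 4)
    (hi : i.noTrail = true) (hv : v.noTrail = true) (hB : 16 ≤ B) (oi : i.Ok B β s)
    (ov : v.Ok B β s) (ht : s.reg 5 + 1 ≤ B) (hQ : Q (s.log k (i.eval s) (v.eval s))) :
    Wp B β (logStore k i v) Q s := by
  let s1 := s.setFld 4 (s.reg 5) k
  let s2 := s1.setFld 5 (s.reg 5) (i.eval s)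
  let s3 := s2.setFld 6 (s.reg 5) (s.fld k (i.eval s))
  have hf1 : ∀ k, k ≠ 4 → k ≠ 5 → k ≠ 6 → s1.fld k = s.fld k := by
    intro k h4 h5 h6; simp [s1, h4]
  have hf2 : ∀ k, k ≠ 4 → k ≠ 5 → k ≠ 6 → s2.fld k = s.fld k := by
    intro k h4 h5 h6; simp [s2, s1, h4, h5]
  have hf3 : ∀ k, k ≠ 4 → k ≠ 5 → k ≠ 6 → s3.fld k = s.fld k := by
    intro k h4 h5 h6; simp [s3, s2, s1, h4, h5, h6]
  have i1 := Expr.noTrail_congr (B := B) (β := β) (s := s) (t := s1) rfl rfl hf1 i hi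
  have i2 := Expr.noTrail_congr (B := B) (β := β) (s := s) (t := s2) rfl rfl hf2 i hi
  have i3 := Expr.noTrail_congr (B := B) (β := β) (s := s) (t := s3) rfl rfl hf3 i hi
  have v3 := Expr.noTrail_congr (B := B) (β := β) (s := s) (t := s3) rfl rfl hf3 v hv
  refine ⟨s.log k (i.eval s) (v.eval s), ?_, hQ⟩
  have e1 : HExec B β (.store (.const 4) (rg 5) (.const k)) s s1 :=
    .store (by simp; omega) trivial (by simp; omega) (by simp)
  have e2 : HExec B β (.store (.const 5) (rg 5) i) s1 s2 := by
    have := HExec.store (B := B) (β := β) (s := s1) (k := .const 5) (i := rg 5) (e := i)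
      (by simp; omega) trivial (i1.2.2 oi) (by simp)
    rw [i1.1] at this; exact this
  have hks : s2.fld k = s.fld k := hf2 k (by omega) (by omega) (by omega)
  have e3 : HExec B β (.store (.const 6) (rg 5) (arr k i)) s2 s3 := by
    have := HExec.store (B := B) (β := β) (s := s2) (k := .const 6) (i := rg 5) (e := arr k i)
      (by simp; omega) trivial (by simp only [Expr.Ok, Expr.eval]; exact ⟨by omega, i2.2.2 oi, by omega⟩)
      (by simp)
    simp only [Expr.eval, i2.1, hks] at this; exact this
  have e4 : HExec B β (.store (.const k) i v) s3 (s3.setFld k (i.eval s) (v.eval s)) := by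
    have := HExec.store (B := B) (β := β) (s := s3) (k := .const k) (i := i) (e := v)
      (by simp; omega) (i3.2.2 oi) (v3.2.2 ov) (by simp; omega)
    rw [i3.1, v3.1] at this; exact this
  have e5 := HExec.assign (B := B) (β := β) (s := s3.setFld k (i.eval s) (v.eval s)) (r := 5)
    (e := .add (rg 5) (.const 1)) (by simp [s3, s2, s1]; omega)
  have := HExec.seq e1 (.seq e2 (.seq e3 (.seq e4 e5)))
  have hs : s.log k (i.eval s) (v.eval s) =
      (s3.setFld k (i.eval s) (v.eval s)).setReg 5 (s.reg 5 + 1) := by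
    ext k' i'
    · simp [s3, s2, s1]
    · simp only [HState.log_fld, HState.setReg_fld, HState.setFld_fld, s3, s2, s1]
      have := show k ≠ 4 ∧ k ≠ 5 ∧ k ≠ 6 by omega
      by_cases h : k' = k
      · subst h; simp [this]
      · by_cases h4 : k' = 4
        · subst h4; simp [h]
        · by_cases h5 : k' = 5
          · subst h5; simp [h]
          · by_cases h6 : k' = 6
            · subst h6; simp [h]
            · simp [h, h4, h5, h6]
    all_goals rfl
  rw [hs]; exact this

/-- Undo `j` writes, down to the length `m` of the trail `T`. -/
def unwind (T : ℕ → ℕ → ℕ) (m : ℕ) : ℕ → (ℕ → ℕ → ℕ) → ℕ → ℕ → ℕ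
  | 0, f => f
  | j + 1, f => unwind T m j (Function.update f (T 4 (m + j))
      (Function.update (f (T 4 (m + j))) (T 5 (m + j)) (T 6 (m + j))))

/-- Undoing acts on each array separately: the result in array `k` depends only on that array and on
the used part of the trail. States that differ elsewhere can thus be compared. -/
theorem unwind_congr {T T' : ℕ → ℕ → ℕ} {m j k : ℕ} {f f' : ℕ → ℕ → ℕ}
    (hT : ∀ i < m + j, T 4 i = T' 4 i ∧ T 5 i = T' 5 i ∧ T 6 i = T' 6 i) (hf : f k = f' k) :
    unwind T m j f k = unwind T' m j f' k := by
  induction j generalizing f f' with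
  | zero => exact hf
  | succ j ih =>
    refine ih (fun i hi => hT i (by omega)) ?_
    obtain ⟨h4, h5, h6⟩ := hT (m + j) (by omega)
    rw [h4, h5, h6]
    by_cases h : k = T' 4 (m + j)
    · subst h; simp [hf]
    · rw [Function.update_of_ne h, Function.update_of_ne h, hf]

/-- Undoing the trail of `s` down to the length `m` restores the logged arrays of `g`. -/
structure Undoes (m : ℕ) (s : HState) (g : ℕ → ℕ → ℕ) : Prop where
  le : m ≤ s.reg 5
  key : ∀ i, m ≤ i → i < s.reg 5 → s.fld 4 i < 4
  eq : ∀ k < 4, unwind s.fld m (s.reg 5 - m) s.fld k = g k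
  old : ∀ k, 4 ≤ k → k < 7 → ∀ i < m, s.fld k i = g k i

theorem Undoes.refl (s : HState) : Undoes (s.reg 5) s s.fld :=
  ⟨le_rfl, fun i h h' => by omega, fun k _ => by rw [Nat.sub_self]; rfl, fun _ _ _ _ _ => rfl⟩

theorem Undoes.congr {m : ℕ} {s t : HState} {g : ℕ → ℕ → ℕ} (h : Undoes m s g)
    (hr : t.reg 5 = s.reg 5) (hf : ∀ k < 7, t.fld k = s.fld k) : Undoes m t g := by
  refine ⟨hr ▸ h.le, fun i h1 h2 => ?_, fun k hk => ?_, fun k h1 h2 i hi => ?_⟩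
  · rw [hf 4 (by omega)]; exact h.key i h1 (hr ▸ h2)
  · rw [hr, ← h.eq k hk]
    refine unwind_congr (fun i _ => ?_) (hf k (by omega))
    simp [hf]
  · rw [hf k h2]; exact h.old k h1 h2 i hi

/-- The newest trail entry holds the place and the old value of the new write, so the first step of
undoing cancels it, and the rest is the undoing known before. -/
theorem Undoes.log {m : ℕ} {s : HState} {g : ℕ → ℕ → ℕ} (h : Undoes m s g) {k : ℕ} (hk : k < 4)
    (i v : ℕ) : Undoes m (s.log k i v) g := by
  have hle := h.le
  have k4 : 4 ≠ k := by omega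
  have k5 : 5 ≠ k := by omega
  have k6 : 6 ≠ k := by omega
  refine ⟨by simp; omega, fun j h1 h2 => ?_, fun k' hk' => ?_, fun k' h1 h2 j hj => ?_⟩
  · simp only [HState.log_reg, if_true] at h2
    simp only [HState.log_fld, k4, if_false, if_true]
    rw [Function.update_apply]; split
    · exact hk
    · exact h.key j h1 (by omega)
  · have e : (s.log k i v).reg 5 - m = (s.reg 5 - m) + 1 := by simp; omega
    rw [e, unwind, show m + (s.reg 5 - m) = s.reg 5 by omega, ← h.eq k' hk']
    refine unwind_congr (fun j hj => ?_) ?_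
    · have : j ≠ s.reg 5 := by omega
      simp [k4, k5, k6, Function.update_of_ne this]
    · simp only [HState.log_fld, k4, k5, k6, if_false, if_true, Function.update_self]
      by_cases h' : k' = k
      · subst h'; simp
      · rw [Function.update_of_ne h', HState.log_fld, if_neg h']
        simp [show k' ≠ 4 by omega, show k' ≠ 5 by omega, show k' ≠ 6 by omega]
  · have : j ≠ s.reg 5 := by omega
    rw [← h.old k' h1 h2 j hj]
    simp only [HState.log_fld]
    rw [if_neg (by omega)]
    split_ifs with h3 h4 h5
    · subst h3; rw [Function.update_of_ne this]
    · subst h4; rw [Function.update_of_ne this]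
    · subst h5; rw [Function.update_of_ne this]
    · rfl

/-- Undo all writes down to the trail length in register `13`. -/
def undo : HProg :=
  .while (rg 13) (rg 5) (.assign 5 (.sub (rg 5) (.const 1)) ;;
    .store (arr 4 (rg 5)) (arr 5 (rg 5)) (arr 6 (rg 5)))

/-- The array number of the write is read from the trail; that it is below `4` keeps the trail
itself from being overwritten. Each undone entry costs three steps: the test, the decrement and the
store. -/
theorem undo_exec {B β : ℕ} {s : HState} {g : ℕ → ℕ → ℕ} (hB : 16 ≤ B)
    (h : Undoes (s.reg 13) s g) : ∃ t, HExec B β undo s t ∧ t.reg 5 = s.reg 13 ∧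
      (∀ r ≠ 5, t.reg r = s.reg r) ∧ (∀ k < 4, t.fld k = g k) ∧ (∀ k, 4 ≤ k → t.fld k = s.fld k) ∧
      t.raw = s.raw ∧ t.out = s.out ∧ t.time ≤ s.time + 3 * (s.reg 5 - s.reg 13) + 1 := by
  refine wp_while (fun j t => Undoes (s.reg 13) t g ∧ (∀ r ≠ 5, t.reg r = s.reg r) ∧
    (∀ k, 4 ≤ k → t.fld k = s.fld k) ∧ t.raw = s.raw ∧ t.out = s.out ∧
    j = t.reg 5 - s.reg 13 ∧ t.time + 3 * j ≤ s.time + 3 * (s.reg 5 - s.reg 13))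
    (s.reg 5 - s.reg 13) ?_ ?_ ?_ ?_
  · exact ⟨h, fun _ _ => rfl, fun _ _ => rfl, rfl, rfl, rfl, le_rfl⟩
  · intros; exact ⟨trivial, trivial⟩
  · rintro j t ⟨h1, h2, h3, h4, h5, rfl, h7⟩ hlt
    simp only [Expr.eval] at hlt
    have h13 := h2 13 (by decide)
    rw [h13] at hlt
    have hkey := h1.key (t.reg 5 - 1) (by omega) (by omega)
    simp only [wp_seq, wp_assign, wp_store, Expr.Ok, Expr.eval, HState.tick_reg, HState.setReg_reg,
      HState.setReg_fld, HState.tick_fld, if_true]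
    refine ⟨⟨trivial, by omega⟩, ⟨⟨by omega, trivial, by omega⟩, ⟨by omega, trivial, by omega⟩,
      ⟨by omega, trivial, by omega⟩, by omega⟩, t.reg 5 - 1 - s.reg 13, by omega, ?_, ?_, ?_, h4, h5,
      by simp, ?_⟩
    · refine ⟨by simp; omega, fun i h8 h9 => ?_, fun k hk => ?_, fun k h8 h9 i hi => ?_⟩
      · simp only [HState.setFld_reg, HState.setReg_reg, if_true, HState.setFld_fld, HState.setReg_fld,
          HState.tick_fld] at h9 ⊢
        rw [if_neg (by omega)]; exact h1.key i h8 (by omega)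
      · rw [← h1.eq k hk]
        obtain ⟨q, hq⟩ : ∃ q, t.reg 5 - s.reg 13 = q + 1 := ⟨t.reg 5 - 1 - s.reg 13, by omega⟩
        have hq' : s.reg 13 + q = t.reg 5 - 1 := by omega
        rw [hq, unwind, hq']
        simp only [HState.setFld_reg, HState.setReg_reg, if_true]
        rw [show t.reg 5 - 1 - s.reg 13 = q by omega]
        refine unwind_congr (fun i _ => ?_) ?_
        · simp only [HState.setFld_fld, HState.setReg_fld, HState.tick_fld]
          rw [if_neg (by omega), if_neg (by omega), if_neg (by omega)]; exact ⟨rfl, rfl, rfl⟩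
        · simp only [HState.setFld_fld, HState.setReg_fld, HState.tick_fld, Function.update_apply]
      · simp only [HState.setFld_fld, HState.setReg_fld, HState.tick_fld]
        rw [if_neg (by omega)]; exact h1.old k h8 h9 i hi
    · intro r hr
      simp only [HState.setFld_reg, HState.setReg_reg, if_neg hr]; exact h2 r hr
    · intro k hk
      simp only [HState.setFld_fld, HState.setReg_fld, HState.tick_fld]
      rw [if_neg (by omega)]; exact h3 k hk
    · simp only [HState.setFld_time, HState.setReg_time, HState.tick_time]; omega
  · rintro j t ⟨h1, h2, h3, h4, h5, rfl, h7⟩ hlt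
    simp only [Expr.eval, h2 13 (by decide)] at hlt
    have hle := h1.le
    refine ⟨by simp only [HState.tick_reg]; omega, h2, fun k hk => ?_, h3, h4, h5,
      by simp only [HState.tick_time]; omega⟩
    have := h1.eq k hk
    rw [show t.reg 5 - s.reg 13 = 0 by omega] at this
    exact this

end InducedSubtrees

namespace InducedSubtrees

/-! ## Data structures of the enumeration

Vertices are represented by their ranks. `A` is the adjacency relation of the ranks. -/

/-- The neighbours of `v` after `v`. -/
def later (n : ℕ) (A : ℕ → ℕ → Bool) (v : ℕ) : List ℕ :=
  (List.range n).filter fun w => decide (v < w) && A v w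

/-- The neighbours of `w` before `w` in `F`. -/
def earlierIn (A : ℕ → ℕ → Bool) (F : Finset ℕ) (w : ℕ) : List ℕ :=
  (List.range w).filter fun v => decide (v ∈ F) && A v w

/-- The list cell for the edge from `v` to the later vertex `w`. -/
def cell (n : ℕ) (A : ℕ → ℕ → Bool) (lo : ℕ → ℕ) (w v : ℕ) : ℕ :=
  n + (lo v + (later n A v).idxOf w)

/-- The lists of later neighbours are stored in disjoint blocks below `L`. -/
structure Layout (n L : ℕ) (A : ℕ → ℕ → Bool) (lo : ℕ → ℕ) : Prop where
  bound : ∀ v < n, lo v + (later n A v).length ≤ L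
  sep : ∀ v < n, ∀ w < n, v ≠ w →
    lo v + (later n A v).length ≤ lo w ∨ lo w + (later n A w).length ≤ lo v

/-- The part of the memory that the enumeration does not change. -/
structure Static (n L : ℕ) (A : ℕ → ℕ → Bool) (lo ord : ℕ → ℕ) (s : HState) : Prop where
  num : s.reg 0 = n
  len : s.reg 1 = L
  first : ∀ v < n, s.fld 9 v = lo v
  last : ∀ v < n, s.fld 10 v = lo v + (later n A v).length
  tgt : ∀ v < n, ∀ j (h : j < (later n A v).length), s.fld 11 (lo v + j) = (later n A v)[j]
  name : ∀ v < n, s.raw (L + v) = ord v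

/-- The lists of earlier neighbours in `F` are maintained. -/
structure Fresh (n : ℕ) (A : ℕ → ℕ → Bool) (lo : ℕ → ℕ) (F : Finset ℕ) (s : HState) : Prop where
  lt : ∀ v ∈ F, v < n
  flag : ∀ v < n, s.fld 0 v = if v ∈ F then 1 else 0
  fam : Fam (s.fld 2) (s.fld 3) n fun w => (earlierIn A F w).map (cell n A lo w)
  src : ∀ v ∈ F, ∀ j < (later n A v).length, s.fld 12 (lo v + j) = v

section Basic

variable {n L : ℕ} {A : ℕ → ℕ → Bool} {lo ord : ℕ → ℕ} {F : Finset ℕ}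

theorem mem_later {v w : ℕ} : w ∈ later n A v ↔ w < n ∧ v < w ∧ A v w = true := by
  simp [later]

theorem mem_earlierIn {v w : ℕ} : v ∈ earlierIn A F w ↔ v < w ∧ v ∈ F ∧ A v w = true := by
  simp [earlierIn]

theorem later_nodup (v : ℕ) : (later n A v).Nodup := List.nodup_range.filter _

theorem later_sorted (v : ℕ) : (later n A v).Pairwise (· < ·) := List.pairwise_lt_range.filter _

theorem earlierIn_sorted (w : ℕ) : (earlierIn A F w).Pairwise (· < ·) :=
  List.pairwise_lt_range.filter _

theorem earlierIn_erase (y w : ℕ) :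
    earlierIn A (F.erase y) w = (earlierIn A F w).filter fun v => decide (v ≠ y) := by
  rw [earlierIn, earlierIn, List.filter_filter]
  refine List.filter_congr fun v _ => ?_
  by_cases h1 : v = y <;> by_cases h2 : v ∈ F <;> simp [h1, h2]

theorem earlierIn_erase_of_notMem {y w : ℕ} (h : y ∉ earlierIn A F w) :
    earlierIn A (F.erase y) w = earlierIn A F w := by
  rw [earlierIn_erase, List.filter_eq_self]
  intro v hv
  simp only [decide_eq_true_eq]
  rintro rfl; exact h hv

theorem cell_getElem {v j : ℕ} (hj : j < (later n A v).length) :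
    cell n A lo (later n A v)[j] v = n + (lo v + j) := by
  rw [cell, (later_nodup v).idxOf_getElem]

/-- Blocks of different vertices are disjoint and inside a block the offset is the position of the
neighbour, so a cell identifies its edge. -/
theorem cell_inj (hL : Layout n L A lo) {v w v' w' : ℕ} (hv : v < n) (hv' : v' < n)
    (hw : w ∈ later n A v) (hw' : w' ∈ later n A v')
    (h : cell n A lo w v = cell n A lo w' v') : v = v' ∧ w = w' := by
  have h1 := List.idxOf_lt_length_of_mem hw
  have h2 := List.idxOf_lt_length_of_mem hw'
  simp only [cell] at h
  by_cases hvv : v = v'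
  · subst hvv
    exact ⟨rfl, (List.idxOf_inj hw).1 (by omega)⟩
  · have := hL.sep v hv v' hv' hvv
    omega

theorem Static.congr {s t : HState} (h : Static n L A lo ord s) (h0 : t.reg 0 = s.reg 0)
    (h1 : t.reg 1 = s.reg 1) (h9 : t.fld 9 = s.fld 9) (h10 : t.fld 10 = s.fld 10)
    (h11 : t.fld 11 = s.fld 11) (hr : t.raw = s.raw) : Static n L A lo ord t :=
  ⟨h0.trans h.num, h1.trans h.len, by rw [h9]; exact h.first, by rw [h10]; exact h.last,
    by rw [h11]; exact h.tgt, by rw [hr]; exact h.name⟩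

theorem Static.exec {B β : ℕ} {p : HProg} {s t : HState} (h : Static n L A lo ord s)
    (hx : HExec B β p s t)
    (hp : (p.noReg 0 && p.noReg 1 && p.noFld 9 && p.noFld 10 && p.noFld 11 && p.noRaw) = true) :
    Static n L A lo ord t := by
  simp only [Bool.and_eq_true] at hp
  exact h.congr (hx.reg_eq hp.1.1.1.1.1) (hx.reg_eq hp.1.1.1.1.2) (hx.fld_eq hp.1.1.1.2)
    (hx.fld_eq hp.1.1.2) (hx.fld_eq hp.1.2) (hx.raw_eq hp.2)

theorem Fresh.congr {s t : HState} (h : Fresh n A lo F s) (h0 : t.fld 0 = s.fld 0)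
    (h2 : t.fld 2 = s.fld 2) (h3 : t.fld 3 = s.fld 3) (h12 : t.fld 12 = s.fld 12) :
    Fresh n A lo F t :=
  ⟨h.lt, by rw [h0]; exact h.flag, by rw [h2, h3]; exact h.fam, by rw [h12]; exact h.src⟩

end Basic

/-! ### Removing a vertex from the lists -/

/-- Remove the vertex in register `11` from the lists of its later neighbours. -/
def unfresh : HProg :=
  logStore 0 (rg 11) (.const 0) ;; .assign 12 (arr 9 (rg 11)) ;;
  .while (rg 12) (arr 10 (rg 11))
    (logStore 2 (arr 3 (.add (rg 0) (rg 12))) (arr 2 (.add (rg 0) (rg 12))) ;;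
     logStore 3 (arr 2 (.add (rg 0) (rg 12))) (arr 3 (.add (rg 0) (rg 12))) ;;
     .assign 12 (.add (rg 12) (.const 1)))

variable {n L B β : ℕ} {A : ℕ → ℕ → Bool} {lo ord : ℕ → ℕ} {F : Finset ℕ}

/-- During the loop the lists of the first `i` later neighbours have already lost `y` and the others
have not; the set of fresh vertices is therefore made to depend on the header `w`. Injectivity of
cells turns the erasure of one cell into the removal of the vertex `y`. -/
theorem fam_unlink_take (hL : Layout n L A lo) {nx pv : ℕ → ℕ} {y i : ℕ} (hy : y ∈ F)
    (hF : ∀ v ∈ F, v < n) (hi : i < (later n A y).length)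
    (h : Fam nx pv n fun w => (earlierIn A
      (if w ∈ (later n A y).take i then F.erase y else F) w).map (cell n A lo w)) :
    pv (n + (lo y + i)) ≠ n + (lo y + i) ∧
    Fam (Function.update nx (pv (n + (lo y + i))) (nx (n + (lo y + i))))
      (Function.update pv (nx (n + (lo y + i))) (pv (n + (lo y + i)))) n fun w => (earlierIn A
        (if w ∈ (later n A y).take (i + 1) then F.erase y else F) w).map (cell n A lo w) := by
  set w := (later n A y)[i] with hw
  have hwl : w ∈ later n A y := List.getElem_mem hi
  obtain ⟨hwn, hyw, hA⟩ := mem_later.1 hwl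
  have hwt : w ∉ (later n A y).take i := by
    intro hc
    obtain ⟨j, hj, hj'⟩ := List.mem_take_iff_getElem.1 hc
    rw [hw] at hj'
    have := (later_nodup (n := n) (A := A) y).getElem_inj_iff.1 hj'
    omega
  have hcell : cell n A lo w y = n + (lo y + i) := cell_getElem hi
  have hmem : n + (lo y + i) ∈ (earlierIn A
      (if w ∈ (later n A y).take i then F.erase y else F) w).map (cell n A lo w) := by
    rw [if_neg hwt, ← hcell]
    exact List.mem_map_of_mem (mem_earlierIn.2 ⟨hyw, hy, hA⟩)
  refine ⟨h.pv_ne hwn hmem, (h.unlink hwn hmem).congr fun w' hw' => ?_⟩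
  have htake : w' ∈ (later n A y).take (i + 1) ↔ w' ∈ (later n A y).take i ∨ w' = w := by
    rw [List.take_add_one, List.getElem?_eq_getElem hi, hw, List.mem_append]
    simp only [Option.toList, List.mem_singleton]
  by_cases hww : w' = w
  · subst hww
    have hnd := h.nodup w hwn
    rw [if_neg hwt] at hnd
    rw [if_pos (htake.2 (Or.inr rfl)), Function.update_self, if_neg hwt, hnd.erase_eq_filter,
      List.filter_map, earlierIn_erase]
    congr 1
    refine List.filter_congr fun v hv => ?_
    obtain ⟨h1, h2, h3⟩ := mem_earlierIn.1 hv
    rw [← hcell]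
    by_cases hvy : v = y
    · simp [hvy]
    · have : cell n A lo w v ≠ cell n A lo w y := fun hc =>
        hvy (cell_inj hL (hF v h2) (hF y hy) (mem_later.2 ⟨hwn, h1, h3⟩) hwl hc).1
      simp [hvy, this]
  · rw [Function.update_of_ne hww]
    simp only [htake, hww, or_false]

/-- Only later neighbours of the vertex are visited, so time and trail are controlled by the
degeneracy. One logged write clears the flag and two unlink each cell; an iteration takes twelve
steps: the test, two logged writes of five steps, and the increment. -/
theorem unfresh_exec (hL : Layout n L A lo) (hB : 16 + n + L ≤ B) {m : ℕ} {s : HState}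
    {g : ℕ → ℕ → ℕ} (hs : Static n L A lo ord s) (hf : Fresh n A lo F s) (hu : Undoes m s g)
    (hy : s.reg 11 ∈ F) (ht : s.reg 5 + 2 + 2 * (later n A (s.reg 11)).length ≤ B) :
    ∃ t, HExec B β unfresh s t ∧ Fresh n A lo (F.erase (s.reg 11)) t ∧ Undoes m t g ∧
      t.reg 5 = s.reg 5 + 1 + 2 * (later n A (s.reg 11)).length ∧ t.fld 1 = s.fld 1 ∧
      t.time = s.time + 7 + 12 * (later n A (s.reg 11)).length := by
  obtain ⟨y, hye⟩ : ∃ y, y = s.reg 11 := ⟨_, rfl⟩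
  rw [← hye] at hy ht ⊢
  have hyn := hf.lt y hy
  have hbd := hL.bound y hyn
  change Wp B β _ _ s
  rw [unfresh, wp_seq]
  refine wp_logStore (by decide) rfl rfl (by omega) trivial (by simp) (by omega) ?_
  rw [wp_seq, wp_assign]
  refine ⟨⟨by simp; omega, trivial, by simp⟩, ?_⟩
  refine wp_while (fun j t => ∃ i, i + j = (later n A y).length ∧ t.reg 12 = lo y + i ∧
    t.reg 11 = y ∧ t.reg 0 = n ∧ t.reg 5 = s.reg 5 + 1 + 2 * i ∧ t.fld 1 = s.fld 1 ∧
    (∀ k, 9 ≤ k → t.fld k = s.fld k) ∧ t.fld 0 = Function.update (s.fld 0) y 0 ∧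
    Undoes m t g ∧ t.time = s.time + 6 + 12 * i ∧
    Fam (t.fld 2) (t.fld 3) n fun w => (earlierIn A
      (if w ∈ (later n A y).take i then F.erase y else F) w).map (cell n A lo w))
    (later n A y).length ⟨0, ?_⟩ ?_ ?_ ?_
  · refine ⟨by omega, by simp [← hye, hs.first y hyn], by simp [hye], by simp [hs.num], by simp,
      by simp, fun k hk => ?_, by simp [← hye], ?_, by simp, ?_⟩
    · simp [show k ≠ 0 by omega, show k ≠ 4 by omega, show k ≠ 5 by omega, show k ≠ 6 by omega]
    · exact (hu.log (by decide) (s.reg 11) 0).congr (by simp) (fun _ _ => rfl)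
    · simpa using hf.fam
  · intros; simp; omega
  · rintro j t ⟨i, hij, h12, h11, h0, h5, h1, h9, hfr, hun, htm, hfam⟩ hlt
    simp only [Expr.eval, h12, h11, h9 10 (by decide), hs.last y hyn] at hlt
    have hi : i < (later n A y).length := by omega
    obtain ⟨hne, hfam'⟩ := fam_unlink_take hL hy hf.lt hi hfam
    rw [wp_seq]
    refine wp_logStore (by decide) rfl rfl (by omega) (by simp [h0, h12]; omega)
      (by simp [h0, h12]; omega) (by simp [h5]; omega) ?_
    rw [wp_seq]
    refine wp_logStore (by decide) rfl rfl (by omega) (by simp [h0, h12]; omega)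
      (by simp [h0, h12]; omega) (by simp [h5]; omega) ?_
    rw [wp_assign]
    refine ⟨by simp [h12]; omega, j - 1, by omega, i + 1, by omega, by simp [h12]; omega,
      by simp [h11], by simp [h0], by simp [h5]; omega, by simp [h1], fun k hk => ?_, by simp [hfr],
      ?_, by simp [htm]; omega, ?_⟩
    · simp [show k ≠ 2 by omega, show k ≠ 3 by omega, show k ≠ 4 by omega, show k ≠ 5 by omega,
        show k ≠ 6 by omega, h9 k hk]
    · refine (Undoes.log (Undoes.log (hun.congr rfl fun _ _ => rfl) (by decide) _ _)
        (by decide) _ _).congr (by simp) (fun _ _ => rfl)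
    · simp only [Expr.eval, HState.setReg_fld, HState.log_fld, HState.log_reg, HState.tick_reg,
        HState.tick_fld, h0, h12]
      simp only [Nat.reduceEqDiff, if_true, if_false]
      rw [Function.update_of_ne hne.symm]
      exact hfam'
  · rintro j t ⟨i, hij, h12, h11, h0, h5, h1, h9, hfr, hun, htm, hfam⟩ hlt
    simp only [Expr.eval, h12, h11, h9 10 (by decide), hs.last y hyn] at hlt
    have hi : i = (later n A y).length := by omega
    subst hi
    refine ⟨⟨fun v hv => hf.lt v (Finset.mem_of_mem_erase hv), fun v hv => ?_, ?_, fun v hv j hj => ?_⟩,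
      hun.congr rfl fun _ _ => rfl, h5, h1, by simp [htm]; omega⟩
    · simp only [HState.tick_fld, hfr, Function.update_apply, hf.flag v hv, Finset.mem_erase]
      by_cases hvy : v = y <;> simp [hvy]
    · refine hfam.congr fun w hw => ?_
      rw [List.take_length]
      split
      · rfl
      · rename_i hwl
        rw [earlierIn_erase_of_notMem]
        intro hc
        obtain ⟨h2, -, h3⟩ := mem_earlierIn.1 hc
        exact hwl (mem_later.2 ⟨hw, h2, h3⟩)
    · simp only [HState.tick_fld, h9 12 (by decide)]
      exact hf.src v (Finset.mem_of_mem_erase hv) j hj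

end InducedSubtrees

namespace InducedSubtrees

/-! ### Merging the candidates with the later neighbours -/

theorem Seg.drop_last {nx : ℕ → ℕ} {a b : ℕ} {l l' : List ℕ} (h : Seg nx a (l ++ l') b) :
    Seg nx ((a :: l).getLast (List.cons_ne_nil _ _)) l' b := by
  induction l generalizing a with
  | nil => exact h
  | cons x l ih => rw [List.getLast_cons (List.cons_ne_nil _ _)]; exact ih h.2

/-- In a merge only the pointer of the last cell of the finished part is redirected; everything
before it stays, and the new tail is attached there. -/
theorem Seg.relink {nx nx' : ℕ → ℕ} {a b : ℕ} {l l' l'' : List ℕ} (h : Seg nx a (l ++ l') b)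
    (h' : Seg nx' ((a :: l).getLast (List.cons_ne_nil _ _)) l'' b)
    (hag : ∀ i ∈ a :: l, i ≠ (a :: l).getLast (List.cons_ne_nil _ _) → nx' i = nx i)
    (hnd : (a :: l).Nodup) : Seg nx' a (l ++ l'') b := by
  induction l generalizing a with
  | nil => exact h'
  | cons x l ih =>
    rw [List.getLast_cons (List.cons_ne_nil _ _)] at h' hag
    have hne : a ≠ (x :: l).getLast (List.cons_ne_nil _ _) := by
      intro hc
      exact (List.nodup_cons.1 hnd).1 (hc ▸ List.getLast_mem _)
    exact ⟨(hag a (by simp) hne).trans h.1,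
      ih h.2 h' (fun i hi => hag i (List.mem_cons_of_mem _ hi)) (List.nodup_cons.1 hnd).2⟩

theorem Seg.change_start {nx nx' : ℕ → ℕ} {a a' b : ℕ} {l : List ℕ} (h : Seg nx a l b)
    (h' : nx' a' = l.headD b) (hag : ∀ i ∈ l, nx' i = nx i) : Seg nx' a' l b := by
  cases l with
  | nil => exact h'
  | cons x l => exact ⟨h', Seg.congr h.2 hag⟩

/-- Insert the fresh vertex in register `11` after the cell in register `8`. -/
def insertStep : HProg :=
  logStore 1 (rg 11) (rg 9) ;; logStore 1 (rg 8) (rg 11) ;; .assign 8 (rg 11) ;; unfresh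

/-- One step of the merge: register `8` is the last cell of the merged part, register `9` the
first remaining candidate and register `10` the index of the next later neighbour. -/
def mergeStep : HProg :=
  .assign 11 (arr 11 (rg 10)) ;;
  .ite (rg 9) (rg 11)
    (.assign 8 (rg 9) ;; .assign 9 (arr 1 (rg 9)))
    (.assign 10 (.add (rg 10) (.const 1)) ;;
     .ite (rg 11) (rg 9)
       (.ite (.const 0) (arr 0 (rg 11)) insertStep .skip)
       (.assign 9 (arr 1 (rg 9)) ;; logStore 1 (rg 8) (rg 9)))

/-- An upper bound for the number of trail entries that vertices in `F` can still cause before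
they leave the candidate set. -/
def pot (n : ℕ) (A : ℕ → ℕ → Bool) (F : Finset ℕ) : ℕ :=
  ∑ v ∈ F, (4 + 2 * (later n A v).length)

theorem pot_erase {n : ℕ} {A : ℕ → ℕ → Bool} {F : Finset ℕ} {y : ℕ} (hy : y ∈ F) :
    pot n A (F.erase y) + (4 + 2 * (later n A y).length) = pot n A F :=
  Finset.sum_erase_add _ _ hy

/-- The invariant of the merge. `pre` are the later neighbours of `u` treated so far, `a` the others,
`d` is the merged part of the candidate list, `l` the remaining part. -/
structure Merging (n L : ℕ) (A : ℕ → ℕ → Bool) (lo ord : ℕ → ℕ) (K u : ℕ) (C₀ : List ℕ)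
    (F₀ : Finset ℕ) (m : ℕ) (g : ℕ → ℕ → ℕ) (P T : ℕ) (pre a d l : List ℕ) (F : Finset ℕ)
    (t : HState) : Prop where
  split : later n A u = pre ++ a
  idx : t.reg 10 = lo u + pre.length
  root : t.reg 3 = u
  last : t.reg 8 = (u :: d).getLast (List.cons_ne_nil _ _)
  head : t.reg 9 = l.headD n
  seg : Seg (t.fld 1) u (d ++ l) n
  sorted : (d ++ l).Pairwise (· < ·)
  gt : ∀ x ∈ d ++ l, u < x ∧ x < n
  lt : ∀ x ∈ d, ∀ y ∈ a, x < y
  mem : ∀ x, x ∈ d ++ l ↔ (x ∈ C₀ ∧ x ∉ pre) ∨ (x ∈ F₀ ∧ x ∈ pre)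
  set : ∀ x, x ∈ F ↔ x ∈ F₀ ∧ x ∉ pre
  fresh : Fresh n A lo F t
  stat : Static n L A lo ord t
  und : Undoes m t g
  trail : t.reg 5 + pot n A F + (d ++ l).length ≤ P
  time : t.time + 11 * (l.length + a.length) + (13 + 12 * K) * F.card ≤ T

section Merge

variable {n L B β : ℕ} {A : ℕ → ℕ → Bool} {lo ord : ℕ → ℕ} {K u m P T : ℕ} {C₀ : List ℕ}
  {F₀ : Finset ℕ} {g : ℕ → ℕ → ℕ}

/-- Let `x` be the first remaining candidate and `y` the next later neighbour of `u`. If `x < y`,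
then `x` is not adjacent to `u` and stays. If `y < x`, then `y` is no candidate and is inserted
exactly if it is fresh. If `x = y`, the candidate is adjacent to `u` and is dropped. The end marker
`n` exceeds every rank, so an exhausted candidate list falls under `y < x`. -/
theorem mergeStep_exec (hL : Layout n L A lo) (hB : 16 + n + L ≤ B) (hP : P ≤ B) (hu : u < n)
    (hK : ∀ v < n, (later n A v).length ≤ K) (hCF : ∀ x ∈ C₀, x ∉ F₀) {pre a d l : List ℕ}
    {F : Finset ℕ} {y : ℕ} {t : HState}
    (h : Merging n L A lo ord K u C₀ F₀ m g P T pre (y :: a) d l F t) :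
    Wp B β mergeStep (fun t' => ∃ pre' a' d' l' F',
      Merging n L A lo ord K u C₀ F₀ m g P T pre' a' d' l' F' t' ∧
      l'.length + a'.length < l.length + (a.length + 1)) t.tick := by
  have hylater : y ∈ later n A u := by rw [h.split]; simp
  obtain ⟨hyn, huy, hAuy⟩ := mem_later.1 hylater
  have hbd := hL.bound u hu
  have hlen : pre.length + (a.length + 1) = (later n A u).length := by rw [h.split]; simp
  have htgt : t.fld 11 (lo u + pre.length) = y := by
    rw [h.stat.tgt u hu pre.length (by omega)]
    simp only [h.split, List.getElem_append_right le_rfl, Nat.sub_self, List.getElem_cons_zero]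
  have hsrt := later_sorted (n := n) (A := A) u
  have hnd := later_nodup (n := n) (A := A) u
  rw [h.split] at hsrt hnd
  have hypre : y ∉ pre := fun hc => (List.nodup_append.1 hnd).2.2 y hc y (by simp) rfl
  have hya : ∀ z ∈ a, y < z := (List.pairwise_cons.1 (List.pairwise_append.1 hsrt).2.1).1
  have hysep : ∀ z ∈ d, z < y := fun z hz => h.lt z hz y (by simp)
  have hund : (u :: (d ++ l)).Nodup := by
    refine List.nodup_cons.2 ⟨fun hc => ?_, h.sorted.imp fun hab => hab.ne⟩
    exact absurd (h.gt u hc).1 (lt_irrefl u)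
  have hund' : (u :: d).Nodup := by
    rw [← List.cons_append] at hund; exact (List.nodup_append.1 hund).1
  have htime := h.time
  have htrail := h.trail
  simp only [List.length_cons, List.length_append] at htime htrail
  rw [mergeStep, wp_seq, wp_assign]
  refine ⟨⟨by simp; omega, trivial, by simp⟩, ?_⟩
  simp only [Expr.eval, HState.tick_fld, HState.tick_reg, h.idx, htgt]
  refine wp_ite trivial trivial (fun hlt => ?_) (fun hlt => ?_)
  · simp only [Expr.eval, HState.setReg_reg, HState.tick_reg, h.head, Nat.reduceEqDiff, if_true,
      if_false] at hlt
    cases l with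
    | nil => simp only [List.headD_nil] at hlt; omega
    | cons x l =>
      simp only [List.headD_cons] at hlt
      have hseg := (seg_append.1 h.seg).2
      rw [wp_seq, wp_assign, wp_assign]
      refine ⟨trivial, ⟨by simp; omega, trivial, by simp⟩, pre, y :: a, d ++ [x], l, F,
        ⟨h.split, by simp [h.idx], by simp [h.root], by simp [h.head], ?_, ?_, ?_, ?_, ?_, ?_, h.set,
        h.fresh.congr rfl rfl rfl rfl, h.stat.congr rfl rfl rfl rfl rfl rfl,
        h.und.congr rfl fun _ _ => rfl, ?_, ?_⟩, by simp⟩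
      · simp [h.head, hseg.head]
      · simpa using h.seg
      · simpa using h.sorted
      · simpa using h.gt
      · intro z hz w hw
        rcases List.mem_append.1 hz with hz | hz
        · exact h.lt z hz w hw
        · obtain rfl := List.mem_singleton.1 hz
          rcases List.mem_cons.1 hw with rfl | hw
          · exact hlt
          · exact hlt.trans (hya w hw)
      · intro z; rw [← h.mem z]; simp
      · simp; simp at htrail; omega
      · simp; simp at htime; omega
  · simp only [Expr.eval, HState.setReg_reg, HState.tick_reg, h.head, Nat.reduceEqDiff, if_true,
      if_false] at hlt
    rw [wp_seq, wp_assign]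
    refine ⟨by simp [h.idx]; omega, ?_⟩
    refine wp_ite trivial trivial (fun hlt2 => ?_) (fun hlt2 => ?_)
    · simp only [Expr.eval, HState.setReg_reg, HState.tick_reg, h.head, Nat.reduceEqDiff, if_true,
        if_false] at hlt2
      have hyl : ∀ z ∈ l, y < z := by
        intro z hz
        cases l with
        | nil => simp at hz
        | cons x l =>
          rcases List.mem_cons.1 hz with rfl | hz
          · exact hlt2
          · have := (List.pairwise_cons.1 (List.pairwise_append.1 h.sorted).2.1).1 z hz
            exact lt_trans hlt2 this
      have hydl : y ∉ d ++ l := by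
        rw [List.mem_append, not_or]
        exact ⟨fun hc => lt_irrefl y (hysep y hc), fun hc => lt_irrefl y (hyl y hc)⟩
      have hyC : y ∉ C₀ := fun hc => hydl ((h.mem y).2 (Or.inl ⟨hc, hypre⟩))
      refine wp_ite (by simp) (by simp) (fun hf => ?_) (fun hf => ?_)
      · simp only [Expr.eval, HState.setReg_reg, HState.tick_reg, HState.setReg_fld, HState.tick_fld,
          Nat.reduceEqDiff, if_true, if_false, h.fresh.flag y hyn] at hf
        have hyF : y ∈ F := by by_contra hc; simp [hc] at hf
        have hpot := pot_erase (n := n) (A := A) hyF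
        have hcard := Finset.card_erase_add_one hyF
        have hKy := hK y hyn
        rw [insertStep, wp_seq]
        refine wp_logStore (by decide) rfl rfl (by omega) trivial trivial (by simp; omega) ?_
        rw [wp_seq]
        refine wp_logStore (by decide) rfl rfl (by omega) trivial trivial (by simp; omega) ?_
        rw [wp_seq, wp_assign]
        refine ⟨trivial, ?_⟩
        simp only [Expr.eval, HState.log_reg, HState.setReg_reg, HState.tick_reg, Nat.reduceEqDiff,
          if_true, if_false, h.head, h.last, h.idx]
        generalize ht4 : HState.setReg _ 8 y = t4
        have f11 : t4.reg 11 = y := by simp [← ht4]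
        have f5 : t4.reg 5 = t.reg 5 + 2 := by simp [← ht4]
        have f10 : t4.reg 10 = lo u + pre.length + 1 := by simp [← ht4]
        have f3 : t4.reg 3 = u := by simp [← ht4, h.root]
        have f8 : t4.reg 8 = y := by simp [← ht4]
        have f9 : t4.reg 9 = l.headD n := by simp [← ht4, h.head]
        have ftime : t4.time = t.time + 17 := by simp [← ht4]
        have fnx : t4.fld 1 = Function.update (Function.update (t.fld 1) y (l.headD n))
            ((u :: d).getLast (List.cons_ne_nil _ _)) y := by simp [← ht4]
        have hfr4 : Fresh n A lo F t4 := by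
          refine h.fresh.congr ?_ ?_ ?_ ?_ <;> simp [← ht4]
        have hst4 : Static n L A lo ord t4 := by
          refine h.stat.congr ?_ ?_ ?_ ?_ ?_ ?_ <;> simp [← ht4]
        have hun4 : Undoes m t4 g := by
          rw [← ht4]
          exact (Undoes.log (Undoes.log (h.und.congr rfl fun _ _ => rfl) (by decide) _ _)
            (by decide) _ _).congr (by simp) fun _ _ => rfl
        obtain ⟨t5, x5, hfr5, hun5, g5, g1, gt⟩ := unfresh_exec (β := β) hL hB hst4 hfr4 hun4
          (by rw [f11]; exact hyF) (by rw [f5, f11]; omega)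
        rw [f11] at hfr5 g5 gt
        refine ⟨t5, x5, pre ++ [y], a, d ++ [y], l, F.erase y, ⟨by simp [h.split], ?_, ?_, ?_, ?_, ?_,
          ?_, ?_, ?_, ?_, ?_, hfr5, hst4.exec x5 rfl, hun5, ?_, ?_⟩, by omega⟩
        · rw [x5.reg_eq rfl, f10]; simp; omega
        · rw [x5.reg_eq rfl, f3]
        · rw [x5.reg_eq rfl, f8]; simp
        · rw [x5.reg_eq rfl, f9]
        · rw [g1, fnx, List.append_assoc]
          have hyu : y ≠ (u :: d).getLast (List.cons_ne_nil _ _) := by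
            intro hc
            rcases List.mem_cons.1 (hc ▸ List.getLast_mem (List.cons_ne_nil u d)) with h1 | h1
            · omega
            · exact lt_irrefl y (hysep y h1)
          refine h.seg.relink ⟨Function.update_self .., ?_⟩ (fun i hi hne => ?_) hund'
          · refine h.seg.drop_last.change_start ?_ (fun i hi => ?_)
            · rw [Function.update_of_ne hyu, Function.update_self]
            · rw [Function.update_of_ne, Function.update_of_ne]
              · exact (hyl i hi).ne'
              · rintro rfl
                rw [← List.cons_append] at hund
                exact (List.nodup_append.1 hund).2.2 _ (List.getLast_mem (List.cons_ne_nil u d)) _ hi rfl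
          · rw [Function.update_of_ne hne, Function.update_of_ne]
            rintro rfl
            rcases List.mem_cons.1 hi with h1 | h1
            · omega
            · exact lt_irrefl _ (hysep _ h1)
        · obtain ⟨p1, p2, p3⟩ := List.pairwise_append.1 h.sorted
          rw [List.append_assoc]
          refine List.pairwise_append.2 ⟨p1, List.pairwise_cons.2 ⟨hyl, p2⟩, fun z hz w hw => ?_⟩
          rcases List.mem_cons.1 hw with rfl | hw
          · exact hysep z hz
          · exact p3 z hz w hw
        · intro x hx
          rw [List.append_assoc, List.mem_append] at hx
          rcases hx with hx | hx
          · exact h.gt x (List.mem_append_left _ hx)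
          · rcases List.mem_cons.1 hx with rfl | hx
            · exact ⟨huy, hyn⟩
            · exact h.gt x (List.mem_append_right _ hx)
        · intro z hz w hw
          rcases List.mem_append.1 hz with hz | hz
          · exact h.lt z hz w (List.mem_cons_of_mem _ hw)
          · obtain rfl := List.mem_singleton.1 hz
            exact hya w hw
        · intro x
          have := h.mem x
          have hyF0 := ((h.set y).1 hyF).1
          simp only [List.mem_append, List.mem_singleton] at this ⊢
          by_cases hxy : x = y
          · subst hxy; simp [hyF0]
          · simp only [hxy, or_false]; exact this
        · intro x
          have := h.set x
          simp only [Finset.mem_erase, List.mem_append, List.mem_singleton, this]; tauto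
        -- Two entries for the pointers, one for the flag, two for each later neighbour, and one
        -- more candidate in the list: together exactly the summand `4 + 2 * (later n A y).length`
        -- by which `pot` drops.
        · rw [g5, f5]; simp only [List.length_append, List.length_singleton]; omega
        · rw [gt, ftime]
          have : 12 * (later n A y).length ≤ 12 * K := by omega
          -- This case takes `24 + 12 * (later n A y).length` steps; `11` of them are paid by the
          -- treated neighbour and the others by the share `13 + 12 * K` of the vertex leaving `F`.
          have e : (13 + 12 * K) * F.card = (13 + 12 * K) * (F.erase y).card + (13 + 12 * K) := by
            rw [← hcard]; ring
          omega
      · simp only [Expr.eval, HState.setReg_reg, HState.tick_reg, HState.setReg_fld, HState.tick_fld,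
          Nat.reduceEqDiff, if_true, if_false, h.fresh.flag y hyn] at hf
        have hyF : y ∉ F := by intro hc; simp [hc] at hf
        have hyF0 : y ∉ F₀ := fun hc => hyF ((h.set y).2 ⟨hc, hypre⟩)
        rw [wp_skip]
        refine ⟨pre ++ [y], a, d, l, F, ⟨by simp [h.split], by simp [h.idx]; omega, by simp [h.root],
          by simp [h.last], by simp [h.head], h.seg, h.sorted, h.gt,
          fun z hz w hw => h.lt z hz w (List.mem_cons_of_mem _ hw), fun x => ?_, fun x => ?_,
          h.fresh.congr rfl rfl rfl rfl, h.stat.congr rfl rfl rfl rfl rfl rfl,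
          h.und.congr rfl fun _ _ => rfl, ?_, ?_⟩, by omega⟩
        · have := h.mem x
          simp only [List.mem_append, List.mem_singleton] at this ⊢
          by_cases hxy : x = y
          · subst hxy; simp [this, hyC, hyF0]
          · simp only [hxy, or_false]; exact this
        · have := h.set x
          by_cases hxy : x = y
          · subst hxy; simp [hyF]
          · simp [this, hxy]
        · simp; omega
        · simp; omega
    · simp only [Expr.eval, HState.setReg_reg, HState.tick_reg, h.head, Nat.reduceEqDiff, if_true,
        if_false] at hlt2
      cases l with
      | nil => simp only [List.headD_nil] at hlt2; omega
      | cons x l =>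
        simp only [List.headD_cons] at hlt hlt2
        obtain rfl : x = y := by omega
        have hseg := (seg_append.1 h.seg).2
        have hxC : x ∈ C₀ := by
          rcases (h.mem x).1 (by simp) with h1 | h1
          · exact h1.1
          · exact absurd h1.2 hypre
        have hxF : x ∉ F₀ := hCF x hxC
        have hxF' : x ∉ F := fun hc => hxF ((h.set x).1 hc).1
        simp only [List.length_cons] at htrail htime
        rw [wp_seq, wp_assign]
        refine ⟨⟨by simp; omega, trivial, by simp⟩, ?_⟩
        refine wp_logStore (by decide) rfl rfl (by omega) trivial trivial (by simp; omega) ?_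
        have hdl : x ∉ d ++ l := by
          rw [List.nodup_cons] at hund
          have := hund.2
          rw [List.nodup_append] at this
          rw [List.mem_append, not_or]
          exact ⟨fun hc => this.2.2 x hc x (by simp) rfl, fun hc => (List.nodup_cons.1 this.2.1).1 hc⟩
        refine ⟨pre ++ [x], a, d, l, F, ⟨by simp [h.split], by simp [h.idx]; omega, by simp [h.root],
          by simp [h.last], by simp [h.head, hseg.head], ?_, ?_, fun z hz => h.gt z ?_,
          fun z hz w hw => h.lt z hz w (List.mem_cons_of_mem _ hw), fun z => ?_, fun z => ?_,
          h.fresh.congr ?_ ?_ ?_ ?_, h.stat.congr ?_ ?_ ?_ ?_ ?_ ?_,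
          ?_, ?_, ?_⟩, by simp only [List.length_cons]; omega⟩
        · simp only [Expr.eval, HState.log_fld, HState.setReg_fld, HState.setReg_reg, HState.tick_fld,
            HState.tick_reg, Nat.reduceEqDiff, if_true, if_false, h.head, h.last, h.idx,
            List.headD_cons]
          refine h.seg.relink (Seg.change_start hseg ?_ fun i hi => ?_) (fun i hi hne => ?_) hund'
          · rw [Function.update_self, hseg.head]
          · rw [Function.update_of_ne]
            rintro rfl
            rw [← List.cons_append] at hund
            exact (List.nodup_append.1 hund).2.2 _ (List.getLast_mem (List.cons_ne_nil u d)) _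
              (List.mem_cons_of_mem _ hi) rfl
          · rw [Function.update_of_ne hne]
        · exact h.sorted.sublist (by simp)
        · simp only [List.mem_append, List.mem_cons] at hz ⊢; tauto
        · have := h.mem z
          simp only [List.mem_append, List.mem_cons, List.not_mem_nil, or_false] at this hdl ⊢
          by_cases hzx : z = x
          · subst hzx; simp [hdl, hxF]
          · simp only [hzx, or_false, false_or] at this ⊢; exact this
        · have := h.set z
          by_cases hzx : z = x
          · subst hzx; simp [hxF']
          · simp [this, hzx]
        all_goals first | (simp; done) | skip
        · refine Undoes.log ?_ (by decide) _ _
          exact h.und.congr (by simp) fun _ _ => rfl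
        · simp only [HState.log_reg, HState.setReg_reg, HState.tick_reg, if_true, Nat.reduceEqDiff,
            if_false, List.length_append]; omega
        · simp only [HState.log_time, HState.setReg_time, HState.tick_time]; omega

end Merge

end InducedSubtrees

/-! ### Including a vertex: the fresh earlier neighbours and the cost in terms of the new candidates
-/

namespace InducedSubtrees

/-- The pointers `nx` link the list `l`, which starts with the cell `h` and ends before `b`. -/
def Linked (nx : ℕ → ℕ) : ℕ → List ℕ → ℕ → Prop
  | h, [], b => h = b
  | h, x :: l, b => h = x ∧ Seg nx x l b

theorem Seg.linked {nx : ℕ → ℕ} {a b : ℕ} {l : List ℕ} (h : Seg nx a l b) :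
    Linked nx (nx a) l b := by
  cases l with
  | nil => exact h
  | cons x l => exact h

theorem Linked.seg_update {nx : ℕ → ℕ} {h y b : ℕ} {l : List ℕ} (hl : Linked nx h l b)
    (hy : y ∉ l) : Seg (Function.update nx y h) y l b := by
  cases l with
  | nil => exact (Function.update_self ..).trans hl
  | cons x l => exact ⟨(Function.update_self ..).trans hl.1, hl.2.update hy⟩

/-- Move the last fresh vertex before `u` that is adjacent to `u` to the front of the candidate
list. -/
def prependStep : HProg :=
  .assign 11 (arr 12 (.sub (arr 3 (rg 3)) (rg 0))) ;;
  logStore 1 (rg 11) (rg 4) ;; .assign 4 (rg 11) ;; unfresh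

/-- Replace the candidate list starting after `u` by the candidate list for the set with `u`
included. Register `3` holds `u`; the first candidate is returned in register `4`. -/
def includeStep : HProg :=
  .assign 8 (rg 3) ;; .assign 9 (arr 1 (rg 3)) ;; .assign 10 (arr 9 (rg 3)) ;;
  .while (rg 10) (arr 10 (rg 3)) mergeStep ;;
  .assign 4 (arr 1 (rg 3)) ;;
  .while (rg 0) (.add (arr 3 (rg 3)) (.const 1)) prependStep

/-- The invariant of the second part of `includeStep`. -/
structure Prepending (n L : ℕ) (A : ℕ → ℕ → Bool) (lo ord : ℕ → ℕ) (K u : ℕ) (C₁ : List ℕ)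
    (F₁ : Finset ℕ) (m : ℕ) (g : ℕ → ℕ → ℕ) (P T : ℕ) (C : List ℕ) (F : Finset ℕ)
    (t : HState) : Prop where
  root : t.reg 3 = u
  linked : Linked (t.fld 1) (t.reg 4) C n
  sorted : C.Pairwise (· < ·)
  lt : ∀ x ∈ C, x < n
  below : ∀ x ∈ earlierIn A F u, ∀ y ∈ C, x < y
  mem : ∀ x, x ∈ C ↔ x ∈ C₁ ∨ (x ∈ F₁ ∧ x ∉ F)
  sub : ∀ x ∈ F, x ∈ F₁
  gone : ∀ x ∈ F₁, x ∉ F → x < u ∧ A x u = true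
  fresh : Fresh n A lo F t
  stat : Static n L A lo ord t
  und : Undoes m t g
  trail : t.reg 5 + pot n A F + C.length ≤ P
  time : t.time + (15 + 12 * K) * F.card ≤ T

section Prepend

variable {n L B β : ℕ} {A : ℕ → ℕ → Bool} {lo ord : ℕ → ℕ} {K u m P T : ℕ} {C₁ : List ℕ}
  {F₁ : Finset ℕ} {g : ℕ → ℕ → ℕ}

/-- The last cell in the list of `u` belongs to its largest fresh earlier neighbour. These
neighbours are taken in decreasing order and lie below all candidates, so prepending keeps the list
sorted. Earlier neighbours that are not fresh are never looked at; this matters because their number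
is not bounded by the degeneracy. -/
theorem prependStep_exec (hL : Layout n L A lo) (hB : 16 + n + L ≤ B) (hP : P ≤ B) (hu : u < n)
    (hK : ∀ v < n, (later n A v).length ≤ K) {C : List ℕ} {F : Finset ℕ} {t : HState}
    (h : Prepending n L A lo ord K u C₁ F₁ m g P T C F t) (hne : earlierIn A F u ≠ []) :
    Wp B β prependStep (fun t' => ∃ C' F', Prepending n L A lo ord K u C₁ F₁ m g P T C' F' t' ∧
      F'.card < F.card) t.tick := by
  obtain ⟨r, y, hr⟩ : ∃ r y, earlierIn A F u = r ++ [y] := by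
    rcases List.eq_nil_or_concat (earlierIn A F u) with h | ⟨r, y, h⟩
    · exact absurd h hne
    · exact ⟨r, y, by simpa using h⟩
  obtain ⟨hyu, hyF, hA⟩ := mem_earlierIn.1 (show y ∈ earlierIn A F u by simp [hr])
  have hyn := h.fresh.lt y hyF
  have hyl : u ∈ later n A y := mem_later.2 ⟨hu, hyu, hA⟩
  have hidx := List.idxOf_lt_length_of_mem hyl
  have hpv : t.fld 3 u = n + (lo y + (later n A y).idxOf u) :=
    h.fresh.fam.pv_eq hu (l := r.map (cell n A lo u)) (by simp [hr, cell])
  have hsrc := h.fresh.src y hyF _ hidx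
  have hyC : y ∉ C := fun hc => lt_irrefl y (h.below y (by simp [hr]) y hc)
  have hpot := pot_erase (n := n) (A := A) hyF
  have hcard := Finset.card_erase_add_one hyF
  have hKy := hK y hyn
  have htime := h.time
  have htrail := h.trail
  rw [prependStep, wp_seq, wp_assign]
  refine ⟨by simp; omega, ?_⟩
  simp only [Expr.eval, HState.tick_fld, HState.tick_reg, h.root, h.stat.num, hpv,
    Nat.add_sub_cancel_left, hsrc]
  rw [wp_seq]
  refine wp_logStore (by decide) rfl rfl (by omega) trivial trivial (by simp; omega) ?_
  rw [wp_seq, wp_assign]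
  refine ⟨trivial, ?_⟩
  simp only [Expr.eval, HState.log_reg, HState.setReg_reg, HState.tick_reg, Nat.reduceEqDiff,
    if_true, if_false]
  generalize ht4 : HState.setReg _ 4 y = t4
  have f11 : t4.reg 11 = y := by simp [← ht4]
  have f5 : t4.reg 5 = t.reg 5 + 1 := by simp [← ht4]
  have f3 : t4.reg 3 = u := by simp [← ht4, h.root]
  have f4 : t4.reg 4 = y := by simp [← ht4]
  have ftime : t4.time = t.time + 8 := by simp [← ht4]
  have fnx : t4.fld 1 = Function.update (t.fld 1) y (t.reg 4) := by simp [← ht4]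
  have hfr4 : Fresh n A lo F t4 := by
    refine h.fresh.congr ?_ ?_ ?_ ?_ <;> simp [← ht4]
  have hst4 : Static n L A lo ord t4 := by
    refine h.stat.congr ?_ ?_ ?_ ?_ ?_ ?_ <;> simp [← ht4]
  have hun4 : Undoes m t4 g := by
    rw [← ht4]
    exact (Undoes.log (h.und.congr rfl fun _ _ => rfl) (by decide) _ _).congr (by simp) fun _ _ => rfl
  obtain ⟨t5, x5, hfr5, hun5, g5, g1, gt⟩ := unfresh_exec (β := β) hL hB hst4 hfr4 hun4
    (by rw [f11]; exact hyF) (by rw [f5, f11]; omega)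
  rw [f11] at hfr5 g5 gt
  refine ⟨t5, x5, y :: C, F.erase y, ⟨?_, ?_, ?_, ?_, ?_, ?_, ?_, ?_, hfr5, hst4.exec x5 rfl, hun5,
    ?_, ?_⟩, by omega⟩
  · rw [x5.reg_eq rfl, f3]
  · rw [x5.reg_eq rfl, f4, g1, fnx]
    exact ⟨rfl, h.linked.seg_update hyC⟩
  · exact List.pairwise_cons.2 ⟨fun z hz => h.below y (by simp [hr]) z hz, h.sorted⟩
  · intro x hx
    rcases List.mem_cons.1 hx with rfl | hx
    · exact hyn
    · exact h.lt x hx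
  · intro x hx z hz
    rw [earlierIn_erase, List.mem_filter] at hx
    rcases List.mem_cons.1 hz with rfl | hz
    · have hs := earlierIn_sorted (A := A) (F := F) u
      rw [hr] at hs
      have hx1 := hx.1
      rw [hr, List.mem_append, List.mem_singleton] at hx1
      have hx2 : x ≠ z := by simpa using hx.2
      exact (List.pairwise_append.1 hs).2.2 x (hx1.resolve_right hx2) z (by simp)
    · exact h.below x hx.1 z hz
  · intro x
    have := h.mem x
    have hyF1 := h.sub y hyF
    simp only [List.mem_cons, Finset.mem_erase, this]
    by_cases hxy : x = y
    · subst hxy; simp [hyF1]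
    · simp [hxy]
  · exact fun x hx => h.sub x (Finset.mem_of_mem_erase hx)
  · intro x hx hx'
    by_cases hxy : x = y
    · subst hxy; exact ⟨hyu, hA⟩
    · exact h.gone x hx fun hc => hx' (Finset.mem_erase.2 ⟨hxy, hc⟩)
  · rw [g5, f5]; simp only [List.length_cons]; omega
  · rw [gt, ftime]
    have e : (15 + 12 * K) * F.card = (15 + 12 * K) * (F.erase y).card + (15 + 12 * K) := by
      rw [← hcard]; ring
    omega

/-- Adjacency of ranks. -/
def RankAdj (n : ℕ) (A : ℕ → ℕ → Bool) (u x : ℕ) : Prop :=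
  x ∈ later n A u ∨ (x < u ∧ A x u = true)

/-- The bounds are expressed through the new list `C`, because the number of reported sets will pay
for `|C|`. A lost candidate is one of the at most `K` later neighbours of `u`, so `|C₀| ≤ |C| + K`;
a vertex that leaves `F` enters `C`, and its unlinking costs `O(K)` steps and trail entries. -/
theorem includeStep_exec (hL : Layout n L A lo) (hB : 16 + n + L ≤ B) (hK1 : 1 ≤ K)
    (hK : ∀ v < n, (later n A v).length ≤ K) {C₀ : List ℕ} {F : Finset ℕ} {s : HState}
    (hs : Static n L A lo ord s) (hf : Fresh n A lo F s) (hu : s.reg 3 = u) (hun : u < n)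
    (hseg : Seg (s.fld 1) u C₀ n) (hsort : (u :: C₀).Pairwise (· < ·)) (hlt : ∀ x ∈ C₀, x < n)
    (hCF : ∀ x ∈ C₀, x ∉ F) (hP : s.reg 5 + pot n A F + C₀.length ≤ P) (hPB : P ≤ B) :
    ∃ t C F', HExec B β includeStep s t ∧ Linked (t.fld 1) (t.reg 4) C n ∧ C.Pairwise (· < ·) ∧
      (∀ x ∈ C, x < n) ∧
      (∀ x, x ∈ C ↔ (x ∈ C₀ ∧ x ∉ later n A u) ∨ (x ∈ F ∧ RankAdj n A u x)) ∧
      (∀ x, x ∈ F' ↔ x ∈ F ∧ ¬ RankAdj n A u x) ∧ Fresh n A lo F' t ∧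
      Undoes (s.reg 5) t s.fld ∧ t.reg 5 + pot n A F' + C.length ≤ P ∧
      t.reg 5 ≤ s.reg 5 + 6 * K * C.length + K ∧
      t.time ≤ s.time + 28 * K + 38 * K * C.length := by
  obtain ⟨hs1, hs2⟩ := List.pairwise_cons.1 hsort
  have hbd := hL.bound u hun
  -- the merge
  have hmerge : Wp B β (.while (rg 10) (arr 10 (rg 3)) mergeStep)
      (fun t => ∃ C₁ F₁, t.reg 3 = u ∧ Seg (t.fld 1) u C₁ n ∧ C₁.Pairwise (· < ·) ∧
        (∀ x ∈ C₁, u < x ∧ x < n) ∧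
        (∀ x, x ∈ C₁ ↔ (x ∈ C₀ ∧ x ∉ later n A u) ∨ (x ∈ F ∧ x ∈ later n A u)) ∧
        (∀ x, x ∈ F₁ ↔ x ∈ F ∧ x ∉ later n A u) ∧ Fresh n A lo F₁ t ∧ Static n L A lo ord t ∧
        Undoes (s.reg 5) t s.fld ∧
        t.reg 5 + pot n A F₁ + C₁.length ≤ s.reg 5 + pot n A F + C₀.length ∧
        t.time + (15 + 12 * K) * F₁.card ≤
          s.time + 4 + 11 * (C₀.length + K) + (15 + 12 * K) * F.card)
      (((s.setReg 8 u).setReg 9 (s.fld 1 u)).setReg 10 (lo u)) := by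
    have hKu := hK u hun
    refine wp_while (fun j t => ∃ pre a d l F', Merging n L A lo ord K u C₀ F (s.reg 5) s.fld
      (s.reg 5 + pot n A F + C₀.length)
      (s.time + 3 + 11 * (C₀.length + K) + (13 + 12 * K) * F.card) pre a d l F' t ∧
      j = l.length + a.length) _ ⟨[], later n A u, [], C₀, F, ⟨by simp, by simp, by simp [hu],
        by simp, by simp [hseg.head], by simpa using hseg, by simpa using hs2, ?_, by simp, by simp,
        by simp, hf.congr rfl rfl rfl rfl, hs.congr rfl rfl rfl rfl rfl rfl,
        (Undoes.refl s).congr rfl fun _ _ => rfl, by simp, ?_⟩, rfl⟩ ?_ ?_ ?_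
    · simpa using fun x hx => ⟨hs1 x hx, hlt x hx⟩
    · simp only [HState.setReg_time]; omega
    · intros; simp; omega
    · rintro j t ⟨pre, a, d, l, F', h, rfl⟩ hlt'
      simp only [Expr.eval, h.idx, h.root, h.stat.last u hun, h.split, List.length_append] at hlt'
      cases a with
      | nil => simp at hlt'
      | cons y a =>
        refine (mergeStep_exec hL hB (le_trans hP hPB) hun hK hCF h).mono ?_
        rintro t' ⟨pre', a', d', l', F'', h', hlt2⟩
        exact ⟨_, by simpa using hlt2, pre', a', d', l', F'', h', rfl⟩
    · rintro j t ⟨pre, a, d, l, F', h, rfl⟩ hlt'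
      simp only [Expr.eval, h.idx, h.root, h.stat.last u hun, h.split, List.length_append] at hlt'
      have ha : a = [] := List.length_eq_zero_iff.1 (by omega)
      have hsp := h.split
      rw [ha, List.append_nil] at hsp
      have htm := h.time
      have hle : F'.card ≤ F.card := Finset.card_le_card fun x hx => ((h.set x).1 hx).1
      refine ⟨d ++ l, F', h.root, h.seg, h.sorted, h.gt, by rw [hsp]; exact h.mem,
        by rw [hsp]; exact h.set, h.fresh.congr rfl rfl rfl rfl, h.stat.congr rfl rfl rfl rfl rfl rfl,
        h.und.congr rfl fun _ _ => rfl, h.trail, ?_⟩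
      simp only [HState.tick_time]
      -- The second loop charges `15 + 12 * K` for each fresh vertex. The budget of the merge, with
      -- `13` in place of `15`, is raised to this rate so that both loops share it.
      have e1 : (15 + 12 * K) * F'.card = (13 + 12 * K) * F'.card + 2 * F'.card := by ring
      have e2 : (15 + 12 * K) * F.card = (13 + 12 * K) * F.card + 2 * F.card := by ring
      omega
  obtain ⟨t1, x1, C₁, F₁, a1, a2, a3, a4, a5, a6, a7, a8, a9, a10, a11⟩ := hmerge
  -- the earlier neighbours
  have hprep : Wp B β (.while (rg 0) (.add (arr 3 (rg 3)) (.const 1)) prependStep)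
      (fun t => ∃ C F', Prepending n L A lo ord K u C₁ F₁ (s.reg 5) s.fld
        (s.reg 5 + pot n A F + C₀.length)
        (s.time + 6 + 11 * (C₀.length + K) + (15 + 12 * K) * F.card) C F' t ∧
        earlierIn A F' u = []) (t1.setReg 4 (t1.fld 1 u)) := by
    refine wp_while (fun j t => ∃ C F', Prepending n L A lo ord K u C₁ F₁ (s.reg 5) s.fld
        (s.reg 5 + pot n A F + C₀.length)
        (s.time + 5 + 11 * (C₀.length + K) + (15 + 12 * K) * F.card) C F' t ∧ j = F'.card) _
        ⟨C₁, F₁, ⟨by simp [a1], by simpa using a2.linked, a3, fun x hx => (a4 x hx).2,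
          fun x hx y hy => (mem_earlierIn.1 hx).1.trans (a4 y hy).1, by simp, fun _ hx => hx,
          fun x hx hx' => absurd hx hx', a7.congr rfl rfl rfl rfl, a8.congr rfl rfl rfl rfl rfl rfl,
          a9.congr rfl fun _ _ => rfl, a10, ?_⟩, rfl⟩ ?_ ?_ ?_
    · simp only [HState.setReg_time]; omega
    · rintro j t ⟨C, F', h, rfl⟩
      refine ⟨trivial, ⟨by simp; omega, by simp; omega, ?_⟩⟩
      have := h.fresh.fam.seg u hun
      simp only [Expr.eval, h.root]
      rcases List.eq_nil_or_concat (earlierIn A F' u) with he | ⟨r, y, he⟩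
      · have := (h.fresh.fam.pv_lt_iff hun).2 (by simp [he])
        omega
      · rw [List.concat_eq_append] at he
        obtain ⟨hyu, hyF, hA⟩ := mem_earlierIn.1 (show y ∈ earlierIn A F' u by simp [he])
        have hyn := h.fresh.lt y hyF
        have hidx := List.idxOf_lt_length_of_mem (mem_later.2 ⟨hun, hyu, hA⟩)
        have := hL.bound y hyn
        rw [h.fresh.fam.pv_eq hun (l := r.map (cell n A lo u)) (x := cell n A lo u y) (by simp [he])]
        simp only [cell]
        omega
    · rintro j t ⟨C, F', h, rfl⟩ hlt'
      simp only [Expr.eval, h.root, h.stat.num] at hlt'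
      -- The test `n < pv u + 1` says that `pv u` is a cell and not the header, that is, that the
      -- list of `u` is nonempty.
      have hne : earlierIn A F' u ≠ [] := by
        intro hc
        have := (h.fresh.fam.pv_lt_iff hun).2 (by simp [hc])
        omega
      refine (prependStep_exec hL hB (le_trans hP hPB) hun hK h hne).mono ?_
      rintro t' ⟨C', F'', h', hlt2⟩
      exact ⟨_, hlt2, C', F'', h', rfl⟩
    · rintro j t ⟨C, F', h, rfl⟩ hlt'
      simp only [Expr.eval, h.root, h.stat.num] at hlt'
      have hnil : earlierIn A F' u = [] := by
        have := (h.fresh.fam.pv_lt_iff hun).1 (by omega)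
        simpa using this
      refine ⟨C, F', ⟨h.root, h.linked, h.sorted, h.lt, h.below, h.mem, h.sub, h.gone,
        h.fresh.congr rfl rfl rfl rfl, h.stat.congr rfl rfl rfl rfl rfl rfl,
        h.und.congr rfl fun _ _ => rfl, h.trail, ?_⟩, hnil⟩
      have := h.time
      simp only [HState.tick_time]; omega
  obtain ⟨t2, x2, C, F', h, hnil⟩ := hprep
  have hset : ∀ x, x ∈ F' ↔ x ∈ F ∧ ¬ RankAdj n A u x := by
    intro x
    rw [RankAdj, not_or]
    constructor
    · intro hx
      have h1 := (a6 x).1 (h.sub x hx)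
      refine ⟨h1.1, h1.2, fun hc => ?_⟩
      have : x ∈ earlierIn A F' u := mem_earlierIn.2 ⟨hc.1, hx, hc.2⟩
      simp [hnil] at this
    · rintro ⟨h1, h2, h3⟩
      by_contra hc
      exact h3 (h.gone x ((a6 x).2 ⟨h1, h2⟩) hc)
  have hmem : ∀ x, x ∈ C ↔ (x ∈ C₀ ∧ x ∉ later n A u) ∨ (x ∈ F ∧ RankAdj n A u x) := by
    intro x
    rw [h.mem, a5, a6, hset, RankAdj]
    constructor
    · rintro ((h1 | h1) | ⟨h1, h2⟩)
      · exact Or.inl h1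
      · exact Or.inr ⟨h1.1, Or.inl h1.2⟩
      · exact Or.inr ⟨h1.1, by tauto⟩
    · rintro (h1 | ⟨h1, h2 | h2⟩)
      · exact Or.inl (Or.inl h1)
      · exact Or.inl (Or.inr ⟨h1, h2⟩)
      · by_cases h3 : x ∈ later n A u
        · exact Or.inl (Or.inr ⟨h1, h3⟩)
        · exact Or.inr ⟨⟨h1, h3⟩, fun h4 => h4.2 (Or.inr h2)⟩
  have hsub : F ⊆ F' ∪ C.toFinset := by
    intro x hx
    rw [Finset.mem_union, List.mem_toFinset, hset, hmem]
    by_cases hr : RankAdj n A u x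
    · exact Or.inr (Or.inr ⟨hx, hr⟩)
    · exact Or.inl ⟨hx, hr⟩
  have hcardF : F.card ≤ F'.card + C.length :=
    (Finset.card_le_card hsub).trans ((Finset.card_union_le _ _).trans
      (Nat.add_le_add_left (List.toFinset_card_le _) _))
  have hcardC : C₀.length ≤ C.length + K := by
    have hnd : C₀.Nodup := hs2.imp fun hab => hab.ne
    have h1 : C₀.toFinset ⊆ C.toFinset ∪ (later n A u).toFinset := by
      intro x hx
      rw [Finset.mem_union, List.mem_toFinset, List.mem_toFinset, hmem]
      rw [List.mem_toFinset] at hx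
      tauto
    have h2 := (Finset.card_le_card h1).trans (Finset.card_union_le _ _)
    rw [List.toFinset_card_of_nodup hnd] at h2
    have h3 := List.toFinset_card_le C
    have h4 := List.toFinset_card_le (later n A u)
    have h5 := hK u hun
    omega
  -- The fresh vertices that are lost all lie in `C`, and each contributes at most `4 + 2 * K` to
  -- the potential. This bounds the growth of the trail in terms of `|C|`.
  have hpot : pot n A F ≤ pot n A F' + (4 + 2 * K) * C.length := by
    have h1 : pot n A F ≤ ∑ v ∈ F' ∪ (C.toFinset ∩ F), (4 + 2 * (later n A v).length) := by
      refine Finset.sum_le_sum_of_subset fun x hx => ?_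
      have := hsub hx
      rw [Finset.mem_union] at this ⊢
      rw [Finset.mem_inter]
      tauto
    have h2 : ∑ v ∈ F' ∪ (C.toFinset ∩ F), (4 + 2 * (later n A v).length) ≤
        pot n A F' + ∑ v ∈ C.toFinset ∩ F, (4 + 2 * (later n A v).length) := by
      rw [pot, ← Finset.sum_union_inter]; exact Nat.le_add_right _ _
    have h3 : ∑ v ∈ C.toFinset ∩ F, (4 + 2 * (later n A v).length) ≤
        (C.toFinset ∩ F).card * (4 + 2 * K) := by
      refine Finset.sum_le_card_nsmul _ _ _ fun v hv => ?_
      have := hK v (hf.lt v (Finset.mem_inter.1 hv).2)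
      omega
    have h4 : (C.toFinset ∩ F).card ≤ C.length :=
      (Finset.card_le_card Finset.inter_subset_left).trans (List.toFinset_card_le _)
    have h5 := Nat.mul_le_mul_right (4 + 2 * K) h4
    have h6 : C.length * (4 + 2 * K) = (4 + 2 * K) * C.length := Nat.mul_comm _ _
    omega
  refine ⟨t2, C, F', ?_, h.linked, h.sorted, h.lt, hmem, hset, h.fresh, h.und,
    h.trail.trans hP, ?_, ?_⟩
  · have e1 := HExec.assign (B := B) (β := β) (s := s) (r := 8) (e := rg 3) trivial
    have e2 := HExec.assign (B := B) (β := β) (s := s.setReg 8 u) (r := 9) (e := arr 1 (rg 3))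
      (by simp; omega)
    have e3 := HExec.assign (B := B) (β := β) (s := (s.setReg 8 u).setReg 9 (s.fld 1 u)) (r := 10)
      (e := arr 9 (rg 3)) (by simp; omega)
    have e4 := HExec.assign (B := B) (β := β) (s := t1) (r := 4) (e := arr 1 (rg 3))
      (by simp; omega)
    simp only [Expr.eval, hu] at e1
    simp only [Expr.eval, HState.setReg_reg, HState.setReg_fld, Nat.reduceEqDiff, if_false, hu] at e2
    simp only [Expr.eval, HState.setReg_reg, HState.setReg_fld, Nat.reduceEqDiff, if_false, hu,
      hs.first u hun] at e3
    simp only [Expr.eval, a1] at e4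
    exact .seq e1 (.seq e2 (.seq e3 (.seq x1 (.seq e4 x2))))
  · have h1 := h.trail
    have h2 : (4 + 2 * K) * C.length ≤ 6 * K * C.length := Nat.mul_le_mul_right _ (by omega)
    omega
  · have h1 := h.time
    have h2 := Nat.mul_le_mul_left (15 + 12 * K) hcardF
    rw [Nat.mul_add] at h2
    -- The time is at most `6 + 11 * (|C| + 2 * K) + (15 + 12 * K) * |C|`; as `1 ≤ K`, this gives
    -- `26 + 12 * K ≤ 38 * K` for the coefficient of `|C|` and `6 + 22 * K ≤ 28 * K` for the rest.
    have h3 : (15 + 12 * K) * C.length + 11 * C.length ≤ 38 * K * C.length := by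
      rw [← Nat.add_mul]; exact Nat.mul_le_mul_right _ (by omega)
    omega

end Prepend

end InducedSubtrees

namespace InducedSubtrees

/-! ## The main loop -/

/-- The set after the output of a list of symbols. -/
def currentFrom (cur : Finset ℕ) : List Event → Finset ℕ
  | [] => cur
  | Event.ins v :: l => currentFrom (insert v cur) l
  | Event.del v :: l => currentFrom (cur.erase v) l
  | Event.report :: l => currentFrom cur l

theorem currentFrom_append (cur : Finset ℕ) (l l' : List Event) :
    currentFrom cur (l ++ l') = currentFrom (currentFrom cur l) l' := by
  induction l generalizing cur with
  | nil => rfl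
  | cons e l ih => cases e <;> simp only [List.cons_append, currentFrom, ih]

theorem reportedFrom_append (cur : Finset ℕ) (l l' : List Event) :
    reportedFrom cur (l ++ l') = reportedFrom cur l ++ reportedFrom (currentFrom cur l) l' := by
  induction l generalizing cur with
  | nil => rfl
  | cons e l ih => cases e <;> simp only [List.cons_append, currentFrom, reportedFrom, ih]

/-- From the current set `S`, the symbols `ev` report the sets `Ls` and return to `S`. -/
def Reports {n : ℕ} (S : Finset (Fin n)) (ev : List Event) (Ls : List (Finset (Fin n))) : Prop :=
  reportedFrom (S.map Fin.valEmbedding) ev = Ls.map (fun S => S.map Fin.valEmbedding) ∧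
    currentFrom (S.map Fin.valEmbedding) ev = S.map Fin.valEmbedding

theorem Reports.append {n : ℕ} {S : Finset (Fin n)} {ev ev' : List Event}
    {Ls Ls' : List (Finset (Fin n))} (h : Reports S ev Ls) (h' : Reports S ev' Ls') :
    Reports S (ev ++ ev') (Ls ++ Ls') :=
  ⟨by rw [reportedFrom_append, h.1, h.2, h'.1, List.map_append],
    by rw [currentFrom_append, h.2, h'.2]⟩

theorem Reports.insert {n : ℕ} {S : Finset (Fin n)} {v : Fin n} {ev : List Event}
    {Ls : List (Finset (Fin n))} (h : Reports (insert v S) ev Ls) (hv : v ∉ S) :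
    Reports S ([Event.ins v] ++ ev ++ [Event.del v]) Ls := by
  have h1 : currentFrom (S.map Fin.valEmbedding) [Event.ins v] =
      (Insert.insert v S).map Fin.valEmbedding := by
    rw [Finset.map_insert]; rfl
  constructor
  · rw [reportedFrom_append, reportedFrom_append, h1, h.1]
    simp [reportedFrom]
  · rw [currentFrom_append, currentFrom_append, h1, h.2]
    simp only [currentFrom]
    rw [Finset.map_insert, Fin.valEmbedding_apply, Finset.erase_insert_eq_erase, Finset.erase_eq_of_notMem]
    simpa [Fin.val_inj] using hv

/-- One step of the main loop. Register `7` is `0` for a call and `1` for a return, register `6` is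
the number of frames; a frame consists of a vertex and `0` or the trail length plus one. -/
def enumStep : HProg :=
  .ite (rg 7) (.const 1)
    (.ite (rg 4) (rg 0)
      (.store (.const 7) (rg 6) (rg 4) ;; .store (.const 8) (rg 6) (.const 0) ;;
       .assign 6 (.add (rg 6) (.const 1)) ;; .assign 4 (arr 1 (rg 4)))
      (.report ;; .assign 7 (.const 1)))
    (.assign 3 (arr 7 (.sub (rg 6) (.const 1))) ;; .assign 13 (arr 8 (.sub (rg 6) (.const 1))) ;;
     .ite (rg 13) (.const 1)
       (.store (.const 8) (.sub (rg 6) (.const 1)) (.add (rg 5) (.const 1)) ;;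
        .ins (.raw (.add (rg 1) (rg 3))) ;; includeStep ;; .assign 7 (.const 0))
       (.assign 13 (.sub (rg 13) (.const 1)) ;; undo ;; .del (.raw (.add (rg 1) (rg 3))) ;;
        .assign 6 (.sub (rg 6) (.const 1))))

/-- The parts of the state that are restored when a call ends, with `sp` frames left. -/
structure Restored (sp : ℕ) (s t : HState) : Prop where
  reg : ∀ r, r = 0 ∨ r = 1 ∨ r = 2 ∨ r = 5 → t.reg r = s.reg r
  stack : t.reg 6 = sp
  data : ∀ k < 4, t.fld k = s.fld k
  trail : ∀ k, 4 ≤ k → k < 7 → ∀ i < s.reg 5, t.fld k i = s.fld k i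
  frames : ∀ k, 7 ≤ k → k < 9 → ∀ i < sp, t.fld k i = s.fld k i
  const : ∀ k, 9 ≤ k → t.fld k = s.fld k
  raw : t.raw = s.raw

theorem Restored.static {n L sp : ℕ} {A : ℕ → ℕ → Bool} {lo ord : ℕ → ℕ} {s t : HState}
    (h : Restored sp s t) (hs : Static n L A lo ord s) : Static n L A lo ord t :=
  hs.congr (h.reg 0 (by simp)) (h.reg 1 (by simp)) (h.const 9 le_rfl) (h.const 10 (by simp))
    (h.const 11 (by simp)) h.raw

theorem Restored.fresh {n sp : ℕ} {A : ℕ → ℕ → Bool} {lo : ℕ → ℕ} {F : Finset ℕ} {s t : HState}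
    (h : Restored sp s t) (hs : Fresh n A lo F s) : Fresh n A lo F t :=
  hs.congr (h.data 0 (by simp)) (h.data 2 (by simp)) (h.data 3 (by simp)) (h.const 12 (by simp))

/-- The vertices with ranks in `C`. -/
def rankSet {n : ℕ} (pos : Fin n ≃ Fin n) (C : List ℕ) : Finset (Fin n) :=
  Finset.univ.filter fun v => (pos v : ℕ) ∈ C

/-- The vertices with ranks neither in `C` nor in `F`. -/
def restSet {n : ℕ} (pos : Fin n ≃ Fin n) (C : List ℕ) (F : Finset ℕ) : Finset (Fin n) :=
  Finset.univ.filter fun v => (pos v : ℕ) ∉ C ∧ (pos v : ℕ) ∉ F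

section Main

variable {n L B β : ℕ} {A : ℕ → ℕ → Bool} {lo ord : ℕ → ℕ} {K P : ℕ} {G : SimpleGraph (Fin n)}
  {pos : Fin n ≃ Fin n}

theorem iter_one {Q : HState → Prop} {s : HState} (h : 0 < s.reg 6)
    (hw : Wp B β enumStep Q s.tick) : ∃ t, Iter B β (.const 0) (rg 6) enumStep s t ∧ Q t := by
  obtain ⟨t, ht, hq⟩ := hw
  exact ⟨t, .step (by simp) trivial h ht (.refl t), hq⟩

theorem rankAdj_iff (hA : ∀ u v : Fin n, A (pos u) (pos v) = true ↔ G.Adj u v) (u v : Fin n) :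
    RankAdj n A (pos u) (pos v) ↔ G.Adj u v := by
  rw [RankAdj, mem_later, hA, hA, G.adj_comm v u]
  constructor
  · rintro (h | h)
    · exact h.2.2
    · exact h.2
  · intro h
    have : (pos u : ℕ) ≠ pos v := fun he => h.ne (pos.injective (Fin.ext he))
    rcases lt_or_gt_of_ne this with h1 | h1
    · exact Or.inl ⟨(pos v).2, h1, h⟩
    · exact Or.inr ⟨h1, h⟩

theorem mem_later_iff (hA : ∀ u v : Fin n, A (pos u) (pos v) = true ↔ G.Adj u v) (u v : Fin n) :
    (pos v : ℕ) ∈ later n A (pos u) ↔ pos u < pos v ∧ G.Adj u v := by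
  rw [mem_later, hA]
  exact ⟨fun h => h.2, fun h => ⟨(pos v).2, h⟩⟩

/-- The decidability instance is arbitrary because `ISE` uses the classical one. -/
theorem erase_rankSet [inst : DecidableEq (Fin n)] {v : Fin n} {C₀ : List ℕ} (hv : (pos v : ℕ) ∉ C₀) :
    @Finset.erase _ inst (rankSet pos ((pos v : ℕ) :: C₀)) v = rankSet pos C₀ := by
  ext w
  simp only [rankSet, Finset.mem_erase, Finset.mem_filter, Finset.mem_univ, true_and, List.mem_cons]
  by_cases hwv : w = v
  · subst hwv; simp [hv]
  · have : (pos w : ℕ) ≠ pos v := fun he => hwv (pos.injective (Fin.ext he))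
    simp [hwv, this]

theorem insert_restSet [inst : DecidableEq (Fin n)] {v : Fin n} {C₀ : List ℕ} {F : Finset ℕ}
    (hv : (pos v : ℕ) ∉ C₀) (hF : (pos v : ℕ) ∉ F) :
    @insert _ _ (@Finset.instInsert _ inst) v (restSet pos ((pos v : ℕ) :: C₀) F) = restSet pos C₀ F := by
  ext w
  simp only [restSet, Finset.mem_insert, Finset.mem_filter, Finset.mem_univ, true_and, List.mem_cons]
  by_cases hwv : w = v
  · subst hwv; simp [hv, hF]
  · have : (pos w : ℕ) ≠ pos v := fun he => hwv (pos.injective (Fin.ext he))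
    simp [hwv, this]

/-- All of `C₀` comes after `v`, so a candidate adjacent to `v` is a later neighbour; and a vertex
outside the forbidden set and different from the candidates is in `F`. With these two facts the
description of the list agrees with the definition of the procedure. -/
theorem newCand_eq (hA : ∀ u v : Fin n, A (pos u) (pos v) = true ↔ G.Adj u v) {S : Finset (Fin n)}
    (hS : S ≠ ∅) {v : Fin n} {C₀ C : List ℕ} {F : Finset ℕ} (hv : ∀ x ∈ C₀, (pos v : ℕ) < x)
    (hCF : ∀ x ∈ C₀, x ∉ F) (hF : (pos v : ℕ) ∉ F)
    (hmem : ∀ x, x ∈ C ↔ (x ∈ C₀ ∧ x ∉ later n A (pos v)) ∨ (x ∈ F ∧ RankAdj n A (pos v) x)) :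
    newCand G pos S (rankSet pos ((pos v : ℕ) :: C₀)) (restSet pos ((pos v : ℕ) :: C₀) F) v =
      rankSet pos C := by
  ext w
  have hne : w ≠ v → (pos w : ℕ) ≠ pos v := fun h he => h (pos.injective (Fin.ext he))
  rw [mem_newCand, if_neg hS]
  simp only [rankSet, restSet, Finset.mem_filter, Finset.mem_univ, true_and, List.mem_cons, hmem,
    rankAdj_iff hA, mem_later_iff hA]
  by_cases hwv : w = v
  · subst hwv
    simp only [ne_eq, not_true_eq_false, false_and, and_false, hF, SimpleGraph.irrefl,
      not_false_eq_true, and_true, or_false, false_iff]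
    exact fun hc => lt_irrefl _ (hv _ hc)
  · have h1 := hne hwv
    have h2 : (pos w : ℕ) ∈ C₀ → pos v < pos w := fun h => hv _ h
    have h3 := hCF (pos w)
    simp only [h1, false_or, hwv, ne_eq, not_false_eq_true, true_and]
    tauto

theorem newForbidden_eq (hA : ∀ u v : Fin n, A (pos u) (pos v) = true ↔ G.Adj u v)
    {S : Finset (Fin n)} (hS : S ≠ ∅) {v : Fin n} {C₀ C : List ℕ} {F F' : Finset ℕ}
    (hv : ∀ x ∈ C₀, (pos v : ℕ) < x) (hCF : ∀ x ∈ C₀, x ∉ F) (hF : (pos v : ℕ) ∉ F)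
    (hmem : ∀ x, x ∈ C ↔ (x ∈ C₀ ∧ x ∉ later n A (pos v)) ∨ (x ∈ F ∧ RankAdj n A (pos v) x))
    (hset : ∀ x, x ∈ F' ↔ x ∈ F ∧ ¬ RankAdj n A (pos v) x) :
    newForbidden G S (rankSet pos ((pos v : ℕ) :: C₀)) (restSet pos ((pos v : ℕ) :: C₀) F) v =
      restSet pos C F' := by
  ext w
  have hne : w ≠ v → (pos w : ℕ) ≠ pos v := fun h he => h (pos.injective (Fin.ext he))
  rw [mem_newForbidden]
  simp only [rankSet, restSet, Finset.mem_filter, Finset.mem_univ, true_and, List.mem_cons, hmem,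
    hset, rankAdj_iff hA, mem_later_iff hA, ne_eq, hS, not_false_eq_true]
  by_cases hwv : w = v
  · subst hwv
    simp only [true_or, hF, false_and, or_false, not_false_eq_true, and_true, true_iff, not_and]
    exact fun hc => absurd (hv _ hc) (lt_irrefl _)
  · have h1 := hne hwv
    have h2 : (pos w : ℕ) ∈ C₀ → pos v < pos w := fun h => hv _ h
    have h3 := hCF (pos w)
    simp only [h1, false_or, hwv]
    tauto

/-- The main loop treats calls with the set `S`, the candidates `C` and the fresh vertices `F`
correctly. -/
def CallCorrect (B β L : ℕ) (A : ℕ → ℕ → Bool) (lo ord : ℕ → ℕ) (K P : ℕ) (G : SimpleGraph (Fin n))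
    (pos : Fin n ≃ Fin n) (S : Finset (Fin n)) (C : List ℕ) (F : Finset ℕ) : Prop :=
  ∀ s : HState, s.reg 7 = 0 → Static n L A lo ord s → Fresh n A lo F s →
    Linked (s.fld 1) (s.reg 4) C n → C.Pairwise (· < ·) → (∀ x ∈ C, x < n) → (∀ x ∈ C, x ∉ F) →
    (∀ v ∈ S, (pos v : ℕ) ∉ C ∧ (pos v : ℕ) ∉ F) → 1 ≤ s.reg 6 →
    s.reg 5 + pot n A F + C.length ≤ P → s.reg 6 + C.length + F.card ≤ P →
    ∃ t Ls ev, Iter B β (.const 0) (rg 6) enumStep s t ∧ Restored (s.reg 6) s t ∧ t.reg 7 = 1 ∧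
      ISE G pos S (rankSet pos C) (restSet pos C F) Ls ∧ t.out = s.out ++ ev ∧ Reports S ev Ls ∧
      t.time + 56 * K * C.length + 112 * K ≤ s.time + (112 * K + 5) * Ls.length

/-- The return from the call without `u`, followed by the call with `u`. -/
theorem return_correct (hL : Layout n L A lo) (hB : 16 + n + L ≤ B) (hβ : L + n ≤ β) (hK1 : 1 ≤ K)
    (hK : ∀ v < n, (later n A v).length ≤ K) (hPB : P + 1 ≤ B)
    (hord : ∀ v : Fin n, ord (pos v) = v)
    {S : Finset (Fin n)} {v : Fin n} {C₀ : List ℕ} {F : Finset ℕ}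
    (hcall : ∀ C F', C.length + 2 * F'.card < C₀.length + 1 + 2 * F.card →
      CallCorrect B β L A lo ord K P G pos (insert v S) C F')
    {s : HState} {sp : ℕ} (h7 : s.reg 7 = 1) (hs : Static n L A lo ord s) (hf : Fresh n A lo F s)
    (h6 : s.reg 6 = sp + 1) (hsu : s.fld 7 sp = pos v) (hsm : s.fld 8 sp = 0)
    (hseg : Seg (s.fld 1) (pos v) C₀ n) (hsort : ((pos v : ℕ) :: C₀).Pairwise (· < ·))
    (hlt : ∀ x ∈ C₀, x < n) (hCF : ∀ x ∈ (pos v : ℕ) :: C₀, x ∉ F)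
    (hS : ∀ w ∈ S, (pos w : ℕ) ∉ C₀ ∧ (pos w : ℕ) ∉ F) (hvS : v ∉ S)
    (hP : s.reg 5 + pot n A F + C₀.length ≤ P) (hP' : sp + 1 + C₀.length + F.card ≤ P) :
    ∃ t Ls ev C F', Iter B β (.const 0) (rg 6) enumStep s t ∧ Restored sp s t ∧ t.reg 7 = 1 ∧
      ISE G pos (insert v S) (rankSet pos C) (restSet pos C F') Ls ∧
      (∀ x, x ∈ C ↔ (x ∈ C₀ ∧ x ∉ later n A (pos v)) ∨ (x ∈ F ∧ RankAdj n A (pos v) x)) ∧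
      (∀ x, x ∈ F' ↔ x ∈ F ∧ ¬ RankAdj n A (pos v) x) ∧
      t.out = s.out ++ ev ∧ Reports S ev Ls ∧
      t.time + 112 * K ≤ s.time + (31 * K + 17) + (112 * K + 5) * Ls.length := by
  have hun := (pos v).2
  have huF : (pos v : ℕ) ∉ F := hCF _ (by simp)
  have huC : (pos v : ℕ) ∉ C₀ := fun hc => lt_irrefl _ ((List.pairwise_cons.1 hsort).1 _ hc)
  -- include
  have hinc : Wp B β enumStep (fun t => ∃ C F', t.reg 7 = 0 ∧ Static n L A lo ord t ∧
      Linked (t.fld 1) (t.reg 4) C n ∧ C.Pairwise (· < ·) ∧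
      (∀ x ∈ C, x < n) ∧
      (∀ x, x ∈ C ↔ (x ∈ C₀ ∧ x ∉ later n A (pos v)) ∨ (x ∈ F ∧ RankAdj n A (pos v) x)) ∧
      (∀ x, x ∈ F' ↔ x ∈ F ∧ ¬ RankAdj n A (pos v) x) ∧ Fresh n A lo F' t ∧
      Undoes (s.reg 5) t s.fld ∧ t.reg 5 + pot n A F' + C.length ≤ P ∧
      t.reg 5 ≤ s.reg 5 + 6 * K * C.length + K ∧
      t.time ≤ s.time + 8 + 28 * K + 38 * K * C.length ∧ t.reg 6 = sp + 1 ∧ t.reg 2 = s.reg 2 ∧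
      (∀ i < sp, t.fld 7 i = s.fld 7 i ∧ t.fld 8 i = s.fld 8 i) ∧ t.fld 7 sp = pos v ∧
      t.fld 8 sp = s.reg 5 + 1 ∧ (∀ k, 9 ≤ k → t.fld k = s.fld k) ∧ t.raw = s.raw ∧
      t.out = s.out ++ [Event.ins v]) s.tick := by
    rw [enumStep]
    refine wp_ite trivial (by simp; omega) (fun hc => by simp [h7] at hc) (fun _ => ?_)
    rw [wp_seq, wp_assign]
    refine ⟨by simp; omega, ?_⟩
    rw [wp_seq, wp_assign]
    refine ⟨by simp; omega, ?_⟩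
    simp only [Expr.eval, HState.tick_fld, HState.tick_reg, HState.setReg_fld, HState.setReg_reg,
      h6, Nat.add_sub_cancel, hsu, hsm, Nat.reduceEqDiff, if_false]
    -- The mark `0` in the frame says that the call without `v` has returned. The mark written next
    -- is the trail length plus one, so it is nonzero even if the trail is empty.
    refine wp_ite trivial (by simp; omega) (fun _ => ?_) (fun hc => by simp at hc)
    rw [wp_seq, wp_store]
    refine ⟨by simp; omega, ?_⟩
    rw [wp_seq, wp_ins]
    refine ⟨by simp [hs.len]; omega, ?_⟩
    simp only [Expr.eval, HState.tick_reg, HState.setReg_reg, HState.setFld_reg, HState.setFld_raw, HState.setReg_raw,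
      HState.tick_raw, h6, Nat.add_sub_cancel, Nat.reduceEqDiff, if_false, if_true, hs.len, hs.name _ hun, hord]
    generalize ht1 : HState.emit _ (Event.ins v) = t1
    have g3 : t1.reg 3 = pos v := by simp [← ht1]
    have g5 : t1.reg 5 = s.reg 5 := by simp [← ht1]
    have g6 : t1.reg 6 = sp + 1 := by simp [← ht1, h6]
    have g2 : t1.reg 2 = s.reg 2 := by simp [← ht1]
    have gf : ∀ k, k ≠ 8 → t1.fld k = s.fld k := by intro k hk; simp [← ht1, hk]
    have g8 : t1.fld 8 = Function.update (s.fld 8) sp (s.reg 5 + 1) := by simp [← ht1]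
    have gr : t1.raw = s.raw := by simp [← ht1]
    have go : t1.out = s.out ++ [Event.ins v] := by simp [← ht1]
    have gt : t1.time = s.time + 7 := by simp [← ht1]
    have hs1 : Static n L A lo ord t1 := by
      refine hs.congr ?_ ?_ ?_ ?_ ?_ ?_ <;> simp [← ht1]
    have hf1 : Fresh n A lo F t1 := by
      refine hf.congr ?_ ?_ ?_ ?_ <;> simp [← ht1]
    rw [wp_seq]
    obtain ⟨t2, C, F', x2, b1, b2, b3, b4, b5, b6, b7, b8, b9, b10⟩ := includeStep_exec
      (β := β) (P := P) hL hB hK1 hK hs1 hf1 g3 hun (by rw [gf 1 (by simp)]; exact hseg) hsort hlt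
      (fun x hx => hCF x (List.mem_cons_of_mem _ hx)) (by rw [g5]; exact hP) (by omega)
    refine ⟨t2, x2, wp_assign.2 ⟨by simp, C, F', by simp, ?_, by simpa using b1, b2, b3, b4, b5,
      b6.congr rfl rfl rfl rfl, ?_, by simpa using b8, by simpa [g5] using b9, ?_, ?_, ?_,
      fun i hi => ?_, ?_, ?_, fun k hk => ?_, ?_, ?_⟩⟩
    · exact (hs1.exec x2 rfl).congr rfl rfl rfl rfl rfl rfl
    · have h1 := b7
      rw [g5] at h1
      refine ⟨h1.le, h1.key, fun k hk => ?_, fun k hk hk' i hi => ?_⟩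
      · rw [← gf k (by omega), ← h1.eq k hk]; rfl
      · rw [← gf k (by omega), ← h1.old k hk hk' i hi]; rfl
    · simp only [HState.setReg_time]; omega
    · simp [x2.reg_eq (r := 6) rfl, g6]
    · simp [x2.reg_eq (r := 2) rfl, g2]
    · have : i ≠ sp := by omega
      simp [x2.fld_eq (k := 7) rfl, x2.fld_eq (k := 8) rfl, gf 7, g8, this]
    · simp [x2.fld_eq (k := 7) rfl, gf 7, hsu]
    · simp [x2.fld_eq (k := 8) rfl, g8]
    · rw [HState.setReg_fld, ← gf k (by omega)]
      refine x2.fld_eq ?_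
      have e : ∀ j : ℕ, j < 9 → (j != k) = true := fun j hj => by simp; omega
      simp [includeStep, mergeStep, prependStep, insertStep, unfresh, logStore, HProg.noFld, e]
    · simp [x2.raw_eq rfl, gr]
    · simp [x2.out_eq rfl, go]
  obtain ⟨t1, y1, C, F', c7, cs, cl, csrt, clt, cmem, cset, cf, cu, cP, cP5, ctm, c6, c2, cfr,
    cfu, cfm, cconst, craw, cout⟩ := iter_one (by omega) hinc
  -- the call
  have hFsub : F' ⊆ F := fun x hx => ((cset x).1 hx).1
  -- A new candidate is an old one or was fresh, so candidates and fresh vertices together do not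
  -- increase in number. This gives both the decrease of the measure, since `v` itself is gone, and
  -- the bound for the stack.
  have hcards : C.length + F'.card ≤ C₀.length + F.card := by
    have hnd : C.Nodup := csrt.imp fun hab => hab.ne
    have h1 : C.toFinset ⊆ C₀.toFinset ∪ (F \ F') := by
      intro x hx
      rw [Finset.mem_union, List.mem_toFinset, Finset.mem_sdiff]
      rw [List.mem_toFinset, cmem] at hx
      rw [cset]; tauto
    have h2 := (Finset.card_le_card h1).trans (Finset.card_union_le _ _)
    rw [List.toFinset_card_of_nodup hnd] at h2
    have h3 := List.toFinset_card_le C₀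
    have h4 := Finset.card_sdiff_add_card_eq_card hFsub
    omega
  have hFle := Finset.card_le_card hFsub
  obtain ⟨t2, Ls, ev, y2, hk2, d7, dise, dout, drep, dtm⟩ := hcall C F' (by omega) t1 c7 cs cf cl csrt
    clt (fun x hx hx' => by
      have h1 := (cset x).1 hx'
      rcases (cmem x).1 hx with h2 | h2
      · exact hCF x (List.mem_cons_of_mem _ h2.1) h1.1
      · exact h1.2 h2.2)
    (fun w hw => by
      have key : (pos w : ℕ) ∉ C₀ ∧ (pos w : ℕ) ∉ F := by
        rcases Finset.mem_insert.1 hw with rfl | hw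
        · exact ⟨huC, huF⟩
        · exact hS w hw
      refine ⟨fun hc => ?_, fun hc => key.2 (hFsub hc)⟩
      rcases (cmem _).1 hc with h2 | h2
      · exact key.1 h2.1
      · exact key.2 h2.1) (by omega) cP (by omega)
  rw [c6] at hk2
  -- undo
  have e5 : t2.reg 5 = t1.reg 5 := hk2.reg 5 (by simp)
  -- The call restores the logged arrays, the trail length and the trail below it, so the writes of
  -- the inclusion can be undone after the call just as before it.
  have hu2 : Undoes (s.reg 5) t2 s.fld := by
    refine ⟨e5 ▸ cu.le, fun i hi hi' => ?_, fun k hk => ?_, fun k hk hk' i hi => ?_⟩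
    · rw [hk2.trail 4 (by simp) (by simp) i (by omega)]; exact cu.key i hi (by omega)
    · rw [← cu.eq k hk, e5]
      have hle := cu.le
      refine unwind_congr (fun i hi => ?_) (hk2.data k hk)
      exact ⟨hk2.trail 4 (by simp) (by simp) i (by omega), hk2.trail 5 (by simp) (by simp) i (by omega),
        hk2.trail 6 (by simp) (by simp) i (by omega)⟩
    · rw [hk2.trail k hk hk' i (lt_of_lt_of_le hi cu.le)]; exact cu.old k hk hk' i hi
  have hs2 := hk2.static cs
  have f7 : t2.fld 7 sp = pos v := by rw [hk2.frames 7 (by simp) (by simp) sp (by omega), cfu]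
  have f8 : t2.fld 8 sp = s.reg 5 + 1 := by rw [hk2.frames 8 (by simp) (by simp) sp (by omega), cfm]
  have hend : Wp B β enumStep (fun t => Restored sp s t ∧ t.reg 7 = 1 ∧
      t.out = s.out ++ ([Event.ins v] ++ ev ++ [Event.del v]) ∧
      t.time ≤ t2.time + 9 + 3 * (6 * K * C.length + K)) t2.tick := by
    rw [enumStep]
    refine wp_ite trivial (by simp; omega) (fun hc => by simp [d7] at hc) (fun _ => ?_)
    rw [wp_seq, wp_assign]
    refine ⟨by simp; omega, ?_⟩
    rw [wp_seq, wp_assign]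
    refine ⟨by simp; omega, ?_⟩
    simp only [Expr.eval, HState.tick_fld, HState.tick_reg, HState.setReg_fld, HState.setReg_reg,
      hk2.stack, Nat.add_sub_cancel, f7, f8, Nat.reduceEqDiff, if_false]
    refine wp_ite trivial (by simp; omega) (fun hc => by simp at hc) (fun _ => ?_)
    rw [wp_seq, wp_assign]
    refine ⟨by simp; omega, ?_⟩
    simp only [Expr.eval, HState.tick_reg, HState.setReg_reg, if_true, Nat.add_sub_cancel]
    generalize ht3 : HState.setReg _ 13 (s.reg 5) = t3
    have g13 : t3.reg 13 = s.reg 5 := by simp [← ht3]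
    have gr : ∀ r, r ≠ 3 → r ≠ 13 → t3.reg r = t2.reg r := by
      intro r h3 h13; simp [← ht3, h3, h13]
    have g3 : t3.reg 3 = pos v := by simp [← ht3]
    have gf : t3.fld = t2.fld := by simp [← ht3]
    have gw : t3.raw = t2.raw := by simp [← ht3]
    have go : t3.out = t2.out := by simp [← ht3]
    have gt : t3.time = t2.time + 6 := by simp [← ht3]
    obtain ⟨t4, x4, k5, kr, kd, kf, kw, ko, kt⟩ := undo_exec (B := B) (β := β) (s := t3) (g := s.fld)
      (by omega) (by
        rw [g13]; exact hu2.congr (gr 5 (by simp) (by simp)) fun k _ => by rw [gf])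
    rw [wp_seq]
    have r1 : t4.reg 1 = L := by rw [kr 1 (by simp), gr 1 (by simp) (by simp), hs2.len]
    have r3 : t4.reg 3 = pos v := by rw [kr 3 (by simp), g3]
    have r6 : t4.reg 6 = sp + 1 := by rw [kr 6 (by simp), gr 6 (by simp) (by simp), hk2.stack]
    have rw4 : t4.raw = s.raw := by rw [kw, gw, hk2.raw, craw]
    refine ⟨t4, x4, ?_⟩
    rw [wp_seq, wp_del]
    refine ⟨by simp [r1, r3]; omega, ?_⟩
    rw [wp_assign]
    refine ⟨by simp; omega, ⟨fun r hr => ?_, by simp [r6], fun k hk => ?_, fun k hk hk' i hi => ?_,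
      fun k hk hk' i hi => ?_, fun k hk => ?_, by simp [rw4]⟩, ?_, ?_, ?_⟩
    · have h6' : r ≠ 6 := by omega
      simp only [HState.setReg_reg, HState.emit_reg, if_neg h6']
      rcases hr with rfl | rfl | rfl | rfl
      · rw [kr 0 (by simp), gr 0 (by simp) (by simp), hk2.reg 0 (by simp), cs.num, hs.num]
      · rw [r1, hs.len]
      · rw [kr 2 (by simp), gr 2 (by simp) (by simp), hk2.reg 2 (by simp), c2]
      · rw [k5, g13]
    · simpa using kd k hk
    · simp only [HState.setReg_fld, HState.emit_fld]
      rw [kf k hk, gf]; exact hu2.old k hk hk' i hi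
    · simp only [HState.setReg_fld, HState.emit_fld]
      rw [kf k (by omega), gf, hk2.frames k hk hk' i (by omega)]
      obtain rfl | rfl : k = 7 ∨ k = 8 := by omega
      · exact (cfr i hi).1
      · exact (cfr i hi).2
    · simp only [HState.setReg_fld, HState.emit_fld]
      rw [kf k (by omega), gf, hk2.const k hk, cconst k hk]
    · simp only [HState.setReg_reg, HState.emit_reg, Nat.reduceEqDiff, if_false]
      rw [kr 7 (by simp), gr 7 (by simp) (by simp), d7]
    · simp only [HState.setReg_out, HState.emit_out, ko, go, dout, cout, Expr.eval, r1, r3, rw4,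
        hs.name _ hun, hord, List.append_assoc]
    · simp only [HState.setReg_time, HState.emit_time]
      rw [gr 5 (by simp) (by simp), e5, g13] at kt
      omega
  obtain ⟨t5, y5, hk5, i7, iout, itm⟩ := iter_one (by rw [hk2.stack]; omega) hend
  refine ⟨t5, Ls, _, C, F', y1.trans (y2.trans y5), hk5, i7, dise, cmem, cset, iout,
    drep.insert hvS, ?_⟩
  -- The inclusion takes `38 * K * |C|` steps and the undoing `18 * K * |C|`, three for each of `6 *
  -- K * |C|` trail entries, apart from terms without `|C|`. Together this is exactly the `56 * K *
  -- |C|` that the call with `C` leaves unspent.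
  have : 3 * (6 * K * C.length + K) = 18 * K * C.length + 3 * K := by ring
  have h2 : 38 * K * C.length + 18 * K * C.length = 56 * K * C.length := by ring
  omega

/-- Induction on a measure of candidates and fresh vertices; `u` leaves both in either branch. For
the time, each solution brings `112 * K + 5` steps, and the call promises to leave `56 * K * |C| +
112 * K` of them. A leaf meets this with equality. At a branch the two calls together have two
surpluses of `112 * K`; one is passed on, and the other pays for the step itself and for the larger
promise, as the list here is longer by one than that of the call without `u`. -/
theorem call_correct (hL : Layout n L A lo) (hB : 16 + n + L ≤ B) (hβ : L + n ≤ β) (hK1 : 1 ≤ K)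
    (hK : ∀ v < n, (later n A v).length ≤ K) (hPB : P + 1 ≤ B)
    (hord : ∀ v : Fin n, ord (pos v) = v)
    (hA : ∀ u v : Fin n, A (pos u) (pos v) = true ↔ G.Adj u v) {S : Finset (Fin n)} (hS : S ≠ ∅)
    (C : List ℕ) (F : Finset ℕ) : CallCorrect B β L A lo ord K P G pos S C F := by
  obtain ⟨μ, hμ⟩ : ∃ μ, C.length + 2 * F.card = μ := ⟨_, rfl⟩
  induction μ using Nat.strong_induction_on generalizing S C F with
  | _ μ ih =>
    intro s h7 hs hf hl hsort hlt hCF hSX h6 hP hP'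
    cases C with
    | nil =>
      have h4 : s.reg 4 = n := hl
      have hw : Wp B β enumStep (fun t => Restored (s.reg 6) s t ∧ t.reg 7 = 1 ∧
          t.out = s.out ++ [Event.report] ∧ t.time = s.time + 5) s.tick := by
        rw [enumStep]
        refine wp_ite trivial (by simp; omega) (fun _ => ?_) (fun hc => by simp [h7] at hc)
        refine wp_ite trivial trivial (fun hc => by simp [h4, hs.num] at hc) (fun _ => ?_)
        rw [wp_seq, wp_report, wp_assign]
        refine ⟨by simp; omega, ⟨fun r hr => ?_, by simp, fun _ _ => rfl, fun _ _ _ _ _ => rfl,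
          fun _ _ _ _ _ => rfl, fun _ _ => rfl, rfl⟩, by simp, by simp, by simp⟩
        have : r ≠ 7 := by omega
        simp [this]
      obtain ⟨t, ht, h1, h2, h3, h4⟩ := iter_one (by omega) hw
      refine ⟨t, [S], _, ht, h1, h2, ?_, h3, ⟨by simp [reportedFrom], by simp [currentFrom]⟩, ?_⟩
      · have : rankSet pos [] = ∅ := by simp [rankSet]
        rw [this]
        exact .leaf S _
      · simp; omega
    | cons u C₀ =>
      obtain ⟨v, rfl⟩ : ∃ v, (pos v : ℕ) = u := ⟨pos.symm ⟨u, hlt u (by simp)⟩, by simp⟩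
      have h4 : s.reg 4 = pos v := hl.1
      have hun := (pos v).2
      have huF := hCF _ (List.mem_cons_self ..)
      have hsort' := List.pairwise_cons.1 hsort
      have huC : (pos v : ℕ) ∉ C₀ := fun hc => lt_irrefl _ (hsort'.1 _ hc)
      have hvS : v ∉ S := fun hc => (hSX v hc).1 (by simp)
      simp only [List.length_cons] at hP hP' hμ
      have hw : Wp B β enumStep (fun t => t = (((((s.tick.tick.tick).setFld 7 (s.reg 6) (pos v)).setFld 8
          (s.reg 6) 0).setReg 6 (s.reg 6 + 1)).setReg 4 (s.fld 1 (pos v)))) s.tick := by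
        rw [enumStep]
        refine wp_ite trivial (by simp; omega) (fun _ => ?_) (fun hc => by simp [h7] at hc)
        refine wp_ite trivial trivial (fun _ => ?_) (fun hc => by simp [h4, hs.num] at hc)
        simp only [wp_seq, wp_store, wp_assign, Expr.Ok, Expr.eval, HState.setFld_reg,
          HState.setReg_reg, HState.tick_reg, HState.setFld_fld, HState.setReg_fld, HState.tick_fld,
          Nat.reduceEqDiff, if_false, h4]
        refine ⟨⟨by omega, trivial, trivial, by omega⟩, ⟨by omega, trivial, by omega, by omega⟩,
          ⟨trivial, by omega, by omega⟩, ⟨by omega, trivial, by omega⟩, trivial⟩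
      obtain ⟨t1, y1, ht1⟩ := iter_one (by omega) hw
      have g7 : t1.reg 7 = 0 := by simp [ht1, h7]
      have g6 : t1.reg 6 = s.reg 6 + 1 := by simp [ht1]
      have g4 : t1.reg 4 = s.fld 1 (pos v) := by simp [ht1]
      have gr : ∀ r, r ≠ 4 → r ≠ 6 → t1.reg r = s.reg r := by
        intro r h3 h5; simp [ht1, h3, h5]
      have gf : ∀ k, k ≠ 7 → k ≠ 8 → t1.fld k = s.fld k := by
        intro k h3 h5; simp [ht1, h3, h5]
      have gf7 : t1.fld 7 = Function.update (s.fld 7) (s.reg 6) (pos v) := by simp [ht1]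
      have gf8 : t1.fld 8 = Function.update (s.fld 8) (s.reg 6) 0 := by simp [ht1]
      have go : t1.out = s.out := by simp [ht1]
      have gw : t1.raw = s.raw := by simp [ht1]
      have gt : t1.time = s.time + 7 := by simp [ht1]
      have hseg : Seg (s.fld 1) (pos v) C₀ n := hl.2
      have hs1 : Static n L A lo ord t1 := by
        refine hs.congr ?_ ?_ ?_ ?_ ?_ ?_ <;> simp [ht1]
      have hf1 : Fresh n A lo F t1 := by
        refine hf.congr ?_ ?_ ?_ ?_ <;> simp [ht1]
      have hSX' : ∀ w ∈ S, (pos w : ℕ) ∉ C₀ ∧ (pos w : ℕ) ∉ F := fun w hw =>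
        ⟨fun hc => (hSX w hw).1 (List.mem_cons_of_mem _ hc), (hSX w hw).2⟩
      have hCF' : ∀ x ∈ C₀, x ∉ F := fun x hx => hCF x (List.mem_cons_of_mem _ hx)
      have hlt' : ∀ x ∈ C₀, x < n := fun x hx => hlt x (List.mem_cons_of_mem _ hx)
      obtain ⟨t2, L₁, ev₁, y2, hk2, d7, dise, dout, drep, dtm⟩ := ih _ (by omega) hS C₀ F rfl t1 g7 hs1
        hf1 (by rw [g4, gf 1 (by simp) (by simp)]; exact hseg.linked) hsort'.2 hlt' hCF' hSX'
        (by omega) (by rw [gr 5 (by simp) (by simp)]; omega) (by omega)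
      rw [g6] at hk2
      have e5 : t2.reg 5 = s.reg 5 := by rw [hk2.reg 5 (by simp), gr 5 (by simp) (by simp)]
      obtain ⟨t3, L₂, ev₂, C, F', y3, hk3, j7, jise, jmem, jset, jout, jrep, jtm⟩ :=
        return_correct (B := B) (β := β) (G := G) (sp := s.reg 6) hL hB hβ hK1 hK hPB hord
          (S := S) (v := v) (C₀ := C₀) (F := F)
          (fun C F' hlt => ih _ (by omega) (Finset.insert_nonempty _ _).ne_empty C F' rfl) d7
          (hk2.static hs1) (hk2.fresh hf1) hk2.stack
          (by rw [hk2.frames 7 (by simp) (by simp) _ (by omega), gf7, Function.update_self])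
          (by rw [hk2.frames 8 (by simp) (by simp) _ (by omega), gf8, Function.update_self])
          (by rw [hk2.data 1 (by simp), gf 1 (by simp) (by simp)]; exact hseg) hsort hlt' hCF hSX' hvS
          (by rw [e5]; omega) (by omega)
      refine ⟨t3, L₁ ++ L₂, ev₁ ++ ev₂, y1.trans (y2.trans y3), ⟨fun r hr => ?_, hk3.stack,
        fun k hk => ?_, fun k hk hk' i hi => ?_, fun k hk hk' i hi => ?_, fun k hk => ?_, ?_⟩, j7,
        ?_, ?_, drep.append jrep, ?_⟩
      · rw [hk3.reg r hr, hk2.reg r hr, gr r (by omega) (by omega)]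
      · rw [hk3.data k hk, hk2.data k hk, gf k (by omega) (by omega)]
      · rw [hk3.trail k hk hk' i (by omega), hk2.trail k hk hk' i (by rw [gr 5 (by simp) (by simp)]; exact hi),
          gf k (by omega) (by omega)]
      · rw [hk3.frames k hk hk' i hi, hk2.frames k hk hk' i (by omega)]
        have : i ≠ s.reg 6 := by omega
        obtain rfl | rfl : k = 7 ∨ k = 8 := by omega
        · rw [gf7, Function.update_of_ne this]
        · rw [gf8, Function.update_of_ne this]
      · rw [hk3.const k hk, hk2.const k hk, gf k (by omega) (by omega)]
      · rw [hk3.raw, hk2.raw, gw]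
      · refine .branch S _ _ v L₁ L₂ (by simp [rankSet]) (fun w hw => ?_) ?_ ?_
        · simp only [rankSet, Finset.mem_filter, Finset.mem_univ, true_and, List.mem_cons] at hw
          rcases hw with hw | hw
          · exact (Fin.ext hw).ge
          · exact (hsort'.1 _ hw).le
        · convert dise using 1
          · exact @erase_rankSet _ _ (fun _ _ => Classical.propDecidable _) _ _ huC
          · exact @insert_restSet _ _ (fun _ _ => Classical.propDecidable _) _ _ _ huC huF
        · convert jise using 1
          · ext w; simp
          · exact newCand_eq hA hS hsort'.1 hCF' huF jmem
          · exact newForbidden_eq hA hS hsort'.1 hCF' huF jmem jset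
      · rw [jout, dout, go, List.append_assoc]
      -- What remains is `7 + (31 * K + 17) + 56 * K ≤ 112 * K`, which holds since `1 ≤ K`.
      · simp only [List.length_append, List.length_cons]
        rw [Nat.mul_add, Nat.mul_add]
        omega

end Main

end InducedSubtrees

namespace InducedSubtrees

/-! ### Inserting a vertex into the lists -/

/-- Insert the vertex in register `2` into the lists of its later neighbours. -/
def freshen : HProg :=
  .store (.const 0) (rg 2) (.const 1) ;; .assign 10 (arr 9 (rg 2)) ;;
  .while (rg 10) (arr 10 (rg 2))
    (.store (.const 12) (rg 10) (rg 2) ;; .assign 11 (arr 11 (rg 10)) ;;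
     .assign 9 (.add (rg 0) (rg 10)) ;; .store (.const 2) (rg 9) (arr 2 (rg 11)) ;;
     .store (.const 3) (rg 9) (rg 11) ;; .store (.const 3) (arr 2 (rg 11)) (rg 9) ;;
     .store (.const 2) (rg 11) (rg 9) ;; .assign 10 (.add (rg 10) (.const 1)))

variable {n L B β : ℕ} {A : ℕ → ℕ → Bool} {lo ord : ℕ → ℕ} {F : Finset ℕ} {K P : ℕ}

/-- The new vertex is smaller than all fresh ones, so its entry belongs at the front, and insertion
right after the header keeps the list sorted. -/
theorem earlierIn_insert {r w : ℕ} (hF : ∀ x ∈ F, r < x) (hw : r < w) (hA : A r w = true) :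
    earlierIn A (insert r F) w = r :: earlierIn A F w := by
  refine List.Pairwise.eq_of_mem_iff (r := (· < ·)) (earlierIn_sorted w)
    (List.pairwise_cons.2 ⟨fun x hx => hF x (mem_earlierIn.1 hx).2.1, earlierIn_sorted w⟩) fun x => ?_
  rw [List.mem_cons, mem_earlierIn, mem_earlierIn, Finset.mem_insert]
  constructor
  · rintro ⟨h1, h2 | h2, h3⟩
    · exact Or.inl h2
    · exact Or.inr ⟨h1, h2, h3⟩
  · rintro (rfl | ⟨h1, h2, h3⟩)
    · exact ⟨hw, Or.inl rfl, hA⟩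
    · exact ⟨h1, Or.inr h2, h3⟩

theorem earlierIn_insert_of_notMem {r w : ℕ} (hw : ¬ (r < w ∧ A r w = true)) :
    earlierIn A (insert r F) w = earlierIn A F w := by
  refine List.Pairwise.eq_of_mem_iff (r := (· < ·)) (earlierIn_sorted w) (earlierIn_sorted w)
    fun x => ?_
  rw [mem_earlierIn, mem_earlierIn, Finset.mem_insert]
  constructor
  · rintro ⟨h1, rfl | h2, h3⟩
    · exact absurd ⟨h1, h3⟩ hw
    · exact ⟨h1, h2, h3⟩
  · rintro ⟨h1, h2, h3⟩
    exact ⟨h1, Or.inr h2, h3⟩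

theorem fam_insert_take (hL : Layout n L A lo) {nx pv : ℕ → ℕ} {r i : ℕ} (hr : r < n)
    (hF : ∀ x ∈ F, r < x ∧ x < n) (hi : i < (later n A r).length)
    (h : Fam nx pv n fun w => (earlierIn A
      (if w ∈ (later n A r).take i then insert r F else F) w).map (cell n A lo w)) {w c : ℕ}
    (hw : w = (later n A r)[i]) (hc : c = n + (lo r + i)) :
    Fam (Function.update (Function.update nx c (nx w)) w c)
      (Function.update (Function.update pv c w) (nx w) c) n fun w => (earlierIn A
        (if w ∈ (later n A r).take (i + 1) then insert r F else F) w).map (cell n A lo w) := by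
  have hwl : w ∈ later n A r := hw ▸ List.getElem_mem hi
  obtain ⟨hwn, hrw, hA⟩ := mem_later.1 hwl
  have hidx : ∀ j (hj : j < (later n A r).length), (later n A r)[j] = w → j = i := by
    intro j hj hj'
    rw [hw] at hj'
    exact (later_nodup (n := n) (A := A) r).getElem_inj_iff.1 hj'
  have hwt : w ∉ (later n A r).take i := by
    intro hc
    obtain ⟨j, hj, hj'⟩ := List.mem_take_iff_getElem.1 hc
    have := hidx j (by omega) hj'
    omega
  have hcell : cell n A lo w r = c := by rw [hw, hc]; exact cell_getElem hi
  refine (h.insert hwn (c := c) (by omega) fun w' hw' hc' => ?_).congr fun w' hw' => ?_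
  · obtain ⟨v, hv, hv'⟩ := List.mem_map.1 hc'
    obtain ⟨h1, h2, h3⟩ := mem_earlierIn.1 hv
    have hvn : v < n := by omega
    obtain ⟨rfl, rfl⟩ := cell_inj hL hvn hr (mem_later.2 ⟨hw', h1, h3⟩) hwl (hv'.trans hcell.symm)
    rw [if_neg hwt] at h2
    exact lt_irrefl _ (hF v h2).1
  · have htake : w' ∈ (later n A r).take (i + 1) ↔ w' ∈ (later n A r).take i ∨ w' = w := by
      rw [List.take_add_one, List.getElem?_eq_getElem hi, ← hw, List.mem_append]
      simp only [Option.toList, List.mem_singleton]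
    by_cases hww : w' = w
    · subst hww
      rw [if_pos (htake.2 (Or.inr rfl)), Function.update_self, if_neg hwt,
        earlierIn_insert (fun x hx => (hF x hx).1) hrw hA, List.map_cons, hcell]
    · rw [Function.update_of_ne hww]
      simp only [htake, hww, or_false]

/-- The writes are not logged: they are made between the roots and are never undone. Because the
roots are treated in decreasing order, `r` is below all of `F`. -/
theorem freshen_exec (hL : Layout n L A lo) (hB : 16 + n + L ≤ B) {r : ℕ} {s : HState}
    (hs : Static n L A lo ord s) (hf : Fresh n A lo F s) (h2 : s.reg 2 = r) (hr : r < n)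
    (hF : ∀ x ∈ F, r < x) :
    ∃ t, HExec B β freshen s t ∧ Fresh n A lo (insert r F) t ∧
      t.time = s.time + 3 + 9 * (later n A r).length := by
  have hbd := hL.bound r hr
  change Wp B β _ _ s
  rw [freshen, wp_seq, wp_store]
  refine ⟨by simp; omega, ?_⟩
  rw [wp_seq, wp_assign]
  refine ⟨by simp; omega, ?_⟩
  refine wp_while (fun j t => ∃ i, i + j = (later n A r).length ∧ t.reg 10 = lo r + i ∧
    t.reg 2 = r ∧ t.reg 0 = n ∧ (∀ k, 9 ≤ k → k ≠ 12 → t.fld k = s.fld k) ∧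
    t.fld 0 = Function.update (s.fld 0) r 1 ∧
    (∀ x, x < lo r ∨ lo r + (later n A r).length ≤ x → t.fld 12 x = s.fld 12 x) ∧
    (∀ j < i, t.fld 12 (lo r + j) = r) ∧ t.time = s.time + 2 + 9 * i ∧
    Fam (t.fld 2) (t.fld 3) n fun w => (earlierIn A
      (if w ∈ (later n A r).take i then insert r F else F) w).map (cell n A lo w))
    (later n A r).length ⟨0, ?_⟩ ?_ ?_ ?_
  · refine ⟨by omega, by simp [h2, hs.first r hr], by simp [h2], by simp [hs.num],
      fun k hk hk' => ?_, by simp [h2], fun x _ => by simp, by simp, by simp, by simpa using hf.fam⟩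
    simp [show k ≠ 0 by omega]
  · intros; simp; omega
  · rintro j t ⟨i, hij, h10, h2', h0, h9, hfl, hout, hin, htm, hfam⟩ hlt
    simp only [Expr.eval, h10, h2', h9 10 (by decide) (by decide), hs.last r hr] at hlt
    have hi : i < (later n A r).length := by omega
    have htgt : t.fld 11 (lo r + i) = (later n A r)[i] := by
      rw [h9 11 (by decide) (by decide), hs.tgt r hr i hi]
    have hwl : (later n A r)[i] ∈ later n A r := List.getElem_mem hi
    have hwn := (mem_later.1 hwl).1
    have hfam' := fam_insert_take hL hr (fun x hx => ⟨hF x hx, hf.lt x hx⟩) hi hfam rfl rfl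
    simp only [wp_seq, wp_store, wp_assign, Expr.Ok, Expr.eval, HState.setFld_reg,
      HState.setReg_reg, HState.tick_reg, HState.setFld_fld, HState.setReg_fld, HState.tick_fld,
      Nat.reduceEqDiff, if_false, if_true, h10, h2', h0, htgt]
    generalize hw : (later n A r)[i] = w at *
    -- The header `w` is not the new cell, so the pointer of `w` is still the old one when it is
    -- read for the second time.
    have hne : w ≠ n + (lo r + i) := by omega
    simp only [Function.update_of_ne hne]
    refine ⟨by simp; omega, by simp; omega, by simp; omega, by simp; omega, by simp; omega,
      by simp; omega, by simp; omega, by simp; omega, j - 1, by omega, i + 1, by omega, by omega,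
      by simp, by simp, fun k hk hk' => ?_, by simp [hfl], fun x hx => ?_, fun j hj => ?_, ?_, ?_⟩
    · simp [show k ≠ 2 by omega, show k ≠ 3 by omega, hk', h9 k hk hk']
    · simp [Function.update_of_ne (show x ≠ lo r + i by omega), hout x hx]
    · by_cases hji : j = i
      · simp [hji]
      · simp [Function.update_of_ne (show lo r + j ≠ lo r + i by omega), hin j (by omega)]
    · simp [htm]; omega
    · simpa using hfam'
  · rintro j t ⟨i, hij, h10, h2', h0, h9, hfl, hout, hin, htm, hfam⟩ hlt
    simp only [Expr.eval, h10, h2', h9 10 (by decide) (by decide), hs.last r hr] at hlt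
    have hi : i = (later n A r).length := by omega
    subst hi
    refine ⟨⟨fun v hv => ?_, fun v hv => ?_, ?_, fun v hv j hj => ?_⟩, by simp [htm]; omega⟩
    · rcases Finset.mem_insert.1 hv with rfl | hv
      · exact hr
      · exact hf.lt v hv
    · simp only [HState.tick_fld, hfl, Function.update_apply, hf.flag v hv, Finset.mem_insert]
      by_cases hvr : v = r <;> simp [hvr]
    · refine hfam.congr fun w hw => ?_
      rw [List.take_length]
      split
      · rfl
      · rename_i hwl
        rw [earlierIn_insert_of_notMem]
        rintro ⟨h2, h3⟩
        exact hwl (mem_later.2 ⟨hw, h2, h3⟩)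
    · simp only [HState.tick_fld]
      by_cases hvr : v = r
      · subst hvr; exact hin j hj
      · have hvF : v ∈ F := (Finset.mem_insert.1 hv).resolve_left hvr
        have := hL.sep v (hf.lt v hvF) r hr hvr
        rw [hout _ (by omega)]
        exact hf.src v hvF j hj

/-! ### The enumeration -/

/-- Report the trees that contain the next vertex and only later vertices otherwise. -/
def rootStep : HProg :=
  .assign 2 (.sub (rg 2) (.const 1)) ;; .store (.const 1) (rg 2) (rg 0) ;;
  .store (.const 7) (.const 0) (rg 2) ;; .store (.const 8) (.const 0) (.const 0) ;;
  .assign 6 (.const 1) ;; .assign 7 (.const 1) ;; .while (.const 0) (rg 6) enumStep ;; freshen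

/-- Enumerate all induced subtrees. -/
def enumerate : HProg :=
  .assign 5 (.const 0) ;; .report ;; .assign 2 (rg 0) ;; .while (.const 0) (rg 2) rootStep

section Enumerate

variable {G : SimpleGraph (Fin n)} {pos : Fin n ≃ Fin n}

/-- The state of the enumeration in which `r` is the smallest vertex that has been treated. -/
structure Enumerated (L : ℕ) (A : ℕ → ℕ → Bool) (lo ord : ℕ → ℕ) (K : ℕ) (G : SimpleGraph (Fin n))
    (pos : Fin n ≃ Fin n) (s₀ : HState) (r : ℕ) (t : HState) : Prop where
  le : r ≤ n
  root : t.reg 2 = r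
  trail : t.reg 5 = 0
  static : Static n L A lo ord t
  fresh : Fresh n A lo (Finset.Ico r n) t
  run : ∃ Ls ev, ISE G pos ∅ (Finset.univ.filter fun v => r ≤ pos v)
    (Finset.univ.filter fun v => (pos v : ℕ) < r) Ls ∧ t.out = s₀.out ++ ev ∧ Reports ∅ ev Ls ∧
    t.time ≤ s₀.time + (112 * K + 5) * Ls.length

/-- With the empty set the procedure excludes all vertices, reports the empty set, and then includes
the vertices in decreasing order while the calls return. The step for `r` is thus the second half of
a branch: an artificial frame is placed on the stack, with no candidates after `r`, and
`return_correct` applies with `S = ∅`. All vertices after `r` are declared fresh instead of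
candidates, which yields exactly the special definition of the new candidates for `S = ∅`, where
neighbours of `r` remain addible. -/
theorem rootStep_wp (hL : Layout n L A lo) (hB : 16 + n + L ≤ B) (hβ : L + n ≤ β) (hK1 : 1 ≤ K)
    (hK : ∀ v < n, (later n A v).length ≤ K) (hPB : P + 1 ≤ B)
    (hord : ∀ v : Fin n, ord (pos v) = v)
    (hA : ∀ u v : Fin n, A (pos u) (pos v) = true ↔ G.Adj u v)
    (hP : pot n A (Finset.range n) + n + 1 ≤ P) {s₀ s : HState} {r : ℕ}
    (hs : Enumerated L A lo ord K G pos s₀ (r + 1) s) :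
    Wp B β rootStep (Enumerated L A lo ord K G pos s₀ r) s.tick := by
  have hrn : r < n := hs.le
  obtain ⟨v, hv⟩ : ∃ v, (pos v : ℕ) = r := ⟨pos.symm ⟨r, hrn⟩, by simp⟩
  obtain ⟨Ls, ev, hise, hout, hrep, htm⟩ := hs.run
  have hsub : Finset.Ico (r + 1) n ⊆ Finset.range n := fun x hx => by simp at hx ⊢; omega
  have hpot : pot n A (Finset.Ico (r + 1) n) ≤ pot n A (Finset.range n) :=
    Finset.sum_le_sum_of_subset hsub
  have hcard := Finset.card_le_card hsub
  rw [Finset.card_range] at hcard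
  have h0 := hs.static.num
  have h2 := hs.root
  rw [rootStep]
  simp only [wp_seq, wp_store, wp_assign, Expr.Ok, Expr.eval, HState.setFld_reg,
    HState.setReg_reg, HState.tick_reg, Nat.reduceEqDiff, if_false, if_true, h2, h0, Nat.add_sub_cancel]
  refine ⟨by simp; omega, by simp; omega, by simp; omega, by simp; omega, by omega, by omega, ?_⟩
  generalize ht1 : HState.setReg _ 7 1 = t1
  have hst : Static n L A lo ord t1 := by
    refine hs.static.congr ?_ ?_ ?_ ?_ ?_ ?_ <;> simp [← ht1]
  have hfr : Fresh n A lo (Finset.Ico (r + 1) n) t1 := by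
    refine hs.fresh.congr ?_ ?_ ?_ ?_ <;> simp [← ht1]
  obtain ⟨t2, Ls', ev', C, F', y2, hk2, -, dise, dmem, dset, dout, drep, dtm⟩ :=
    return_correct (B := B) (β := β) (P := P) (G := G) (S := ∅) (v := v) (C₀ := [])
      (F := Finset.Ico (r + 1) n) (s := t1) (sp := 0) hL hB hβ hK1 hK hPB hord
      (fun C F' _ => call_correct hL hB hβ hK1 hK hPB hord hA (Finset.insert_nonempty _ _).ne_empty C F')
      (by simp [← ht1]) hst hfr (by simp [← ht1]) (by simp [← ht1, hv]) (by simp [← ht1])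
      (by simp [← ht1, hv, Seg]) (by simp) (by simp) (by simp [hv]) (by simp) (by simp)
      (by simp [← ht1, hs.trail]; omega) (by simp; simp at hcard; omega)
  have hx : HExec B β (.while (.const 0) (rg 6) enumStep) t1 t2.tick :=
    y2.exec (by simp) trivial (by simp [hk2.stack])
  have hst2 : Static n L A lo ord t2.tick := (hk2.static hst).congr rfl rfl rfl rfl rfl rfl
  obtain ⟨t3, x3, hfr3, htm3⟩ := freshen_exec (B := B) (β := β) (r := r) hL hB hst2
    ((hk2.fresh hfr).congr rfl rfl rfl rfl) (by simp [hk2.reg 2, ← ht1]) hrn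
    (fun x hx => by simp at hx; omega)
  refine ⟨t2.tick, hx, t3, x3, hrn.le, ?_, ?_, hst2.exec x3 rfl, ?_, Ls ++ Ls', ev ++ ev', ?_, ?_,
    hrep.append drep, ?_⟩
  · rw [x3.reg_eq (r := 2) rfl]; simp [hk2.reg 2, ← ht1]
  · rw [x3.reg_eq (r := 5) rfl]; simp [hk2.reg 5, ← ht1, hs.trail]
  · rwa [Finset.insert_Ico_add_one_left_eq_Ico hrn] at hfr3
  · have hpne : ∀ w : Fin n, w ≠ v → (pos w : ℕ) ≠ r := fun w h he =>
      h (pos.injective (Fin.ext (he.trans hv.symm)))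
    have hadj : ∀ w : Fin n, RankAdj n A (pos v) (pos w) ↔ G.Adj v w := rankAdj_iff hA v
    refine .branch ∅ _ _ v Ls Ls' (by simp [hv]) (fun w hw => ?_) ?_ ?_
    · simp only [Finset.mem_filter, Finset.mem_univ, true_and] at hw
      exact Fin.le_def.2 (by omega)
    · convert hise using 1
      · ext w
        simp only [Finset.mem_erase, Finset.mem_filter, Finset.mem_univ, true_and]
        by_cases hwv : w = v
        · subst hwv; simp; omega
        · have := hpne w hwv
          simp only [ne_eq, hwv, not_false_eq_true, true_and]; omega
      · ext w
        simp only [Finset.mem_insert, Finset.mem_filter, Finset.mem_univ, true_and]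
        by_cases hwv : w = v
        · subst hwv; simp; omega
        · have := hpne w hwv
          simp only [hwv, false_or]; omega
    · convert dise using 1
      · ext w; simp
      · ext w
        rw [mem_newCand, if_pos rfl]
        simp only [rankSet, Finset.mem_filter, Finset.mem_univ, true_and, dmem, hadj,
          List.not_mem_nil, false_and, false_or, Finset.mem_Ico, (pos w).2, and_true]
        by_cases hwv : w = v
        · subst hwv; simp
        · have := hpne w hwv
          rw [and_comm]; refine and_congr_left fun _ => ?_
          omega
      · ext w
        rw [mem_newForbidden]
        simp only [restSet, Finset.mem_filter, Finset.mem_univ, true_and, dmem, dset, hadj,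
          List.not_mem_nil, false_and, false_or, Finset.mem_Ico, (pos w).2, and_true, ne_eq,
          not_true_eq_false, or_false]
        by_cases hwv : w = v
        · subst hwv; simp [hv]
        · have := hpne w hwv
          simp only [hwv, false_or]
          by_cases hG : G.Adj v w
          · simp only [hG, and_true, not_true_eq_false, and_false, not_false_eq_true]; omega
          · simp only [hG, and_false, not_false_eq_true, and_true, true_and]; omega
  · rw [x3.out_eq rfl, HState.tick_out, dout, ← List.append_assoc, ← hout]
    simp [← ht1]
  · have hlen := hK r hrn
    have ht1t : t1.time = s.time + 7 := by simp [← ht1]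
    rw [List.length_append, Nat.mul_add, htm3, HState.tick_time]
    omega

theorem enumerate_exec (hL : Layout n L A lo) (hB : 16 + n + L ≤ B) (hβ : L + n ≤ β)
    (hK1 : 1 ≤ K) (hK : ∀ v < n, (later n A v).length ≤ K) (hPB : P + 1 ≤ B)
    (hord : ∀ v : Fin n, ord (pos v) = v)
    (hA : ∀ u v : Fin n, A (pos u) (pos v) = true ↔ G.Adj u v)
    (hP : pot n A (Finset.range n) + n + 1 ≤ P) {s : HState} (hs : Static n L A lo ord s)
    (hf : Fresh n A lo ∅ s) :
    ∃ t Ls ev, HExec B β enumerate s t ∧ ISE G pos ∅ Finset.univ ∅ Ls ∧ t.out = s.out ++ ev ∧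
      Reports ∅ ev Ls ∧ t.time ≤ s.time + 1 + (112 * K + 5) * Ls.length := by
  have h : Wp B β enumerate (fun t => ∃ Ls ev, ISE G pos ∅ Finset.univ ∅ Ls ∧ t.out = s.out ++ ev ∧
      Reports ∅ ev Ls ∧ t.time ≤ s.time + 1 + (112 * K + 5) * Ls.length) s := by
    rw [enumerate]
    simp only [wp_seq, wp_assign, wp_report, Expr.Ok]
    refine ⟨by omega, trivial, wp_while (fun r t => Enumerated L A lo ord K G pos s r t) n ?_ ?_ ?_ ?_⟩
    · refine ⟨le_rfl, by simp [hs.num], by simp, ?_, ?_, [∅], [Event.report], ?_, by simp, ?_, ?_⟩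
      · refine hs.congr ?_ ?_ ?_ ?_ ?_ ?_ <;> simp
      · rw [Finset.Ico_self]
        refine hf.congr ?_ ?_ ?_ ?_ <;> simp
      · convert ISE.leaf (G := G) (pos := pos) ∅ _ using 1
        ext w; simp
      · exact ⟨by simp [reportedFrom], by simp [currentFrom]⟩
      · simp; omega
    · intros; simp
    · intro r t ht hlt
      simp only [Expr.eval, ht.root] at hlt
      obtain ⟨r, rfl⟩ : ∃ r', r = r' + 1 := ⟨r - 1, by omega⟩
      exact (rootStep_wp hL hB hβ hK1 hK hPB hord hA hP ht).mono fun t ht' => ⟨r, by omega, ht'⟩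
    · intro r t ht hlt
      simp only [Expr.eval, ht.root] at hlt
      obtain rfl : r = 0 := by omega
      obtain ⟨Ls, ev, hise, hout, hrep, htm⟩ := ht.run
      refine ⟨Ls, ev, ?_, hout, hrep, by simp; omega⟩
      convert hise using 1
      · ext w; simp
      · ext w; simp
  obtain ⟨t, ht, Ls, ev, h1, h2, h3, h4⟩ := h
  exact ⟨t, Ls, ev, ht, h1, h2, h3, h4⟩

end Enumerate

end InducedSubtrees

namespace InducedSubtrees

/-! ## Preprocessing

Vertices of the input are bucketed by the number of neighbours that are left, and moved one after
the other from the bucket structure to the ordering. -/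

/-- `st v` is the address of the adjacency list `nb v` in an input of length `L`. -/
structure AdjBlocks (n L : ℕ) (st : ℕ → ℕ) (nb : ℕ → List ℕ) : Prop where
  zero : st 0 = n + 2
  succ : ∀ v < n, st (v + 1) = st v + (nb v).length
  total : st n = L
  lt : ∀ v < n, ∀ w ∈ nb v, w < n
  symm : ∀ v < n, ∀ w ∈ nb v, v ∈ nb w
  irrefl : ∀ v, v ∉ nb v
  nodup : ∀ v < n, (nb v).Nodup

/-- The neighbours of `w` in `os`, in the order of `os`. -/
def prev (nb : ℕ → List ℕ) (os : List ℕ) (w : ℕ) : List ℕ := os.filter fun v => decide (v ∈ nb w)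

/-- The neighbours of `w` outside `os`. -/
def left (nb : ℕ → List ℕ) (os : List ℕ) (w : ℕ) : List ℕ :=
  (nb w).filter fun v => decide (v ∉ os)

/-- In the doubly linked list of number `d` are the vertices of `U` with `d` neighbours left. -/
def Buckets (n : ℕ) (U : ℕ → Prop) (s : HState) : Prop :=
  ∃ ls, Fam (s.fld 2) (s.fld 3) n ls ∧
    ∀ d < n, ∀ c, c ∈ ls d ↔ ∃ w < n, U w ∧ s.fld 13 w = d ∧ c = n + w

/-- Remove the cell in register `9` from its list. -/
def unlinkCell : HProg :=
  .store (.const 2) (arr 3 (rg 9)) (arr 2 (rg 9)) ;; .store (.const 3) (arr 2 (rg 9)) (arr 3 (rg 9))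

/-- Insert the cell in register `9` into the list with the number in register `8`. -/
def linkCell : HProg :=
  .store (.const 2) (rg 9) (arr 2 (rg 8)) ;; .store (.const 3) (rg 9) (rg 8) ;;
  .store (.const 3) (arr 2 (rg 8)) (rg 9) ;; .store (.const 2) (rg 8) (rg 9)

/-- Decrease the number of neighbours left for the vertex in register `11`. -/
def lower : HProg :=
  .assign 9 (.add (rg 0) (rg 11)) ;; unlinkCell ;;
  .store (.const 13) (rg 11) (.sub (arr 13 (rg 11)) (.const 1)) ;;
  .assign 8 (arr 13 (rg 11)) ;; linkCell

/-- Append the vertex in register `3` to the sorted list of its neighbour in cell `10`. -/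
def sortEdge : HProg :=
  .assign 11 (.raw (rg 10)) ;; .assign 12 (arr 14 (rg 11)) ;;
  .storeRaw (.add (rg 1) (rg 12)) (rg 3) ;; .store (.const 11) (rg 12) (rg 2) ;;
  .store (.const 14) (rg 11) (.add (rg 12) (.const 1)) ;;
  .ite (arr 15 (rg 11)) (.const 1) lower .skip ;; .assign 10 (.add (rg 10) (.const 1))

section Lists

variable {n L : ℕ} {st : ℕ → ℕ} {nb : ℕ → List ℕ}

theorem AdjBlocks.add_le (h : AdjBlocks n L st nb) {v w : ℕ} (hvw : v < w)
    (hw : w ≤ n) : st v + (nb v).length ≤ st w := by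
  induction w with
  | zero => omega
  | succ w ih =>
    rw [h.succ w (by omega)]
    by_cases hvw' : v = w
    · subst hvw'; exact le_rfl
    · have := ih (by omega) (by omega); omega

theorem AdjBlocks.bound (h : AdjBlocks n L st nb) {v : ℕ} (hv : v < n) :
    st v + (nb v).length ≤ L := h.total ▸ h.add_le hv le_rfl

theorem AdjBlocks.ge (h : AdjBlocks n L st nb) {v : ℕ} (hv : v ≤ n) : n + 2 ≤ st v := by
  cases v with
  | zero => exact h.zero.ge
  | succ v =>
    have := h.add_le (v := 0) (w := v + 1) (by omega) hv
    rw [h.zero] at this; omega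

theorem AdjBlocks.sep (h : AdjBlocks n L st nb) {v w : ℕ} (hv : v < n) (hw : w < n) (hvw : v ≠ w) :
    st v + (nb v).length ≤ st w ∨ st w + (nb w).length ≤ st v := by
  rcases lt_or_gt_of_ne hvw with h1 | h1
  · exact Or.inl (h.add_le h1 hw.le)
  · exact Or.inr (h.add_le h1 hv.le)

theorem AdjBlocks.length_lt (h : AdjBlocks n L st nb) {v : ℕ} (hv : v < n) :
    (nb v).length < n := by
  have h1 : (nb v).toFinset ⊆ (Finset.range n).erase v := by
    intro w hw
    rw [List.mem_toFinset] at hw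
    refine Finset.mem_erase.2 ⟨fun he => h.irrefl v (he ▸ hw), Finset.mem_range.2 (h.lt v hv w hw)⟩
  have h2 := Finset.card_le_card h1
  rw [List.toFinset_card_of_nodup (h.nodup v hv), Finset.card_erase_of_mem (Finset.mem_range.2 hv),
    Finset.card_range] at h2
  omega

/-- A partially sorted list never outgrows the block reserved for it. -/
theorem prev_length_le {os : List ℕ} (hos : os.Nodup) (w : ℕ) :
    (prev nb os w).length ≤ (nb w).length := by
  have h : prev nb os w ⊆ nb w := fun v hv => by
    simp only [prev, List.mem_filter, decide_eq_true_eq] at hv; exact hv.2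
  exact (List.subperm_of_subset (hos.filter _) h).length_le

theorem prev_append_of_mem {os : List ℕ} {v w : ℕ} (hv : v ∈ nb w) :
    prev nb (os ++ [v]) w = prev nb os w ++ [v] := by
  simp [prev, List.filter_append, hv]

theorem prev_append_of_notMem {os : List ℕ} {v w : ℕ} (hv : v ∉ nb w) :
    prev nb (os ++ [v]) w = prev nb os w := by
  simp [prev, List.filter_append, hv]

theorem left_append (os : List ℕ) (v w : ℕ) :
    left nb (os ++ [v]) w = (left nb os w).filter fun x => decide (x ≠ v) := by
  rw [left, left, List.filter_filter]
  refine List.filter_congr fun x _ => ?_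
  by_cases h1 : x = v <;> by_cases h2 : x ∈ os <;> simp [h1, h2]

theorem left_append_of_notMem {os : List ℕ} {v w : ℕ} (hv : v ∉ nb w) :
    left nb (os ++ [v]) w = left nb os w := by
  rw [left_append, List.filter_eq_self]
  intro x hx
  simp only [decide_eq_true_eq]
  rintro rfl
  exact hv (List.mem_of_mem_filter hx)

theorem left_append_of_mem (h : AdjBlocks n L st nb) {os : List ℕ} {v w : ℕ} (hw : w < n)
    (hv : v ∈ nb w) (hvo : v ∉ os) :
    (left nb (os ++ [v]) w).length + 1 = (left nb os w).length := by
  have h1 : v ∈ left nb os w := by simp [left, hv, hvo]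
  have h2 : (left nb os w).Nodup := (h.nodup w hw).filter _
  have h3 : left nb (os ++ [v]) w = (left nb os w).erase v := by
    rw [left_append, h2.erase_eq_filter]
    refine List.filter_congr fun x _ => ?_
    by_cases hx : x = v <;> simp [hx]
  rw [h3, List.length_erase_of_mem h1]
  have := List.length_pos_of_mem h1
  omega

end Lists

section Cells

variable {n B β : ℕ} {U : ℕ → Prop} {s t : HState} {w : ℕ}

theorem Buckets.congr (h : Buckets n U s) (h2 : t.fld 2 = s.fld 2) (h3 : t.fld 3 = s.fld 3)
    (h13 : ∀ w < n, U w → t.fld 13 w = s.fld 13 w) {U' : ℕ → Prop} (hU : ∀ w < n, (U' w ↔ U w)) :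
    Buckets n U' t := by
  obtain ⟨ls, h, hls⟩ := h
  refine ⟨ls, by rw [h2, h3]; exact h, fun d hd c => (hls d hd c).trans ?_⟩
  constructor
  · rintro ⟨w, hw, hu, hd, hc⟩
    exact ⟨w, hw, (hU w hw).2 hu, (h13 w hw hu).trans hd, hc⟩
  · rintro ⟨w, hw, hu, hd, hc⟩
    exact ⟨w, hw, (hU w hw).1 hu, ((h13 w hw ((hU w hw).1 hu))).symm.trans hd, hc⟩

theorem unlinkCell_exec (hB : 16 ≤ B) (h : Buckets n U s) (h9 : s.reg 9 = n + w) (hw : w < n) (hU : U w)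
    (hd : s.fld 13 w < n) : ∃ t, HExec B β unlinkCell s t ∧
      Buckets n (fun x => U x ∧ x ≠ w) t ∧ t.time = s.time + 2 := by
  obtain ⟨ls, h, hls⟩ := h
  have hmem : n + w ∈ ls (s.fld 13 w) := (hls _ hd _).2 ⟨w, hw, hU, rfl, rfl⟩
  have h1 := h.unlink hd hmem
  have h2 := h.pv_ne hd hmem
  change Wp B β _ _ s
  simp only [unlinkCell, wp_seq, wp_store, Expr.Ok, Expr.eval, HState.setFld_reg, HState.setFld_fld,
    Nat.reduceEqDiff, if_false, if_true, h9]
  rw [Function.update_of_ne h2.symm]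
  refine ⟨⟨by omega, ⟨by omega, trivial, by omega⟩, ⟨by omega, trivial, by omega⟩, by omega⟩, ⟨by omega, ⟨by omega, trivial, by omega⟩,
    ⟨by omega, trivial, by omega⟩, by omega⟩, ⟨_, by simpa using h1, fun d hd' c => ?_⟩, by simp⟩
  simp only [HState.setFld_fld, Nat.reduceEqDiff, if_false]
  by_cases hdd : d = s.fld 13 w
  · subst hdd
    rw [Function.update_self, (h.nodup _ hd).mem_erase_iff, hls _ hd]
    constructor
    · rintro ⟨h3, x, hx, hu, hdx, rfl⟩
      exact ⟨x, hx, ⟨hu, by omega⟩, hdx, rfl⟩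
    · rintro ⟨x, hx, ⟨hu, hne⟩, hdx, rfl⟩
      exact ⟨by omega, x, hx, hu, hdx, rfl⟩
  · rw [Function.update_of_ne hdd, hls _ hd']
    constructor
    · rintro ⟨x, hx, hu, hdx, rfl⟩
      exact ⟨x, hx, ⟨hu, by rintro rfl; exact hdd hdx.symm⟩, hdx, rfl⟩
    · rintro ⟨x, hx, ⟨hu, hne⟩, hdx, rfl⟩
      exact ⟨x, hx, hu, hdx, rfl⟩

theorem linkCell_exec (hB : 16 ≤ B) (h : Buckets n U s) (h9 : s.reg 9 = n + w) (hw : w < n) (hU : ¬ U w)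
    (h8 : s.reg 8 = s.fld 13 w) (hd : s.fld 13 w < n) : ∃ t, HExec B β linkCell s t ∧
      Buckets n (fun x => U x ∨ x = w) t ∧ t.time = s.time + 4 := by
  obtain ⟨ls, h, hls⟩ := h
  have h1 := h.insert hd (c := n + w) (by omega) fun d hd' hc => by
    obtain ⟨x, hx, hu, -, he⟩ := (hls d hd' _).1 hc
    obtain rfl : x = w := by omega
    exact hU hu
  have hne : s.fld 13 w ≠ n + w := by omega
  change Wp B β _ _ s
  simp only [linkCell, wp_seq, wp_store, Expr.Ok, Expr.eval, HState.setFld_reg, HState.setFld_fld,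
    Nat.reduceEqDiff, if_false, if_true, h9, h8]
  rw [Function.update_of_ne hne]
  refine ⟨⟨by omega, trivial, ⟨by omega, trivial, by omega⟩, by omega⟩,
    ⟨by omega, trivial, trivial, by omega⟩,
    ⟨by omega, ⟨by omega, trivial, by omega⟩, trivial, by omega⟩,
    ⟨by omega, trivial, trivial, by omega⟩, ⟨_, by simpa using h1, fun d hd' c => ?_⟩, by simp⟩
  simp only [HState.setFld_fld, Nat.reduceEqDiff, if_false]
  by_cases hdd : d = s.fld 13 w
  · subst hdd
    rw [Function.update_self, List.mem_cons, hls _ hd]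
    constructor
    · rintro (rfl | ⟨x, hx, hu, hdx, rfl⟩)
      · exact ⟨w, hw, Or.inr rfl, rfl, rfl⟩
      · exact ⟨x, hx, Or.inl hu, hdx, rfl⟩
    · rintro ⟨x, hx, hu | rfl, hdx, rfl⟩
      · exact Or.inr ⟨x, hx, hu, hdx, rfl⟩
      · exact Or.inl rfl
  · rw [Function.update_of_ne hdd, hls _ hd']
    constructor
    · rintro ⟨x, hx, hu, hdx, rfl⟩
      exact ⟨x, hx, Or.inl hu, hdx, rfl⟩
    · rintro ⟨x, hx, hu | rfl, hdx, rfl⟩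
      · exact ⟨x, hx, hu, hdx, rfl⟩
      · exact absurd hdx.symm hdd

/-- Between unlinking and linking, `w` is taken out of the set of bucketed vertices, so its number
can change while `Buckets` stays valid for the others. -/
theorem lower_exec (hB : 16 + n + n ≤ B) (h : Buckets n U s) (h0 : s.reg 0 = n) (h11 : s.reg 11 = w)
    (hw : w < n) (hU : U w) (hd : s.fld 13 w < n) : ∃ t, HExec B β lower s t ∧ Buckets n U t ∧
      t.fld 13 = Function.update (s.fld 13) w (s.fld 13 w - 1) ∧ t.time = s.time + 9 := by
  change Wp B β _ _ s
  rw [lower, wp_seq, wp_assign]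
  refine ⟨by simp; omega, ?_⟩
  simp only [Expr.eval, h0, h11]
  obtain ⟨t1, x1, b1, m1⟩ := unlinkCell_exec (B := B) (β := β) (w := w) (s := s.setReg 9 (n + w)) (by omega)
    (h.congr rfl rfl (fun _ _ _ => rfl) fun _ _ => Iff.rfl) (by simp) hw hU hd
  have r0 : t1.reg 11 = w := by rw [x1.reg_eq rfl]; simpa using h11
  have r9 : t1.reg 9 = n + w := by rw [x1.reg_eq rfl]; simp
  have f13 : t1.fld 13 = s.fld 13 := by rw [x1.fld_eq rfl]; simp
  rw [wp_seq]
  refine ⟨t1, x1, ?_⟩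
  rw [wp_seq, wp_store]
  refine ⟨by simp; omega, ?_⟩
  rw [wp_seq, wp_assign]
  refine ⟨by simp; omega, ?_⟩
  simp only [Expr.eval, HState.setFld_reg, r0, f13, HState.setFld_fld, if_true, Function.update_self]
  obtain ⟨t2, x2, b2, m2⟩ := linkCell_exec (B := B) (β := β) (w := w)
    (s := (t1.setFld 13 w (s.fld 13 w - 1)).setReg 8 (s.fld 13 w - 1)) (by omega)
    (b1.congr (by simp) (by simp) (fun x _ hx => by simp [Function.update_of_ne hx.2])
      fun _ _ => Iff.rfl)
    (by simp [r9]) hw (by simp) (by simp) (by simp; omega)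
  refine ⟨t2, x2, b2.congr rfl rfl (fun _ _ _ => rfl) fun x hx => ?_, ?_, ?_⟩
  · by_cases hxw : x = w
    · simp [hxw, hU]
    · simp [hxw]
  · rw [x2.fld_eq rfl]; simp [f13]
  · rw [m2]; simp [m1]

end Cells

end InducedSubtrees

/-! ### Placing a vertex in the ordering: sorted lists and remaining degrees of its neighbours -/

namespace InducedSubtrees

/-- The vertices `os` have been moved to the ordering; the data of the vertex `w` take the part `f w`
of `os` into account. -/
structure Sorting (n L : ℕ) (st : ℕ → ℕ) (nb : ℕ → List ℕ) (os : List ℕ) (f : ℕ → List ℕ)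
    (s : HState) : Prop where
  num : s.reg 0 = n
  len : s.reg 1 = L
  ptr : ∀ v ≤ n, s.raw (v + 1) = st v
  adj : ∀ v < n, ∀ j (h : j < (nb v).length), s.raw (st v + j) = (nb v)[j]
  name : ∀ i (h : i < os.length), s.raw (L + i) = os[i]
  flag : ∀ w < n, s.fld 15 w = if w ∈ os then 1 else 0
  fill : ∀ w < n, s.fld 14 w = st w + (prev nb (f w) w).length
  tgt : ∀ w < n, ∀ j (h : j < (prev nb (f w) w).length),
    s.fld 11 (st w + j) = os.idxOf (prev nb (f w) w)[j]
  sadj : ∀ w < n, ∀ j (h : j < (prev nb (f w) w).length),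
    s.raw (L + (st w + j)) = (prev nb (f w) w)[j]
  deg : ∀ w < n, w ∉ os → s.fld 13 w = (left nb (f w) w).length
  buckets : Buckets n (fun w => w ∉ os) s

variable {n L B β : ℕ} {st : ℕ → ℕ} {nb : ℕ → List ℕ} {os : List ℕ} {f : ℕ → List ℕ} {s : HState}

theorem Sorting.congr {t : HState} (h : Sorting n L st nb os f s) (h0 : t.reg 0 = s.reg 0)
    (h1 : t.reg 1 = s.reg 1) (h2 : t.fld 2 = s.fld 2) (h3 : t.fld 3 = s.fld 3)
    (h11 : t.fld 11 = s.fld 11) (h13 : t.fld 13 = s.fld 13) (h14 : t.fld 14 = s.fld 14)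
    (h15 : t.fld 15 = s.fld 15) (hr : t.raw = s.raw) : Sorting n L st nb os f t where
  num := h0.trans h.num
  len := h1.trans h.len
  ptr := by rw [hr]; exact h.ptr
  adj := by rw [hr]; exact h.adj
  name := by rw [hr]; exact h.name
  flag := by rw [h15]; exact h.flag
  fill := by rw [h14]; exact h.fill
  tgt := by rw [h11]; exact h.tgt
  sadj := by rw [hr]; exact h.sadj
  deg := by rw [h13]; exact h.deg
  buckets := h.buckets.congr h2 h3 (fun _ _ _ => by rw [h13]) fun _ _ => Iff.rfl

/-- Sorting by transposition: a vertex is appended to the lists of its neighbours at the moment it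
is placed, so each list grows in the order of placement. The name goes to the copy of the adjacency
lists starting at `L`, the rank `os.length` to array `11`. Only neighbours that are not yet placed
change their bucket. -/
theorem sortEdge_exec (hI : AdjBlocks n L st nb) (hB : 16 + n + 2 * L ≤ B) (hβ : 2 * L ≤ β) {v w e : ℕ}
    (hvo : v ∉ os) (ho : os.Nodup) (hon : os.length < n) (hf : ∀ w < n, (f w).Nodup)
    (hw : w < n) (hfw : f w = os) (hvw : v ∈ nb w) (he : e < L) (hew : s.raw e = w)
    (h2 : s.reg 2 = os.length) (h3 : s.reg 3 = v) (h10 : s.reg 10 = e)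
    (hs : Sorting n L st nb (os ++ [v]) f s) :
    ∃ t, HExec B β sortEdge s t ∧
      Sorting n L st nb (os ++ [v]) (Function.update f w (os ++ [v])) t ∧ t.reg 2 = os.length ∧
      t.reg 3 = v ∧ t.reg 10 = e + 1 ∧ t.time ≤ s.time + 16 := by
  have hbd := hI.bound hw
  have hge := hI.ge hw.le
  have hlen := hI.length_lt hw
  obtain ⟨p, hp⟩ : ∃ p, p = st w + (prev nb os w).length := ⟨_, rfl⟩
  have hpw : prev nb (os ++ [v]) w = prev nb os w ++ [v] := prev_append_of_mem hvw
  have hplt : p < st w + (nb w).length := by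
    have h1 := prev_length_le (nb := nb) (ho.append (List.nodup_singleton v) (by simpa using hvo)) w
    rw [hpw, List.length_append, List.length_singleton] at h1
    omega
  have hf14 : s.fld 14 w = p := by rw [hs.fill w hw, hfw, hp]
  have hidx : (os ++ [v]).idxOf v = os.length := by
    rw [List.idxOf_append_of_notMem hvo]; simp
  have hother : ∀ x < n, x ≠ w → ∀ j < (prev nb (f x) x).length, st x + j ≠ p := by
    intro x hx hxw j hj
    have h1 := prev_length_le (nb := nb) (hf x hx) x
    have h2 := hI.sep hx hw hxw
    omega
  change Wp B β _ _ s
  rw [sortEdge]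
  simp only [wp_seq, wp_assign, wp_store, wp_storeRaw]
  simp only [Expr.Ok, Expr.eval, HState.setReg_reg, HState.setReg_fld, HState.setRaw_reg,
    HState.setFld_reg, Nat.reduceEqDiff, if_false, if_true, h2, h3, h10, hew, hf14, hs.len]
  refine ⟨⟨trivial, by omega⟩, ⟨by omega, trivial, by omega⟩,
    ⟨⟨trivial, trivial, by omega⟩, trivial, by omega⟩, ⟨by omega, trivial, trivial, by omega⟩,
    ⟨by omega, trivial, ⟨trivial, by omega, by omega⟩, by omega⟩, ?_⟩
  generalize ht1 : HState.setFld _ 14 w (p + 1) = t1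
  have r0 : t1.reg 0 = n := by simp [← ht1, hs.num]
  have r1 : t1.reg 1 = L := by simp [← ht1, hs.len]
  have r2 : t1.reg 2 = os.length := by simp [← ht1, h2]
  have r3 : t1.reg 3 = v := by simp [← ht1, h3]
  have r10 : t1.reg 10 = e := by simp [← ht1, h10]
  have r11 : t1.reg 11 = w := by simp [← ht1]
  have k11 : t1.fld 11 = Function.update (s.fld 11) p os.length := by simp [← ht1]
  have k14 : t1.fld 14 = Function.update (s.fld 14) w (p + 1) := by simp [← ht1]
  have k2 : t1.fld 2 = s.fld 2 := by simp [← ht1]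
  have k3 : t1.fld 3 = s.fld 3 := by simp [← ht1]
  have k13 : t1.fld 13 = s.fld 13 := by simp [← ht1]
  have k15 : t1.fld 15 = s.fld 15 := by simp [← ht1]
  have kr : t1.raw = Function.update s.raw (L + p) v := by simp [← ht1]
  have km : t1.time = s.time + 5 := by simp [← ht1]
  have hraw : ∀ i < L, t1.raw i = s.raw i := fun i hi => by
    rw [kr, Function.update_of_ne (by omega)]
  -- all but the last part of the invariant
  have main : ∀ t : HState, t.reg 0 = n → t.reg 1 = L → t.fld 11 = t1.fld 11 → t.fld 14 = t1.fld 14 →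
      t.fld 15 = t1.fld 15 → t.raw = t1.raw → Buckets n (fun w => w ∉ os ++ [v]) t →
      (∀ x < n, x ≠ w → t.fld 13 x = s.fld 13 x) →
      (w ∉ os ++ [v] → t.fld 13 w = (left nb (os ++ [v]) w).length) →
      Sorting n L st nb (os ++ [v]) (Function.update f w (os ++ [v])) t := by
    intro t g0 g1 g11 g14 g15 gr gb gx gw
    refine ⟨g0, g1, fun x hx => ?_, fun x hx j hj => ?_, fun i hi => ?_, fun x hx => ?_,
      fun x hx => ?_, fun x hx j hj => ?_, fun x hx j hj => ?_, fun x hx hxo => ?_, gb⟩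
    · rw [gr, hraw _ (by omega), hs.ptr x hx]
    · have := hI.bound hx
      rw [gr, hraw _ (by omega), hs.adj x hx j hj]
    · rw [List.length_append, List.length_singleton] at hi
      rw [gr, kr, Function.update_of_ne (by omega), hs.name i]
    · rw [g15, k15, hs.flag x hx]
    · rw [g14, k14]
      by_cases hxw : x = w
      · subst hxw
        rw [Function.update_self, Function.update_self, hpw, List.length_append,
          List.length_singleton]
        omega
      · rw [Function.update_of_ne hxw, Function.update_of_ne hxw, hs.fill x hx]
    · rw [g11, k11]
      by_cases hxw : x = w
      · subst hxw
        simp only [Function.update_self, hpw, List.length_append, List.length_singleton] at hj ⊢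
        by_cases hjl : j < (prev nb os x).length
        · rw [Function.update_of_ne (by omega), hs.tgt x hx j (by rw [hfw]; exact hjl)]
          simp only [hfw, List.getElem_append_left hjl]
        · obtain rfl : j = (prev nb os x).length := by omega
          rw [hp, Function.update_self, List.getElem_concat_length rfl, hidx]
      · simp only [Function.update_of_ne hxw] at hj ⊢
        rw [Function.update_of_ne (hother x hx hxw j hj), hs.tgt x hx j hj]
    · rw [gr, kr]
      by_cases hxw : x = w
      · subst hxw
        simp only [Function.update_self, hpw, List.length_append, List.length_singleton] at hj ⊢
        by_cases hjl : j < (prev nb os x).length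
        · rw [Function.update_of_ne (by omega), hs.sadj x hx j (by rw [hfw]; exact hjl)]
          simp only [hfw, List.getElem_append_left hjl]
        · obtain rfl : j = (prev nb os x).length := by omega
          rw [hp, Function.update_self, List.getElem_concat_length rfl]
      · simp only [Function.update_of_ne hxw] at hj ⊢
        rw [Function.update_of_ne (by have := hother x hx hxw j hj; omega), hs.sadj x hx j hj]
    · by_cases hxw : x = w
      · subst hxw
        rw [Function.update_self]; exact gw hxo
      · rw [Function.update_of_ne hxw, gx x hx hxw, hs.deg x hx hxo]
  have hb1 : Buckets n (fun w => w ∉ os ++ [v]) t1.tick :=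
    hs.buckets.congr k2 k3 (fun _ _ _ => by rw [k13]) fun _ _ => Iff.rfl
  refine wp_ite (by simp; omega) (by simp; omega) (fun hlt => ?_) (fun hlt => ?_)
  · simp only [Expr.eval, r11, k15, hs.flag w hw] at hlt
    have hwo : w ∉ os ++ [v] := fun hc => by simp [hc] at hlt
    have hdeg := hs.deg w hw hwo
    have hdl : s.fld 13 w < n := by
      have : (left nb (f w) w).length ≤ (nb w).length := List.length_filter_le _ _
      omega
    obtain ⟨t2, x2, b2, d2, m2⟩ := lower_exec (B := B) (β := β) (s := t1.tick) (w := w) (by omega) hb1 r0 r11 hw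
      hwo (by simpa [k13] using hdl)
    refine ⟨t2, x2, wp_assign.2 ⟨by simp [x2.reg_eq (r := 10) rfl, r10]; omega, main _ ?_ ?_ ?_ ?_ ?_ ?_ ?_ ?_ ?_,
      ?_, ?_, ?_, ?_⟩⟩
    · simp [x2.reg_eq (r := 0) rfl, r0]
    · simp [x2.reg_eq (r := 1) rfl, r1]
    · simp [x2.fld_eq (k := 11) rfl]
    · simp [x2.fld_eq (k := 14) rfl]
    · simp [x2.fld_eq (k := 15) rfl]
    · simp [x2.raw_eq rfl]
    · exact b2.congr rfl rfl (fun _ _ _ => rfl) fun _ _ => Iff.rfl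
    · intro x _ hxw
      simp [d2, Function.update_of_ne hxw, k13]
    · intro _
      have h5 := left_append_of_mem hI hw hvw hvo
      simp only [HState.setReg_fld, d2, Function.update_self, HState.tick_fld, k13, hdeg, hfw]
      omega
    · simp [x2.reg_eq (r := 2) rfl, r2]
    · simp [x2.reg_eq (r := 3) rfl, r3]
    · simp [x2.reg_eq (r := 10) rfl, r10]
    · simp [m2, km]
  · simp only [Expr.eval, r11, k15, hs.flag w hw] at hlt
    have hwo : w ∈ os ++ [v] := by by_contra hc; simp [hc] at hlt
    rw [wp_skip, wp_assign]
    refine ⟨by simp [r10]; omega, main _ ?_ ?_ rfl rfl rfl rfl ?_ ?_ ?_, ?_, ?_, ?_, ?_⟩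
    · simp [r0]
    · simp [r1]
    · exact hb1.congr rfl rfl (fun _ _ _ => rfl) fun _ _ => Iff.rfl
    · intro x _ _; simp [k13]
    · exact fun hc => absurd hwo hc
    · simp [r2]
    · simp [r3]
    · simp [r10]
    · simp [km]

/-- During the loop the data of the neighbours already visited take `v` into account and the others
do not; this is why `Sorting` has a list `f w` for each vertex. At the end the difference
disappears, as `v` changes neither `prev` nor `left` for vertices not adjacent to it. -/
theorem edges_exec (hI : AdjBlocks n L st nb) (hB : 16 + n + 2 * L ≤ B) (hβ : 2 * L ≤ β) {v : ℕ}
    (hv : v < n) (hvo : v ∉ os) (ho : os.Nodup) (hon : os.length < n)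
    (h2 : s.reg 2 = os.length) (h3 : s.reg 3 = v) (h10 : s.reg 10 = st v)
    (hend : s.fld 10 os.length = st v + (nb v).length)
    (hs : Sorting n L st nb (os ++ [v]) (fun _ => os) s) :
    ∃ t, HExec B β (.while (rg 10) (arr 10 (rg 2)) sortEdge) s t ∧
      Sorting n L st nb (os ++ [v]) (fun _ => os ++ [v]) t ∧
      t.time ≤ s.time + 1 + 17 * (nb v).length := by
  have hbd := hI.bound hv
  have hon' : (os ++ [v]).Nodup := ho.append (List.nodup_singleton v) (by simpa using hvo)
  change Wp B β _ _ s
  refine wp_while (fun j t => ∃ i, i + j = (nb v).length ∧ t.reg 2 = os.length ∧ t.reg 3 = v ∧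
    t.reg 10 = st v + i ∧ t.fld 10 = s.fld 10 ∧ t.time ≤ s.time + 17 * i ∧
    Sorting n L st nb (os ++ [v]) (fun w => if w ∈ (nb v).take i then os ++ [v] else os) t)
    (nb v).length ⟨0, ?_⟩ ?_ ?_ ?_
  · exact ⟨by omega, h2, h3, by simpa using h10, rfl, by omega, by simpa using hs⟩
  · intros; simp; omega
  · rintro j t ⟨i, hij, g2, g3, g10, gf, gt, gs⟩ hlt
    simp only [Expr.eval, g10, g2, gf, hend] at hlt
    have hi : i < (nb v).length := by omega
    have hwl : (nb v)[i] ∈ nb v := List.getElem_mem hi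
    have hwt : (nb v)[i] ∉ (nb v).take i := by
      intro hc
      obtain ⟨j, hj, hj'⟩ := List.mem_take_iff_getElem.1 hc
      have := (hI.nodup v hv).getElem_inj_iff.1 hj'
      omega
    obtain ⟨t', x', s', q2, q3, q10, qt⟩ := sortEdge_exec (B := B) (β := β) (w := (nb v)[i]) (s := t.tick)
      (e := st v + i) hI hB hβ hvo ho hon (fun w _ => by split <;> assumption)
      (hI.lt v hv _ hwl) (if_neg hwt) (hI.symm v hv _ hwl) (by omega) (gs.adj v hv i hi) g2 g3 g10
      (gs.congr rfl rfl rfl rfl rfl rfl rfl rfl rfl)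
    refine ⟨t', x', j - 1, by omega, i + 1, by omega, q2, q3, by omega, ?_, ?_, ?_⟩
    · rw [x'.fld_eq rfl]; exact gf
    · rw [HState.tick_time] at qt; omega
    · convert s' using 1
      funext w
      rw [Function.update_apply]
      have htake : w ∈ (nb v).take (i + 1) ↔ w ∈ (nb v).take i ∨ w = (nb v)[i] := by
        rw [List.take_add_one, List.getElem?_eq_getElem hi, List.mem_append]
        simp only [Option.toList, List.mem_singleton]
      by_cases hw : w = (nb v)[i]
      · rw [if_pos hw, if_pos (htake.2 (Or.inr hw))]
      · rw [if_neg hw]; simp only [htake, hw, or_false]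
  · rintro j t ⟨i, hij, g2, g3, g10, gf, gt, gs⟩ hlt
    simp only [Expr.eval, g10, g2, gf, hend] at hlt
    obtain rfl : i = (nb v).length := by omega
    refine ⟨?_, by rw [HState.tick_time]; omega⟩
    rw [List.take_length] at gs
    have key : ∀ w < n, prev nb (if w ∈ nb v then os ++ [v] else os) w = prev nb (os ++ [v]) w ∧
        left nb (if w ∈ nb v then os ++ [v] else os) w = left nb (os ++ [v]) w := by
      intro w hw
      split
      · exact ⟨rfl, rfl⟩
      · rename_i hc
        have hc' : v ∉ nb w := fun h => hc (hI.symm w hw v h)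
        exact ⟨(prev_append_of_notMem hc').symm, (left_append_of_notMem hc').symm⟩
    refine ⟨gs.num, gs.len, gs.ptr, gs.adj, gs.name, gs.flag, fun w hw => ?_, fun w hw => ?_,
      fun w hw => ?_, fun w hw => ?_,
      gs.buckets.congr rfl rfl (fun _ _ _ => rfl) fun _ _ => Iff.rfl⟩
    · have h := gs.fill w hw; simp only [(key w hw).1] at h; exact h
    · have h := gs.tgt w hw; simp only [(key w hw).1] at h; exact h
    · have h := gs.sadj w hw; simp only [(key w hw).1] at h; exact h
    · have h := gs.deg w hw; simp only [(key w hw).2] at h; exact h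

end InducedSubtrees

/-! ### Smallest-last ordering in linear time by buckets -/

namespace InducedSubtrees

/-- Make the doubly linked lists empty. -/
def resetHeaders : HProg :=
  .assign 8 (.const 0) ;;
  .while (rg 8) (rg 0)
    (.store (.const 2) (rg 8) (rg 8) ;; .store (.const 3) (rg 8) (rg 8) ;;
     .assign 8 (.add (rg 8) (.const 1)))

/-- Put every vertex into the list that belongs to its degree. -/
def fillBuckets : HProg :=
  .assign 3 (.const 0) ;;
  .while (rg 3) (rg 0)
    (.store (.const 13) (rg 3)
       (.sub (.raw (.add (rg 3) (.const 2))) (.raw (.add (rg 3) (.const 1)))) ;;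
     .store (.const 14) (rg 3) (.raw (.add (rg 3) (.const 1))) ;;
     .assign 9 (.add (rg 0) (rg 3)) ;; .assign 8 (arr 13 (rg 3)) ;; linkCell ;;
     .assign 3 (.add (rg 3) (.const 1)))

/-- Find the first nonempty list. -/
def findLeast : HProg :=
  .assign 8 (.const 0) ;; .while (arr 2 (rg 8)) (rg 0) (.assign 8 (.add (rg 8) (.const 1)))

/-- Move a vertex with the least number of neighbours left to the ordering. -/
def select : HProg :=
  findLeast ;; .assign 9 (arr 2 (rg 8)) ;; .assign 3 (.sub (rg 9) (rg 0)) ;; unlinkCell ;;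
  .store (.const 15) (rg 3) (.const 1) ;; .storeRaw (.add (rg 1) (rg 2)) (rg 3) ;;
  .store (.const 9) (rg 2) (arr 14 (rg 3)) ;;
  .store (.const 10) (rg 2) (.raw (.add (rg 3) (.const 2))) ;;
  .assign 10 (.raw (.add (rg 3) (.const 1))) ;; .while (rg 10) (arr 10 (rg 2)) sortEdge ;;
  .assign 2 (.add (rg 2) (.const 1))

/-- Compute the ordering and the sorted adjacency lists. -/
def preprocess : HProg :=
  resetHeaders ;; fillBuckets ;; .assign 2 (.const 0) ;; .while (rg 2) (rg 0) select ;; resetHeaders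

/-- The vertices `os` have been moved to the ordering, each with the least number of neighbours
left. -/
structure Ordered (n L : ℕ) (st : ℕ → ℕ) (nb : ℕ → List ℕ) (os : List ℕ) (s : HState) : Prop where
  sorting : Sorting n L st nb os (fun _ => os) s
  nodup : os.Nodup
  lt : ∀ v ∈ os, v < n
  count : s.reg 2 = os.length
  first : ∀ i (h : i < os.length), s.fld 9 i = st os[i] + (prev nb (os.take i) os[i]).length
  last : ∀ i (h : i < os.length), s.fld 10 i = st os[i] + (nb os[i]).length
  least : ∀ i (h : i < os.length), ∀ w < n, w ∉ os.take i →
    (left nb (os.take i) os[i]).length ≤ (left nb (os.take i) w).length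

theorem fam_nil {nx pv : ℕ → ℕ} {n : ℕ} (h : ∀ d < n, nx d = d ∧ pv d = d) :
    Fam nx pv n fun _ => [] :=
  ⟨fun d hd => h d hd, by simp, by simp, by simp⟩

variable {n L B β : ℕ} {st : ℕ → ℕ} {nb : ℕ → List ℕ} {os : List ℕ} {s : HState}

theorem resetHeaders_exec (hB : 16 + n ≤ B) (h0 : s.reg 0 = n) :
    ∃ t, HExec B β resetHeaders s t ∧ (∀ d < n, t.fld 2 d = d ∧ t.fld 3 d = d) ∧
      t.time = s.time + 2 + 4 * n := by
  change Wp B β _ _ s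
  rw [resetHeaders, wp_seq, wp_assign]
  refine ⟨by simp, ?_⟩
  refine wp_while (fun j t => ∃ i, i + j = n ∧ t.reg 8 = i ∧ t.reg 0 = n ∧
    t.time = s.time + 1 + 4 * i ∧ ∀ d < i, t.fld 2 d = d ∧ t.fld 3 d = d) n ⟨0, ?_⟩ ?_ ?_ ?_
  · simp [h0]
  · intros; simp
  · rintro j t ⟨i, hij, h8, h0', htm, hd⟩ hlt
    simp only [Expr.eval, h8, h0'] at hlt
    simp only [wp_seq, wp_store, wp_assign]
    refine ⟨by simp; omega, by simp; omega, by simp [h8]; omega, j - 1, by omega, i + 1, by omega,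
      by simp [h8], by simp [h0'], by simp [htm]; omega, fun d hd' => ?_⟩
    by_cases hdi : d = i
    · simp [hdi, h8]
    · simp [h8, Function.update_of_ne hdi, hd d (by omega)]
  · rintro j t ⟨i, hij, h8, h0', htm, hd⟩ hlt
    simp only [Expr.eval, h8, h0'] at hlt
    exact ⟨fun d hd' => hd d (by omega), by simp; omega⟩

theorem fillBuckets_exec (hI : AdjBlocks n L st nb) (hB : 16 + n + 2 * L ≤ B) (hβ : 2 * L ≤ β)
    (h0 : s.reg 0 = n) (hptr : ∀ v ≤ n, s.raw (v + 1) = st v)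
    (hd : ∀ d < n, s.fld 2 d = d ∧ s.fld 3 d = d) :
    ∃ t, HExec B β fillBuckets s t ∧
      (∀ w < n, t.fld 13 w = (nb w).length ∧ t.fld 14 w = st w) ∧ Buckets n (fun _ => True) t ∧
      t.time = s.time + 2 + 10 * n := by
  have hnL := hI.ge le_rfl
  rw [hI.total] at hnL
  change Wp B β _ _ s
  rw [fillBuckets, wp_seq, wp_assign]
  refine ⟨by simp, ?_⟩
  refine wp_while (fun j t => ∃ i, i + j = n ∧ t.reg 3 = i ∧ t.reg 0 = n ∧ t.raw = s.raw ∧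
    (∀ w < i, t.fld 13 w = (nb w).length ∧ t.fld 14 w = st w) ∧ Buckets n (fun w => w < i) t ∧
    t.time = s.time + 1 + 10 * i) n ⟨0, ?_⟩ ?_ ?_ ?_
  · refine ⟨by omega, by simp, by simp [h0], by simp, by simp, ⟨fun _ => [], fam_nil hd, ?_⟩, by simp⟩
    simp
  · intros; simp
  · rintro j t ⟨i, hij, h3, h0', hr, hw, hb, htm⟩ hlt
    simp only [Expr.eval, h3, h0'] at hlt
    have hp1 := hptr i hlt.le
    have hp2 := hptr (i + 1) hlt
    have hlen := hI.length_lt hlt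
    rw [hI.succ i hlt] at hp2
    simp only [wp_seq (p := .store _ _ _), wp_seq (p := .assign _ _), wp_store, wp_assign]
    simp only [Expr.Ok, Expr.eval, HState.setReg_reg, HState.setFld_reg, HState.setFld_raw,
      HState.setFld_fld, HState.tick_reg, HState.tick_raw, HState.setReg_fld, Nat.reduceEqDiff,
      if_false, if_true, h3, h0', hr, hp1, hp2, Nat.add_sub_cancel_left, Function.update_self]
    refine ⟨⟨by omega, trivial, ⟨⟨⟨trivial, by omega, by omega⟩, by omega⟩,
        ⟨⟨trivial, by omega, by omega⟩, by omega⟩⟩, by omega⟩,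
      ⟨by omega, trivial, ⟨⟨trivial, by omega, by omega⟩, by omega⟩, by omega⟩,
      ⟨trivial, trivial, by omega⟩, ⟨by omega, trivial, by omega⟩, ?_⟩
    generalize ht1 : HState.setReg _ 8 (nb i).length = t1
    have k13 : t1.fld 13 = Function.update (t.fld 13) i (nb i).length := by simp [← ht1]
    have k14 : t1.fld 14 = Function.update (t.fld 14) i (st i) := by simp [← ht1]
    obtain ⟨t2, x2, b2, m2⟩ := linkCell_exec (B := B) (β := β) (w := i) (s := t1) (by omega)
      (hb.congr (by simp [← ht1]) (by simp [← ht1])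
        (fun w _ hw => by rw [k13, Function.update_of_ne (Nat.ne_of_lt hw)]) fun _ _ => Iff.rfl)
      (by simp [← ht1]) hlt (by omega) (by simp [← ht1]) (by simpa [k13] using hlen)
    have r3 : t2.reg 3 = i := by rw [x2.reg_eq rfl]; simp [← ht1, h3]
    rw [wp_seq]
    refine ⟨t2, x2, wp_assign.2 ⟨by simp [r3]; omega, j - 1, by omega, i + 1, by omega, by simp [r3],
      ?_, ?_, fun w hw' => ?_, b2.congr rfl rfl (fun _ _ _ => rfl) fun _ _ => by omega, ?_⟩⟩
    · simp [x2.reg_eq (r := 0) rfl, ← ht1, h0']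
    · simp [x2.raw_eq rfl, ← ht1, hr]
    · simp only [HState.setReg_fld, x2.fld_eq (k := 13) rfl, x2.fld_eq (k := 14) rfl, k13, k14]
      by_cases hwi : w = i
      · simp [hwi]
      · rw [Function.update_of_ne hwi, Function.update_of_ne hwi]; exact hw w (by omega)
    · simp [m2, ← ht1, htm]; omega
  · rintro j t ⟨i, hij, h3, h0', hr, hw, hb, htm⟩ hlt
    simp only [Expr.eval, h3, h0'] at hlt
    exact ⟨fun w hw' => hw w (by omega), hb.congr rfl rfl (fun _ _ _ => rfl) fun w hw' => by simp; omega,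
      by simp; omega⟩

/-- The search starts from bucket `0` every time. It costs twice the number of neighbours left for
the vertex found, hence at most twice its degree, and the degrees sum up to a linear bound; no
pointer to the least bucket has to be maintained. -/
theorem findLeast_exec {U : ℕ → Prop} (hB : 16 + n ≤ B) (h : Buckets n U s) (h0 : s.reg 0 = n)
    (hd : ∀ x < n, U x → s.fld 13 x < n) (hx : ∃ x < n, U x) :
    ∃ t w, HExec B β findLeast s t ∧ w < n ∧ U w ∧ s.fld 2 (t.reg 8) = n + w ∧
      (∀ x < n, U x → s.fld 13 w ≤ s.fld 13 x) ∧ t.time ≤ s.time + 2 + 2 * s.fld 13 w := by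
  obtain ⟨ls, hF, hls⟩ := h
  obtain ⟨x₀, hx₀, hU₀⟩ := hx
  have hw : Wp B β findLeast (fun t => ∃ w < n, U w ∧ s.fld 2 (t.reg 8) = n + w ∧
      (∀ x < n, U x → s.fld 13 w ≤ s.fld 13 x) ∧ t.time ≤ s.time + 2 + 2 * s.fld 13 w) s := by
    rw [findLeast, wp_seq, wp_assign]
    refine ⟨by simp, ?_⟩
    refine wp_while (fun j t => ∃ d, d + j = s.fld 13 x₀ ∧ t.reg 8 = d ∧ t.reg 0 = n ∧
      t.fld 2 = s.fld 2 ∧ (∀ x < n, U x → d ≤ s.fld 13 x) ∧ t.time = s.time + 1 + 2 * d)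
      (s.fld 13 x₀) ⟨0, ?_⟩ ?_ ?_ ?_
    · simp [h0]
    · intros; simp; omega
    · rintro j t ⟨d, hdj, h8, h0', h2, hle, htm⟩ hlt
      have hdx := hle x₀ hx₀ hU₀
      have hdn := hd x₀ hx₀ hU₀
      simp only [Expr.eval, h8, h0', h2] at hlt
      rw [hF.nx_lt_iff (by omega)] at hlt
      have hne : ∀ x < n, U x → d + 1 ≤ s.fld 13 x := by
        intro x hx hU
        refine Nat.lt_of_le_of_ne (hle x hx hU) fun he => ?_
        have := (hls d (by omega) (n + x)).2 ⟨x, hx, hU, he.symm, rfl⟩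
        rw [hlt] at this
        exact List.not_mem_nil this
      have := hne x₀ hx₀ hU₀
      rw [wp_assign]
      refine ⟨by simp [h8]; omega, j - 1, by omega, d + 1, by omega, by simp [h8], by simp [h0'],
        by simp [h2], hne, by simp [htm]; omega⟩
    · rintro j t ⟨d, hdj, h8, h0', h2, hle, htm⟩ hlt
      have hdn := hd x₀ hx₀ hU₀
      simp only [Expr.eval, h8, h0', h2] at hlt
      rw [hF.nx_lt_iff (by omega)] at hlt
      obtain ⟨c, l, hcl⟩ := List.exists_cons_of_ne_nil hlt
      obtain ⟨w, hw, hU, hdw, rfl⟩ := (hls d (by omega) c).1 (by simp [hcl])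
      refine ⟨w, hw, hU, ?_, fun x hx hUx => hdw ▸ hle x hx hUx, by simp; omega⟩
      rw [HState.tick_reg, h8]; exact hF.nx_eq (by omega) hcl
  obtain ⟨t, ht, w, h1, h2, h3, h4, h5⟩ := hw
  exact ⟨t, w, ht, h1, h2, h3, h4, h5⟩

/-- When `v` is placed, its sorted list consists of exactly its neighbours placed before. The
current end of the list, kept in array `14`, is therefore the place where its later neighbours will
begin, and it is stored in array `9`. Two steps per neighbour come from the search and seventeen
from the loop over the edges. -/
theorem select_exec (hI : AdjBlocks n L st nb) (hB : 16 + n + 2 * L ≤ B) (hβ : 2 * L ≤ β)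
    (hos : os.length < n) (hs : Ordered n L st nb os s) :
    ∃ t v, HExec B β select s t ∧ Ordered n L st nb (os ++ [v]) t ∧
      t.time ≤ s.time + 13 + 19 * (nb v).length := by
  have hS := hs.sorting
  have hleft : ∀ x < n, x ∉ os → s.fld 13 x ≤ (nb x).length := fun x hx hxo => by
    rw [hS.deg x hx hxo]; exact List.length_filter_le _ _
  obtain ⟨t1, v, x1, hv, hvo, h2, hmin, m1⟩ := findLeast_exec (B := B) (β := β) (by omega) hS.buckets
    hS.num (fun x hx hxo => (hleft x hx hxo).trans_lt (hI.length_lt hx)) (by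
      by_contra hc
      push Not at hc
      have h1 : List.range n ⊆ os := fun x hx => hc x (List.mem_range.1 hx)
      have h2 := (List.subperm_of_subset List.nodup_range h1).length_le
      rw [List.length_range] at h2
      omega)
  have hvlen := hI.length_lt hv
  have hnL := hI.ge le_rfl
  rw [hI.total] at hnL
  have hon' : (os ++ [v]).Nodup := hs.nodup.append (List.nodup_singleton v) (by simpa using hvo)
  have q0 : t1.reg 0 = n := by rw [x1.reg_eq rfl, hS.num]
  have q1 : t1.reg 1 = L := by rw [x1.reg_eq rfl, hS.len]
  have q2 : t1.reg 2 = os.length := by rw [x1.reg_eq rfl, hs.count]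
  have qr : t1.raw = s.raw := x1.raw_eq rfl
  have qf : ∀ k, t1.fld k = s.fld k := fun k => x1.fld_eq rfl
  let t2 := (t1.setReg 9 (n + v)).setReg 3 v
  obtain ⟨t3, x3, b3, m3⟩ := unlinkCell_exec (B := B) (β := β) (s := t2) (w := v) (by omega)
    (hS.buckets.congr (qf 2) (qf 3) (fun w _ _ => congrFun (qf 13) w) fun _ _ => Iff.rfl)
    (by simp [t2]) hv hvo (by
      show t1.fld 13 v < n
      rw [qf]; exact (hleft v hv hvo).trans_lt hvlen)
  have p0 : t3.reg 0 = n := by rw [x3.reg_eq rfl]; simp [t2, q0]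
  have p1 : t3.reg 1 = L := by rw [x3.reg_eq rfl]; simp [t2, q1]
  have p2 : t3.reg 2 = os.length := by rw [x3.reg_eq rfl]; simp [t2, q2]
  have p3 : t3.reg 3 = v := by rw [x3.reg_eq rfl]; simp [t2]
  have pr : t3.raw = s.raw := by rw [x3.raw_eq rfl]; simp [t2, qr]
  have pf : ∀ k, k ≠ 2 → k ≠ 3 → t3.fld k = s.fld k := by
    intro k hk hk'
    rw [x3.fld_eq (by simp [unlinkCell, HProg.noFld, hk.symm, hk'.symm])]
    exact qf k
  have pm : t3.time = t1.time + 4 := m3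
  have hfill := hS.fill v hv
  have hge := hI.ge hv.le
  have hbd := hI.bound hv
  let t4 := ((((t3.setFld 15 v 1).setRaw (L + os.length) v).setFld 9 os.length (s.fld 14 v)).setFld 10
    os.length (st v + (nb v).length)).setReg 10 (st v)
  have s4 : Sorting n L st nb (os ++ [v]) (fun _ => os) t4 := by
    refine ⟨by simp [t4, p0], by simp [t4, p1], fun x hx => ?_, fun x hx j hj => ?_, fun i hi => ?_,
      fun x hx => ?_, fun x hx => ?_, fun x hx j hj => ?_, fun x hx j hj => ?_, fun x hx hxo => ?_, ?_⟩
    · rw [← hS.ptr x hx, ← pr]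
      simp [t4, Function.update_of_ne (show x + 1 ≠ L + os.length by omega)]
    · have := hI.bound hx
      rw [← hS.adj x hx j hj, ← pr]
      simp [t4, Function.update_of_ne (show st x + j ≠ L + os.length by omega)]
    · rw [List.length_append, List.length_singleton] at hi
      by_cases hil : i < os.length
      · rw [List.getElem_append_left hil, ← hS.name i hil, ← pr]
        simp [t4, Function.update_of_ne (show L + i ≠ L + os.length by omega)]
      · obtain rfl : i = os.length := by omega
        simp [t4]
    · simp only [t4, HState.setReg_fld, HState.setFld_fld, HState.setRaw_fld, Nat.reduceEqDiff, if_false,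
        if_true, pf 15 (by simp) (by simp), Function.update_apply, hS.flag x hx, List.mem_append,
        List.mem_singleton]
      by_cases hxv : x = v <;> simp [hxv]
    · rw [← hS.fill x hx, ← pf 14 (by simp) (by simp)]; simp [t4]
    · rw [List.idxOf_append_of_mem (List.mem_of_mem_filter (List.getElem_mem hj)), ← hS.tgt x hx j hj,
        ← pf 11 (by simp) (by simp)]
      simp [t4]
    · have := hI.ge hx.le
      rw [← hS.sadj x hx j hj, ← pr]
      simp [t4, Function.update_of_ne (show L + (st x + j) ≠ L + os.length by omega)]
    · rw [← hS.deg x hx (fun hc => hxo (List.mem_append_left _ hc)), ← pf 13 (by simp) (by simp)]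
      simp [t4]
    · refine b3.congr (by simp [t4]) (by simp [t4]) (fun _ _ _ => by simp [t4]) fun x _ => ?_
      simp
  obtain ⟨t5, x5, s5, m5⟩ := edges_exec (B := B) (β := β) (s := t4) hI hB hβ hv hvo hs.nodup hos
    (by simp [t4, p2]) (by simp [t4, p3]) (by simp [t4]) (by simp [t4]) s4
  have hf5 : ∀ k, k = 9 ∨ k = 10 → t5.fld k = t4.fld k := by
    rintro k (rfl | rfl) <;> exact x5.fld_eq rfl
  have r5 : t5.reg 2 = os.length := by rw [x5.reg_eq rfl]; simp [t4, p2]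
  have m4 : t4.time = t3.time + 5 := rfl
  have hdl := hleft v hv hvo
  refine ⟨t5.setReg 2 (os.length + 1), v, ?_, ⟨s5.congr rfl rfl rfl rfl rfl rfl rfl rfl rfl, hon',
    ?_, ?_, ?_, ?_, ?_⟩, ?_⟩
  · have hw : Wp B β select (fun t => t = t5.setReg 2 (os.length + 1)) s := by
      have e1 : t1.fld 2 (t1.reg 8) = n + v := by rw [qf, h2]
      have e2 : (n + v) - n = v := by omega
      have e3 := hS.ptr v hv.le
      have e4 := hS.ptr (v + 1) hv
      rw [hI.succ v hv] at e4
      rw [select, wp_seq]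
      refine ⟨t1, x1, ?_⟩
      rw [wp_seq, wp_assign]
      refine ⟨by simp; omega, ?_⟩
      rw [wp_seq, wp_assign]
      refine ⟨by simp, ?_⟩
      simp only [Expr.eval, HState.setReg_reg, e1, q0, e2, Nat.reduceEqDiff, if_false, if_true]
      rw [wp_seq]
      refine ⟨t3, x3, ?_⟩
      simp only [wp_seq (p := .store _ _ _), wp_seq (p := .storeRaw _ _), wp_seq (p := .assign _ _),
        wp_store, wp_assign, wp_storeRaw]
      have e5 : L + os.length ≠ v + 1 := by omega
      have e6 : L + os.length ≠ v + 2 := by omega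
      simp only [Expr.Ok, Expr.eval, HState.setFld_reg, HState.setRaw_reg, HState.setFld_raw,
        HState.setRaw_raw, HState.setFld_fld, HState.setRaw_fld,
        Nat.reduceEqDiff, if_false, p1, p2, p3, pr, pf 14 (by simp) (by simp),
        Function.update_of_ne e5.symm, Function.update_of_ne e6.symm, e3, e4]
      refine ⟨by simp; omega, ⟨⟨trivial, trivial, by omega⟩, trivial, by omega⟩, by simp; omega,
        by simp; omega, by simp; omega, ?_⟩
      rw [wp_seq]
      refine ⟨t5, x5, wp_assign.2 ⟨by simp [r5]; omega, by simp [r5]⟩⟩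
    obtain ⟨t, ht, rfl⟩ := hw
    exact ht
  · intro w hw
    rcases List.mem_append.1 hw with hw | hw
    · exact hs.lt w hw
    · rw [List.mem_singleton.1 hw]; exact hv
  · simp
  · intro i hi
    rw [List.length_append, List.length_singleton] at hi
    by_cases hil : i < os.length
    · rw [List.getElem_append_left hil, List.take_append_of_le_length hil.le, ← hs.first i hil,
        ← pf 9 (by simp) (by simp)]
      simp [hf5, t4, Function.update_of_ne (show i ≠ os.length by omega)]
    · obtain rfl : i = os.length := by omega
      rw [List.getElem_concat_length rfl, List.take_left']
      · simp [hf5, t4, hfill]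
      · rfl
  · intro i hi
    rw [List.length_append, List.length_singleton] at hi
    by_cases hil : i < os.length
    · rw [List.getElem_append_left hil, ← hs.last i hil, ← pf 10 (by simp) (by simp)]
      simp [hf5, t4, Function.update_of_ne (show i ≠ os.length by omega)]
    · obtain rfl : i = os.length := by omega
      rw [List.getElem_concat_length rfl]
      simp [hf5, t4]
  · intro i hi w hw hwo
    rw [List.length_append, List.length_singleton] at hi
    by_cases hil : i < os.length
    · rw [List.getElem_append_left hil]
      rw [List.take_append_of_le_length hil.le] at hwo ⊢
      exact hs.least i hil w hw hwo
    · obtain rfl : i = os.length := by omega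
      rw [List.getElem_concat_length rfl]
      rw [List.take_left' rfl] at hwo ⊢
      rw [← hS.deg v hv hvo, ← hS.deg w hw hwo]
      exact hmin w hw hwo
  · simp only [HState.setReg_time]
    omega

theorem perm_range (ho : os.Nodup) (hlt : ∀ v ∈ os, v < n) (hlen : os.length = n) :
    os.Perm (List.range n) :=
  (List.subperm_of_subset ho fun v hv => List.mem_range.2 (hlt v hv)).perm_of_length_le (by simp [hlen])

/-- The cost of placing a vertex is constant plus `19` times its degree. The final reset leaves
arrays `2` and `3`, used for buckets so far, as empty lists for the enumeration. -/
theorem preprocess_exec (hI : AdjBlocks n L st nb) (hB : 16 + n + 2 * L ≤ B) (hβ : 2 * L ≤ β)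
    (h0 : s.reg 0 = n) (h1 : s.reg 1 = L) (hptr : ∀ v ≤ n, s.raw (v + 1) = st v)
    (hadj : ∀ v < n, ∀ j (h : j < (nb v).length), s.raw (st v + j) = (nb v)[j])
    (hflag : ∀ w < n, s.fld 15 w = 0) :
    ∃ t os, HExec B β preprocess s t ∧ Ordered n L st nb os t ∧ os.length = n ∧
      (∀ d < n, t.fld 2 d = d ∧ t.fld 3 d = d) ∧ t.time ≤ s.time + 8 + 19 * (n + L) := by
  obtain ⟨t1, x1, d1, m1⟩ := resetHeaders_exec (B := B) (β := β) (by omega) h0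
  obtain ⟨t2, x2, d2, b2, m2⟩ := fillBuckets_exec (B := B) (β := β) (s := t1) hI hB hβ
    (by rw [x1.reg_eq rfl, h0]) (by rw [x1.raw_eq rfl]; exact hptr) d1
  have r2 : t2.raw = s.raw := by rw [x2.raw_eq rfl, x1.raw_eq rfl]
  have hw : Wp B β (.while (rg 2) (rg 0) select) (fun t => ∃ os, Ordered n L st nb os t ∧ os.length = n ∧
      t.time ≤ t2.time + 2 + 14 * os.length + 19 * (os.map fun v => (nb v).length).sum)
      (t2.setReg 2 0) := by
    refine wp_while (fun j t => ∃ os, os.length + j = n ∧ Ordered n L st nb os t ∧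
      t.time ≤ t2.time + 1 + 14 * os.length + 19 * (os.map fun v => (nb v).length).sum) n ⟨[], ?_⟩ ?_ ?_ ?_
    · refine ⟨by simp, ⟨⟨?_, ?_, ?_, ?_, by simp, ?_, ?_, by simp [prev], by simp [prev], ?_, ?_⟩,
        by simp, by simp, by simp, by simp, by simp, by simp⟩, by simp⟩
      · simp [x2.reg_eq (r := 0) rfl, x1.reg_eq (r := 0) rfl, h0]
      · simp [x2.reg_eq (r := 1) rfl, x1.reg_eq (r := 1) rfl, h1]
      · simpa [r2] using hptr
      · simpa [r2] using hadj
      · simpa [x2.fld_eq (k := 15) rfl, x1.fld_eq (k := 15) rfl] using hflag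
      · intro w hw; simp [(d2 w hw).2, prev]
      · intro w hw _; simp [(d2 w hw).1, left]
      · exact b2.congr rfl rfl (fun _ _ _ => rfl) fun _ _ => by simp
    · intros; simp
    · rintro j t ⟨os, hj, ho, htm⟩ hlt
      simp only [Expr.eval, ho.count, ho.sorting.num] at hlt
      obtain ⟨t', v, x', o', m'⟩ := select_exec (B := B) (β := β) (s := t.tick) hI hB hβ hlt
        ⟨ho.sorting.congr rfl rfl rfl rfl rfl rfl rfl rfl rfl, ho.nodup, ho.lt, ho.count, ho.first,
          ho.last, ho.least⟩
      refine ⟨t', x', j - 1, by omega, os ++ [v], by simp; omega, o', ?_⟩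
      simp only [List.map_append, List.sum_append, List.length_append, List.map_cons, List.map_nil,
        List.sum_cons, List.sum_nil, List.length_cons, List.length_nil]
      rw [HState.tick_time] at m'
      omega
    · rintro j t ⟨os, hj, ho, htm⟩ hlt
      simp only [Expr.eval, ho.count, ho.sorting.num] at hlt
      exact ⟨os, ⟨ho.sorting.congr rfl rfl rfl rfl rfl rfl rfl rfl rfl, ho.nodup, ho.lt, ho.count,
        ho.first, ho.last, ho.least⟩, by omega, by rw [HState.tick_time]; omega⟩
  obtain ⟨t3, x3, os, o3, hos, m3⟩ := hw
  obtain ⟨t4, x4, d4, m4⟩ := resetHeaders_exec (B := B) (β := β) (s := t3) (by omega) o3.sorting.num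
  -- The ordering is a permutation of the vertices, so the degrees along it add up to the total
  -- length of the blocks, which is `L - (n + 2)`.
  have hsum : (os.map fun v => (nb v).length).sum + n + 2 = L := by
    rw [((perm_range o3.nodup o3.lt hos).map _).sum_eq]
    have : ∀ m ≤ n, ((List.range m).map fun v => (nb v).length).sum + n + 2 = st m := by
      intro m hm
      induction m with
      | zero => simp [hI.zero]
      | succ m ih =>
        rw [List.range_succ, List.map_append, List.sum_append, hI.succ m hm, ← ih (by omega)]
        simp; omega
    rw [this n le_rfl, hI.total]
  refine ⟨t4, os, .seq x1 (.seq x2 (.seq (.assign (by simp)) (.seq x3 x4))),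
    ⟨⟨?_, ?_, ?_, ?_, ?_, ?_, ?_, ?_, ?_, ?_, fun _ => [], fam_nil d4, fun d _ c => ?_⟩, o3.nodup, o3.lt,
      ?_, ?_, ?_, o3.least⟩, hos, d4, by omega⟩
  · rw [x4.reg_eq rfl]; exact o3.sorting.num
  · rw [x4.reg_eq rfl]; exact o3.sorting.len
  · rw [x4.raw_eq rfl]; exact o3.sorting.ptr
  · rw [x4.raw_eq rfl]; exact o3.sorting.adj
  · rw [x4.raw_eq rfl]; exact o3.sorting.name
  · rw [x4.fld_eq rfl]; exact o3.sorting.flag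
  · rw [x4.fld_eq rfl]; exact o3.sorting.fill
  · rw [x4.fld_eq rfl]; exact o3.sorting.tgt
  · rw [x4.raw_eq rfl]; exact o3.sorting.sadj
  · rw [x4.fld_eq rfl]; exact o3.sorting.deg
  · simp only [List.not_mem_nil, false_iff]
    rintro ⟨w, hw, hwo, -⟩
    exact hwo ((perm_range o3.nodup o3.lt hos).mem_iff.2 (List.mem_range.2 hw))
  · rw [x4.reg_eq rfl]; exact o3.count
  · rw [x4.fld_eq rfl]; exact o3.first
  · rw [x4.fld_eq rfl]; exact o3.last

end InducedSubtrees

namespace InducedSubtrees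

/-! ## Representation of the input -/

/-- The list `l` is stored at the address `a`. -/
def Holds (m : ℕ → ℕ) (a : ℕ) (l : List ℕ) : Prop := ∀ i (hi : i < l.length), m (a + i) = l[i]

theorem holds_cons {m : ℕ → ℕ} {a x : ℕ} {l : List ℕ} :
    Holds m a (x :: l) ↔ m a = x ∧ Holds m (a + 1) l := by
  constructor
  · refine fun h => ⟨h 0 (by simp), fun i hi => ?_⟩
    have := h (i + 1) (by simpa using hi)
    rw [List.getElem_cons_succ] at this
    rw [← this]; congr 1; omega
  · rintro ⟨h1, h2⟩ i hi
    cases i with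
    | zero => exact h1
    | succ i =>
      rw [List.getElem_cons_succ, ← h2 i (by simpa using hi)]; congr 1; omega

theorem holds_append {m : ℕ → ℕ} {a : ℕ} {l l' : List ℕ} :
    Holds m a (l ++ l') ↔ Holds m a l ∧ Holds m (a + l.length) l' := by
  induction l generalizing a with
  | nil => simp [Holds]
  | cons x l ih =>
    rw [List.cons_append, holds_cons, holds_cons, ih, and_assoc, List.length_cons,
      show a + 1 + l.length = a + (l.length + 1) by omega]

theorem holds_flatMap {α : Type*} {m : ℕ → ℕ} {a : ℕ} {l : List α} {f : α → List ℕ} :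
    Holds m a (l.flatMap f) ↔ ∀ i (hi : i < l.length),
      Holds m (a + ((l.take i).map fun x => (f x).length).sum) (f l[i]) := by
  induction l generalizing a with
  | nil => simp [Holds]
  | cons x l ih =>
    rw [List.flatMap_cons, holds_append, ih]
    constructor
    · rintro ⟨h1, h2⟩ i hi
      cases i with
      | zero => simpa using h1
      | succ i => simpa [add_assoc] using h2 i (by simpa using hi)
    · refine fun h => ⟨?_, fun i hi => ?_⟩
      · have := h 0 (by simp)
        rwa [List.getElem_cons_zero, List.take_zero, List.map_nil, List.sum_nil, add_zero] at this
      · have := h (i + 1) (by simpa using hi)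
        rwa [List.getElem_cons_succ, List.take_succ_cons, List.map_cons, List.sum_cons,
          ← add_assoc] at this

section Input

variable {n : ℕ} {G : SimpleGraph (Fin n)}

/-- The position of the list of `v` in the input. -/
def blockStart (adj : Fin n → List (Fin n)) (v : ℕ) : ℕ :=
  n + 2 + (((List.finRange n).take v).map fun v => (adj v).length).sum

/-- The neighbours of `v` as natural numbers. -/
def natAdj (adj : Fin n → List (Fin n)) (v : ℕ) : List ℕ :=
  if h : v < n then (adj ⟨v, h⟩).map Fin.val else []

theorem natAdj_coe (adj : Fin n → List (Fin n)) (v : Fin n) :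
    natAdj adj v = (adj v).map Fin.val := by simp [natAdj]

theorem mem_natAdj {adj : Fin n → List (Fin n)} (h : IsAdjacencyList G adj) {v w : Fin n} :
    (w : ℕ) ∈ natAdj adj v ↔ G.Adj v w := by
  simp [natAdj_coe, (h v).2, Fin.val_inj]

theorem flatAdj_length (adj : Fin n → List (Fin n)) :
    (flatAdj adj).length = ((List.finRange n).map fun v => (adj v).length).sum := by
  simp [flatAdj, List.length_flatMap]

theorem adjInput_length (adj : Fin n → List (Fin n)) :
    (adjInput adj).length = blockStart adj n := by
  rw [blockStart, List.take_of_length_le (by simp), ← flatAdj_length]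
  simp [adjInput]; omega

theorem adjBlocks {adj : Fin n → List (Fin n)} (h : IsAdjacencyList G adj) :
    AdjBlocks n (adjInput adj).length (blockStart adj) (natAdj adj) where
  zero := by simp [blockStart]
  succ v hv := by
    rw [blockStart, blockStart, List.take_add_one, List.getElem?_eq_getElem (by simpa using hv)]
    simp [natAdj, hv, add_assoc]
  total := (adjInput_length adj).symm
  lt v hv w hw := by
    rw [natAdj_coe adj ⟨v, hv⟩, List.mem_map] at hw
    obtain ⟨x, -, rfl⟩ := hw
    exact x.2
  symm v hv w hw := by
    have hw' := hw
    rw [natAdj_coe adj ⟨v, hv⟩, List.mem_map] at hw'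
    obtain ⟨x, -, rfl⟩ := hw'
    exact (mem_natAdj h (v := x) (w := ⟨v, hv⟩)).2 ((mem_natAdj h (v := ⟨v, hv⟩)).1 hw).symm
  irrefl v hv := by
    by_cases hvn : v < n
    · exact G.irrefl ((mem_natAdj h (v := ⟨v, hvn⟩) (w := ⟨v, hvn⟩)).1 hv)
    · simp [natAdj, hvn] at hv
  nodup v hv := by
    rw [natAdj_coe adj ⟨v, hv⟩]
    exact (h _).1.map Fin.val_injective

/-- The sorted lists stored in place of the given ones. -/
theorem holds_flatAdj {m : ℕ → ℕ} {a : ℕ} {adj sadj : Fin n → List (Fin n)}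
    (hlen : ∀ v, (sadj v).length = (adj v).length) :
    Holds m (a + (n + 2)) (flatAdj sadj) ↔
      ∀ v : Fin n, Holds m (a + blockStart adj v) ((sadj v).map Fin.val) := by
  rw [flatAdj, holds_flatMap]
  simp only [List.length_finRange, List.getElem_finRange, List.length_map, hlen, blockStart,
    Fin.cast_mk, add_assoc]
  exact ⟨fun h v => h v v.2, fun h i hi => h ⟨i, hi⟩⟩

theorem holds_adjInput {m : ℕ → ℕ} {adj : Fin n → List (Fin n)} (h : Holds m 0 (adjInput adj)) :
    m 0 = n ∧ (∀ v ≤ n, m (v + 1) = blockStart adj v) ∧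
      ∀ v < n, ∀ j (hj : j < (natAdj adj v).length), m (blockStart adj v + j) = (natAdj adj v)[j] := by
  rw [adjInput, holds_cons, holds_append] at h
  obtain ⟨h1, h2, h3⟩ := h
  refine ⟨h1, fun v hv => ?_, fun v hv j hj => ?_⟩
  · have := h2 v (by simp; omega)
    simp only [List.getElem_map, List.getElem_range] at this
    rw [← blockStart] at this
    rw [← this]; congr 1; omega
  · have h4 : Holds m (0 + (n + 2)) (flatAdj adj) := by
      simp only [List.length_map, List.length_range] at h3
      convert h3 using 1
      omega
    have := (holds_flatAdj fun _ => rfl).1 h4 ⟨v, hv⟩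
    rw [zero_add, ← natAdj_coe] at this
    exact this j hj

theorem adjInput_le {adj : Fin n → List (Fin n)} (h : IsAdjacencyList G adj) :
    ∀ x ∈ adjInput adj, x ≤ (adjInput adj).length := by
  have hI := adjBlocks h
  have h0 := hI.ge le_rfl
  rw [hI.total] at h0
  intro x hx
  simp only [adjInput, List.mem_cons, List.mem_append, List.mem_map, List.mem_range, flatAdj,
    List.mem_flatMap] at hx
  rcases hx with rfl | ⟨i, hi, rfl⟩ | ⟨v, -, w, -, rfl⟩
  · omega
  · rw [← blockStart]
    by_cases hin : i < n
    · exact le_trans (Nat.le_add_right _ _) (hI.bound hin)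
    · obtain rfl : i = n := by omega
      exact hI.total.le
  · have := w.2; omega

theorem adjInput_length_eq {adj : Fin n → List (Fin n)} (h : IsAdjacencyList G adj) :
    (adjInput adj).length = n + 2 + 2 * G.edgeSet.ncard := by
  classical
  have h1 : ∀ v, (adj v).length = G.degree v := fun v => by
    rw [← List.toFinset_card_of_nodup (h v).1, ← G.card_neighborFinset_eq_degree]
    congr 1; ext w; simp [(h v).2]
  have h2 := G.sum_degrees_eq_twice_card_edges
  rw [← Set.ncard_coe_finset, G.coe_edgeFinset] at h2
  rw [adjInput_length, blockStart, List.take_of_length_le (by simp), ← h2,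
    ← List.sum_ofFn, List.ofFn_eq_map]
  simp only [h1]

end Input

end InducedSubtrees

namespace InducedSubtrees

/-! ## From the preprocessing to the enumeration -/

/-- The vertex of rank `i`. -/
def vertexAt (os : List ℕ) (i : ℕ) : ℕ := os.getD i 0

/-- Adjacency of ranks. -/
def adjAt (nb : ℕ → List ℕ) (os : List ℕ) (i j : ℕ) : Bool :=
  decide (vertexAt os j ∈ nb (vertexAt os i))

/-- The position of the list of later neighbours of the vertex of rank `i`. -/
def laterStart (st : ℕ → ℕ) (nb : ℕ → List ℕ) (os : List ℕ) (i : ℕ) : ℕ :=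
  st (vertexAt os i) + (prev nb (os.take i) (vertexAt os i)).length

/-- The blocks are disjoint intervals below `L`. This makes the potential of all vertices, and with
it the trail, linear in the input. -/
theorem Layout.sum_length_le {n L : ℕ} {A : ℕ → ℕ → Bool} {lo : ℕ → ℕ} (h : Layout n L A lo) :
    ∑ v ∈ Finset.range n, (later n A v).length ≤ L := by
  have h1 : ((Finset.range n).biUnion fun v => Finset.Ico (lo v) (lo v + (later n A v).length)) ⊆
      Finset.range L := by
    intro x hx
    simp only [Finset.mem_biUnion, Finset.mem_range, Finset.mem_Ico] at hx ⊢
    obtain ⟨v, hv, h1, h2⟩ := hx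
    exact h2.trans_le (h.bound v hv)
  have h2 := Finset.card_le_card h1
  rw [Finset.card_biUnion, Finset.card_range] at h2
  · simpa using h2
  · intro v hv w hw hvw
    rw [Function.onFun, Finset.disjoint_left]
    intro x hx hx'
    simp only [Finset.coe_range, Set.mem_Iio, Finset.mem_Ico] at hv hw hx hx'
    have := h.sep v hv w hw hvw
    omega

section Ranks

variable {n L : ℕ} {st : ℕ → ℕ} {nb : ℕ → List ℕ} {os : List ℕ}

theorem vertexAt_eq {i : ℕ} (hi : i < os.length) : vertexAt os i = os[i] := by
  simp [vertexAt, hi]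

theorem vertexAt_inj (ho : os.Nodup) {i j : ℕ} (hi : i < os.length) (hj : j < os.length)
    (h : vertexAt os i = vertexAt os j) : i = j := by
  rw [vertexAt_eq hi, vertexAt_eq hj] at h
  exact ho.getElem_inj_iff.1 h

theorem take_eq_map {i : ℕ} (hi : i ≤ os.length) : os.take i = (List.range i).map (vertexAt os) := by
  refine List.ext_getElem (by simp [hi]) fun j h1 h2 => ?_
  simp only [List.length_map, List.length_range] at h2
  simp [vertexAt_eq (show j < os.length by omega)]

theorem prev_take {i w : ℕ} (hi : i ≤ os.length) : prev nb (os.take i) w =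
    ((List.range i).filter fun j => decide (vertexAt os j ∈ nb w)).map (vertexAt os) := by
  rw [prev, take_eq_map hi, List.filter_map]
  rfl

/-- The sorted list of a vertex splits at its own rank, because the vertex is not its own neighbour.
Hence the later neighbours occupy the tail of its block, and no separate lists have to be built for
them. -/
theorem prev_vertexAt (hI : AdjBlocks n L st nb) (hlen : os.length = n) {i : ℕ} (hi : i < n) :
    prev nb os (vertexAt os i) = prev nb (os.take i) (vertexAt os i) ++
      (later n (adjAt nb os) i).map (vertexAt os) := by
  have h1 : prev nb os (vertexAt os i) = prev nb (os.take n) (vertexAt os i) := by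
    rw [← hlen, List.take_length]
  rw [h1, prev_take hlen.ge, prev_take (by omega), ← List.map_append]
  congr 1
  refine List.Pairwise.eq_of_mem_iff (r := (· < ·)) (List.pairwise_lt_range.filter _) ?_ fun x => ?_
  · refine List.pairwise_append.2 ⟨List.pairwise_lt_range.filter _, later_sorted i, ?_⟩
    intro x hx y hy
    simp only [List.mem_filter, List.mem_range] at hx
    exact hx.1.trans (mem_later.1 hy).2.1
  · simp only [List.mem_filter, List.mem_range, List.mem_append, mem_later, adjAt,
      decide_eq_true_eq]
    have : vertexAt os x ∈ nb (vertexAt os i) → x ≠ i := by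
      rintro h rfl; exact hI.irrefl _ h
    constructor
    · rintro ⟨h2, h3⟩
      rcases lt_or_gt_of_ne (this h3) with h4 | h4
      · exact Or.inl ⟨h4, h3⟩
      · exact Or.inr ⟨h2, h4, h3⟩
    · rintro (⟨h2, h3⟩ | ⟨h2, h3, h4⟩)
      · exact ⟨h2.trans hi, h3⟩
      · exact ⟨h2, h4⟩

theorem prev_length (hI : AdjBlocks n L st nb) (ho : os.Nodup) (hlt : ∀ v ∈ os, v < n)
    (hlen : os.length = n) {w : ℕ} (hw : w < n) : (prev nb os w).length = (nb w).length := by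
  refine le_antisymm (prev_length_le ho w)
    (List.subperm_of_subset (hI.nodup w hw) fun v hv => ?_).length_le
  simp only [prev, List.mem_filter, decide_eq_true_eq]
  exact ⟨(perm_range ho hlt hlen).mem_iff.2 (List.mem_range.2 (hI.lt w hw v hv)), hv⟩

theorem laterStart_add (hI : AdjBlocks n L st nb) (ho : os.Nodup) (hlt : ∀ v ∈ os, v < n)
    (hlen : os.length = n) {i : ℕ} (hi : i < n) :
    laterStart st nb os i + (later n (adjAt nb os) i).length =
      st (vertexAt os i) + (nb (vertexAt os i)).length := by
  have hv : vertexAt os i < n := by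
    rw [vertexAt_eq (by omega)]; exact hlt _ (List.getElem_mem _)
  have h := congrArg List.length (prev_vertexAt hI hlen hi)
  rw [prev_length hI ho hlt hlen hv, List.length_append, List.length_map] at h
  rw [laterStart]; omega

theorem layout (hI : AdjBlocks n L st nb) (ho : os.Nodup) (hlt : ∀ v ∈ os, v < n)
    (hlen : os.length = n) : Layout n L (adjAt nb os) (laterStart st nb os) := by
  have hv : ∀ i < n, vertexAt os i < n := fun i hi => by
    rw [vertexAt_eq (by omega)]; exact hlt _ (List.getElem_mem _)
  refine ⟨fun i hi => ?_, fun i hi j hj hij => ?_⟩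
  · rw [laterStart_add hI ho hlt hlen hi]
    exact hI.bound (hv i hi)
  · rw [laterStart_add hI ho hlt hlen hi, laterStart_add hI ho hlt hlen hj]
    have h1 := hI.sep (hv i hi) (hv j hj) fun h => hij (vertexAt_inj ho (by omega) (by omega) h)
    simp only [laterStart]
    omega

theorem Ordered.static {s : HState} (hI : AdjBlocks n L st nb) (h : Ordered n L st nb os s)
    (hlen : os.length = n) :
    Static n L (adjAt nb os) (laterStart st nb os) (vertexAt os) s := by
  have hv : ∀ i < n, vertexAt os i < n := fun i hi => by
    rw [vertexAt_eq (by omega)]; exact h.lt _ (List.getElem_mem _)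
  refine ⟨h.sorting.num, h.sorting.len, fun i hi => ?_, fun i hi => ?_, fun i hi j hj => ?_,
    fun i hi => ?_⟩
  · rw [h.first i (by omega), laterStart, vertexAt_eq (by omega)]
  · rw [h.last i (by omega), laterStart_add hI h.nodup h.lt hlen hi, vertexAt_eq (by omega)]
  · have h1 := prev_vertexAt hI hlen hi
    have h2 := h.sorting.tgt _ (hv i hi) ((prev nb (os.take i) (vertexAt os i)).length + j)
      (by rw [h1]; simpa using hj)
    simp only [h1] at h2
    rw [List.getElem_append_right (by omega)] at h2
    simp only [Nat.add_sub_cancel_left, List.getElem_map] at h2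
    rw [laterStart, add_assoc, h2]
    have h3 : (later n (adjAt nb os) i)[j] < os.length := by
      rw [hlen]; exact (mem_later.1 (List.getElem_mem hj)).1
    rw [vertexAt_eq h3, h.nodup.idxOf_getElem]
  · rw [h.sorting.name i (by omega), vertexAt_eq (by omega)]

theorem fresh_empty {A : ℕ → ℕ → Bool} {lo : ℕ → ℕ} {s : HState} (h0 : ∀ v < n, s.fld 0 v = 0)
    (hd : ∀ d < n, s.fld 2 d = d ∧ s.fld 3 d = d) : Fresh n A lo ∅ s := by
  refine ⟨by simp, by simpa using h0, (fam_nil hd).congr fun w _ => ?_, by simp⟩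
  simp [earlierIn]

end Ranks

section Order

variable {n : ℕ} {G : SimpleGraph (Fin n)}

/-- The positions of the vertices in a list of all vertices. -/
theorem exists_pos {os : List ℕ} (ho : os.Nodup) (hlt : ∀ v ∈ os, v < n) (hlen : os.length = n) :
    ∃ pos : Fin n ≃ Fin n, ∀ i : Fin n, (pos.symm i : ℕ) = vertexAt os i := by
  have hv : ∀ i < n, vertexAt os i < n := fun i hi => by
    rw [vertexAt_eq (by omega)]; exact hlt _ (List.getElem_mem _)
  have hinj : Function.Injective fun i : Fin n => (⟨vertexAt os i, hv i i.2⟩ : Fin n) := by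
    intro i j hij
    exact Fin.ext (vertexAt_inj ho (by omega) (by omega) (congrArg Fin.val hij))
  exact ⟨(Equiv.ofBijective _ (Finite.injective_iff_bijective.1 hinj)).symm, fun i => rfl⟩

variable {adj : Fin n → List (Fin n)} {os : List ℕ} {pos : Fin n ≃ Fin n}

/-- The adjacency lists sorted by the ordering. -/
def sortedAdj (adj : Fin n → List (Fin n)) (pos : Fin n ≃ Fin n) (v : Fin n) : List (Fin n) :=
  ((List.finRange n).filter fun i => decide (pos.symm i ∈ adj v)).map pos.symm

theorem isAdjacencyList_sortedAdj (h : IsAdjacencyList G adj) :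
    IsAdjacencyList G (sortedAdj adj pos) := by
  refine fun v => ⟨((List.nodup_finRange n).filter _).map pos.symm.injective, fun w => ?_⟩
  rw [← (h v).2, sortedAdj, List.mem_map]
  constructor
  · rintro ⟨i, hi, rfl⟩
    simpa using hi
  · exact fun hw => ⟨pos w, by simpa using hw, by simp⟩

theorem sortedAdj_pairwise (v : Fin n) :
    (sortedAdj adj pos v).Pairwise fun a b => pos a < pos b := by
  rw [sortedAdj, List.pairwise_map]
  simp only [Equiv.apply_symm_apply]
  exact (List.pairwise_lt_finRange n).filter _

theorem sortedAdj_length (h : IsAdjacencyList G adj) (v : Fin n) :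
    (sortedAdj adj pos v).length = (adj v).length := by
  refine List.Perm.length_eq ((List.perm_ext_iff_of_nodup
    (isAdjacencyList_sortedAdj h v).1 (h v).1).2 fun w => ?_)
  rw [(isAdjacencyList_sortedAdj h v).2, (h v).2]

theorem order_eq (hlen : os.length = n) (hpos : ∀ i : Fin n, (pos.symm i : ℕ) = vertexAt os i) :
    os = (List.finRange n).map fun i => (pos.symm i : ℕ) := by
  refine List.ext_getElem (by simp [hlen]) fun i h1 h2 => ?_
  simp [hpos, vertexAt_eq h1]

theorem sortedAdj_map (hlen : os.length = n)
    (hpos : ∀ i : Fin n, (pos.symm i : ℕ) = vertexAt os i) (v : Fin n) :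
    (sortedAdj adj pos v).map Fin.val = prev (natAdj adj) os v := by
  rw [prev, order_eq hlen hpos, List.filter_map, sortedAdj, List.map_map]
  congr 1
  refine List.filter_congr fun i _ => ?_
  simp [natAdj_coe, Fin.val_inj]

theorem vertexAt_pos (hpos : ∀ i : Fin n, (pos.symm i : ℕ) = vertexAt os i) (v : Fin n) :
    vertexAt os (pos v) = v := by rw [← hpos, Equiv.symm_apply_apply]

theorem adjAt_pos (h : IsAdjacencyList G adj) (hpos : ∀ i : Fin n, (pos.symm i : ℕ) = vertexAt os i)
    (u v : Fin n) : adjAt (natAdj adj) os (pos u) (pos v) = true ↔ G.Adj u v := by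
  rw [adjAt, vertexAt_pos hpos, vertexAt_pos hpos, decide_eq_true_iff, mem_natAdj h]

theorem mem_take_iff (ho : os.Nodup) (hlen : os.length = n)
    (hpos : ∀ i : Fin n, (pos.symm i : ℕ) = vertexAt os i) {v : Fin n} {i : ℕ} (hi : i ≤ n) :
    (v : ℕ) ∈ os.take i ↔ (pos v : ℕ) < i := by
  rw [take_eq_map (by omega), List.mem_map]
  constructor
  · rintro ⟨j, hj, hjv⟩
    rw [List.mem_range] at hj
    rw [← vertexAt_pos hpos v] at hjv
    rwa [← vertexAt_inj ho (by omega) (by omega) hjv]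
  · exact fun h => ⟨pos v, List.mem_range.2 h, vertexAt_pos hpos v⟩

theorem left_length (h : IsAdjacencyList G adj) (ho : os.Nodup) (hlen : os.length = n)
    (hpos : ∀ i : Fin n, (pos.symm i : ℕ) = vertexAt os i) (u v : Fin n) :
    (left (natAdj adj) (os.take (pos u)) v).length =
      adjCount G (Finset.univ.filter fun w => pos u ≤ pos w) v := by
  classical
  rw [left, natAdj_coe, List.filter_map, List.length_map,
    ← List.toFinset_card_of_nodup ((h v).1.filter _), adjCount]
  congr 1
  ext w
  simp only [List.mem_toFinset, List.mem_filter, Function.comp, decide_eq_true_eq, (h v).2,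
    mem_take_iff ho hlen hpos (pos u).2.le, Finset.mem_filter, Finset.mem_univ, true_and, Fin.le_def,
    not_lt]
  exact and_comm

theorem Ordered.isMatulaBeckOrder {L : ℕ} {st : ℕ → ℕ} {s : HState} (h : IsAdjacencyList G adj)
    (hs : Ordered n L st (natAdj adj) os s) (hlen : os.length = n)
    (hpos : ∀ i : Fin n, (pos.symm i : ℕ) = vertexAt os i) : IsMatulaBeckOrder G pos := by
  intro u v huv
  have hu : (pos u : ℕ) < os.length := by omega
  have h1 := hs.least (pos u) hu v v.2 (by
    rw [mem_take_iff hs.nodup hlen hpos (pos u).2.le]; exact not_lt.2 huv)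
  rwa [← vertexAt_eq hu, vertexAt_pos hpos, left_length h hs.nodup hlen hpos,
    left_length h hs.nodup hlen hpos] at h1

/-- This is where the degeneracy enters the time bound: the later neighbours of `u` are among the
vertices counted in the subgraph induced by `u` and its successors, where `u` has minimum degree. -/
theorem later_length_le (h : IsAdjacencyList G adj) (hMB : IsMatulaBeckOrder G pos)
    (hpos : ∀ i : Fin n, (pos.symm i : ℕ) = vertexAt os i) {i : ℕ} (hi : i < n) :
    (later n (adjAt (natAdj adj) os) i).length ≤ degeneracy G := by
  classical
  obtain ⟨u, rfl⟩ : ∃ u, (pos u : ℕ) = i := ⟨pos.symm ⟨i, hi⟩, by simp⟩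
  refine le_trans ?_ (hMB.adjCount_le u)
  rw [← List.toFinset_card_of_nodup (later_nodup _), adjCount]
  refine le_trans (Finset.card_le_card (t := Finset.image (fun w => (pos w : ℕ)) _) ?_)
    Finset.card_image_le
  intro x hx
  rw [List.mem_toFinset] at hx
  obtain ⟨w, rfl⟩ : ∃ w, (pos w : ℕ) = x := ⟨pos.symm ⟨x, (mem_later.1 hx).1⟩, by simp⟩
  obtain ⟨h1, h2⟩ := (mem_later_iff (adjAt_pos h hpos) u w).1 hx
  exact Finset.mem_image_of_mem _ (by simp [h1.le, h2])

end Order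

end InducedSubtrees

namespace InducedSubtrees

/-! ## The programs -/

/-- Load the number of vertices and the length `L` of the input, and set the base address to
`2 * L`. -/
def loadSizes : Prog :=
  .seq (.instr (.load (hreg 0) 0)) <| .seq (.instr (.const (tmp 0) 1)) <|
  .seq (.instr (.add (tmp 0) (tmp 0) (hreg 0))) <| .seq (.instr (.load (hreg 1) (tmp 0))) <|
  .instr (.add 0 (hreg 1) (hreg 1))

/-- The last of the `n + 1` pointers, in cell `n + 1`, is the length of the input, so it need not be
scanned. Cells from twice that length on are zero and form the empty arrays. -/
theorem loadSizes_exec {l : List ℕ} {n : ℕ} (h0 : l.getD 0 0 = n)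
    (h1 : l.getD (n + 1) 0 = l.length) (hn : n + 2 ≤ l.length) (hle : ∀ x ∈ l, x ≤ l.length)
    {B : ℕ} (hB : l.length ≤ B) :
    ∃ s h, Exec loadSizes (State.init l) s ∧ Rep B (2 * l.length) h s ∧ h.Bounded B ∧
      h.reg 0 = n ∧ h.reg 1 = l.length ∧ (∀ k i, h.fld k i = 0) ∧ (∀ i, h.raw i = l.getD i 0) ∧
      h.out = [] ∧ h.time = 0 ∧ s.time = 5 := by
  have h0' : l[0]?.getD 0 = n := by simpa using h0
  have h1' : l[1 + n]?.getD 0 = l.length := by rw [add_comm]; simpa using h1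
  refine ⟨_, ⟨fun r => if r = 0 then n else if r = 1 then l.length else 0, fun _ _ => 0,
    fun i => l.getD i 0, [], 0⟩, .seq (.instr _ _) (.seq (.instr _ _) (.seq (.instr _ _)
    (.seq (.instr _ _) (.instr _ _)))), ⟨?_, fun r => ?_, fun k _ i => ?_, fun i _ => ?_, ?_, ?_, ?_⟩,
    ⟨fun r => ?_, fun _ _ => Nat.zero_le _, fun i => ?_⟩, by simp, by simp, fun _ _ => rfl, fun _ => rfl,
    rfl, rfl, rfl⟩
  all_goals simp only [Instr.run, State.tick, State.setReg, State.touch, State.init, hreg, tmp,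
    Function.update_apply]
  all_goals norm_num [h0', h1']
  · omega
  · split_ifs <;> omega
  · rw [List.getElem?_eq_none (by omega)]; rfl
  · omega
  · omega
  · split_ifs <;> omega
  · by_cases hi : i < l.length
    · rw [List.getElem?_eq_getElem hi]
      exact (hle _ (List.getElem_mem hi)).trans hB
    · rw [List.getElem?_eq_none (by omega)]; exact Nat.zero_le _

theorem reported_eq {n : ℕ} {ev : List Event} {Ls : List (Finset (Fin n))} (h : Reports ∅ ev Ls) :
    reported ev = Ls.map fun S => S.map Fin.valEmbedding := h.1

theorem two_phases {n : ℕ} {G : SimpleGraph (Fin n)} {adj : Fin n → List (Fin n)}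
    (h : IsAdjacencyList G adj) : ∃ (s₁ s₂ : State) (pos : Fin n ≃ Fin n) (Ls : List (Finset (Fin n))),
      Exec (.seq loadSizes preprocess.code) (State.init (adjInput adj)) s₁ ∧
      s₁.time ≤ (5 + 46 * preprocess.cost) * (n + G.edgeSet.ncard + 1) ∧ s₁.out = [] ∧
      IsMatulaBeckOrder G pos ∧ s₁.Stores ((List.finRange n).map fun i => (pos.symm i).val) ∧
      s₁.Stores (flatAdj (sortedAdj adj pos)) ∧ Exec enumerate.code s₁ s₂ ∧
      ISE G pos ∅ Finset.univ ∅ Ls ∧ reported s₂.out = Ls.map (fun S => S.map Fin.valEmbedding) ∧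
      s₂.time ≤ s₁.time + 118 * enumerate.cost * max 1 (degeneracy G) * Ls.length ∧
      s₂.space ≤ 410 * (n + G.edgeSet.ncard + 1) ∧ s₂.width ≤ 410 * (n + G.edgeSet.ncard + 1) := by
  obtain ⟨L, hL⟩ : ∃ L, L = (adjInput adj).length := ⟨_, rfl⟩
  have hLm := adjInput_length_eq h
  have hI := adjBlocks h
  obtain ⟨i0, iptr, iadj⟩ := holds_adjInput (m := fun i => (adjInput adj).getD i 0) (adj := adj)
    fun i hi => by simp [hi]
  -- The bound `5 * n + 2 * L + 18` leaves room for the trail, of length at most `5 * n + 2 * L +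
  -- 1`, and for the numbers up to `16 + n + 2 * L` of the preprocessing.
  obtain ⟨s0, h0, x0, r0, b0, h00, h01, h0f, h0r, h0o, h0t, s0t⟩ := loadSizes_exec
    (B := 5 * n + 2 * L + 18) i0 (by rw [iptr n le_rfl, hI.total]) (by omega) (adjInput_le h) (by omega)
  rw [← hL] at hLm hI r0 h01
  -- preprocessing
  obtain ⟨h1, os, y1, ho, hlen, hd, h1t⟩ := preprocess_exec (B := 5 * n + 2 * L + 18) (β := 2 * L) (s := h0)
    hI (by omega) le_rfl h00 h01 (fun v hv => by rw [h0r]; exact iptr v hv)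
    (fun v hv j hj => by rw [h0r]; exact iadj v hv j hj) (fun w _ => h0f 15 w)
  obtain ⟨s1, x1, r1, s1t⟩ := y1.code_exec b0 le_rfl r0
  have b1 := y1.bounded b0
  have h1o : h1.out = [] := by rw [y1.out_eq rfl, h0o]
  obtain ⟨pos, hpos⟩ := exists_pos ho.nodup ho.lt hlen
  have hMB := ho.isMatulaBeckOrder h hlen hpos
  -- enumeration
  have hlay := layout hI ho.nodup ho.lt hlen
  have hstat := ho.static hI hlen
  have hsum := hlay.sum_length_le
  -- The potential of all vertices is `4 * n` plus twice the number of entries in the blocks of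
  -- later neighbours, which is at most `L`; the candidate list adds at most `n`.
  have hpot : pot n (adjAt (natAdj adj) os) (Finset.range n) + n + 1 ≤ 5 * n + 2 * L + 1 := by
    rw [pot, Finset.sum_add_distrib, ← Finset.mul_sum]
    simp only [Finset.sum_const, Finset.card_range, smul_eq_mul]
    omega
  obtain ⟨h2, Ls, ev, y2, hise, h2o, hrep, h2t⟩ := enumerate_exec (B := 5 * n + 2 * L + 18)
    (β := 2 * L) (P := 5 * n + 2 * L + 1) (K := max 1 (degeneracy G)) (G := G) (pos := pos) hlay
    (by omega) (by omega) (le_max_left _ _)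
    (fun v hv => (later_length_le h hMB hpos hv).trans (le_max_right _ _)) (by omega)
    (vertexAt_pos hpos) (adjAt_pos h hpos) hpot hstat
    (fresh_empty (fun v _ => by rw [y1.fld_eq rfl, h0f]) hd)
  obtain ⟨s2, x2, r2, s2t⟩ := y2.code_exec b1 le_rfl r1
  refine ⟨s1, s2, pos, Ls, .seq x0 x1, ?_, by rw [r1.out, h1o], hMB, ⟨L, fun i hi => ?_⟩,
    ⟨L + (n + 2), ?_⟩, x2, hise, ?_, ?_, r2.space.trans ?_, r2.width.trans ?_⟩
  -- With `L = n + 2 + 2 * m` for `m` edges, `8 + 19 * (n + L)` equals `46 + 38 * n + 38 * m`. The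
  -- summand `5` is the time of `loadSizes`.
  · have h3 : preprocess.cost * h1.time ≤ preprocess.cost * (46 * (n + G.edgeSet.ncard + 1)) :=
      Nat.mul_le_mul_left _ (by omega)
    have h4 : (5 + 46 * preprocess.cost) * (n + G.edgeSet.ncard + 1) =
      5 * (n + G.edgeSet.ncard + 1) + preprocess.cost * (46 * (n + G.edgeSet.ncard + 1)) := by ring
    rw [h0t, s0t] at s1t
    omega
  · rw [r1.raw _ (by simp at hi; omega)]
    have := ho.sorting.name i (by simp at hi; omega)
    rw [this]
    simp only [← order_eq hlen hpos]
  · refine (holds_flatAdj (sortedAdj_length h)).2 fun v => ?_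
    rw [sortedAdj_map hlen hpos]
    intro j hj
    have h3 := prev_length_le (nb := natAdj adj) ho.nodup v
    have h4 := hI.bound v.2
    rw [r1.raw _ (by omega), add_assoc]
    exact ho.sorting.sadj v v.2 j hj
  · rw [r2.out, h2o, h1o, List.nil_append, reported_eq hrep]
  -- The empty set is always reported. With `N = Ls.length` and `1 ≤ K`, the bound `1 + (112 * K +
  -- 5) * N` is then at most `118 * K * N`.
  · have hpos' : 1 ≤ Ls.length := List.length_pos_of_mem
      ((hise.start_correct.2 ∅).2 isInducedSubtree_empty)
    have hK : 1 ≤ max 1 (degeneracy G) := le_max_left _ _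
    generalize max 1 (degeneracy G) = K at *
    have h3 : h2.time ≤ h1.time + 118 * K * Ls.length := by nlinarith
    have h4 := Nat.mul_le_mul_left enumerate.cost h3
    rw [Nat.mul_add] at h4
    have h5 : 118 * enumerate.cost * K * Ls.length = enumerate.cost * (118 * K * Ls.length) := by ring
    omega
  -- For `B = 5 * n + 2 * L + 18` and `β = 2 * L`, the limit `17 * B + β + 32` of `Rep` equals `121
  -- * n + 72 * m + 410`, where `m` is the number of edges.
  · omega
  · omega

end InducedSubtrees

/-! ### The theorem: a common constant for time and space -/

theorem mainTheorem1 :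
    ∃ (pre enum : InducedSubtrees.Prog) (C : ℕ),
      ∀ (n : ℕ) (G : SimpleGraph (Fin n)) (adj : Fin n → List (Fin n)),
        InducedSubtrees.IsAdjacencyList G adj →
        ∃ (s₁ s₂ : InducedSubtrees.State) (pos : Fin n ≃ Fin n)
          (sadj : Fin n → List (Fin n)) (L : List (Finset (Fin n))),
          -- preprocessing: a Matula–Beck ordering and adjacency lists sorted by it, no output
          InducedSubtrees.Exec pre
            (InducedSubtrees.State.init (InducedSubtrees.adjInput adj)) s₁ ∧
          s₁.time ≤ C * (n + G.edgeSet.ncard + 1) ∧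
          s₁.out = [] ∧
          InducedSubtrees.IsMatulaBeckOrder G pos ∧
          s₁.Stores ((List.finRange n).map (fun i => (pos.symm i).val)) ∧
          InducedSubtrees.IsAdjacencyList G sadj ∧
          (∀ v, (sadj v).Pairwise (fun a b => pos a < pos b)) ∧
          s₁.Stores (InducedSubtrees.flatAdj sadj) ∧
          -- enumeration: the output is that of the binary partition procedure
          InducedSubtrees.Exec enum s₁ s₂ ∧
          InducedSubtrees.ISE G pos ∅ Finset.univ ∅ L ∧
          InducedSubtrees.reported s₂.out = L.map (fun S => S.map Fin.valEmbedding) ∧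
          -- all induced subtrees, without duplicates
          L.Nodup ∧
          (∀ S : Finset (Fin n), S ∈ L ↔ InducedSubtrees.IsInducedSubtree G S) ∧
          -- amortized time per solution
          s₂.time ≤ s₁.time + C * max 1 (InducedSubtrees.degeneracy G) *
            {S : Finset (Fin n) | InducedSubtrees.IsInducedSubtree G S}.ncard ∧
          -- space, counted in words that hold numbers of linear size
          s₂.space ≤ C * (n + G.edgeSet.ncard + 1) ∧
          s₂.width ≤ C * (n + G.edgeSet.ncard + 1) := by
  open InducedSubtrees in
  refine ⟨.seq loadSizes preprocess.code, enumerate.code,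
    5 + 46 * preprocess.cost + 118 * enumerate.cost + 410, fun n G adj h => ?_⟩
  obtain ⟨s₁, s₂, pos, L, h1, h2, h3, h4, h5, h6, h7, h8, h9, h10, h11, h12⟩ :=
    two_phases h
  obtain ⟨hnd, hmem⟩ := h8.start_correct
  have hN : {S : Finset (Fin n) | IsInducedSubtree G S}.ncard = L.length := by
    rw [← List.toFinset_card_of_nodup hnd, ← Set.ncard_coe_finset]
    congr 1
    ext S
    simp [hmem]
  refine ⟨s₁, s₂, pos, sortedAdj adj pos, L, h1, h2.trans (Nat.mul_le_mul_right _ ?_), h3, h4,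
    h5, isAdjacencyList_sortedAdj h, sortedAdj_pairwise, h6, h7, h8,
    h9, hnd, hmem, h10.trans ?_, h11.trans (Nat.mul_le_mul_right _ ?_),
    h12.trans (Nat.mul_le_mul_right _ ?_)⟩
  · omega
  · rw [hN]
    exact Nat.add_le_add_left (Nat.mul_le_mul_right _ (Nat.mul_le_mul_right _ (by omega))) _
  · omega
  · omega
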